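/- Let $\mathbb F$ be $\mathbb R$ or $\mathbb C$, and let $\Phi=\operatorname{ind\,lim}_{n}\Phi_n$ be a (strict) (LB)-space: $(\Phi_n)$ is a sequence of Banach spaces over $\mathbb F$, each $\Phi_n$ is a subspace of $\Phi_{n+1}$ with the restricted norm, and $\Phi=\bigcup_n\Phi_n$ carries the locally convex inductive limit topology. Let $\Phi'$ be the dual of $\Phi$, and let $\Phi^{\hat\odot k}=\operatorname{ind\,lim}_n\Phi_n^{\hat\odot k}$, where $\Phi_n^{\hat\odot k}$ is the $k$th symmetric injective tensor power of $\Phi_n$ (and $\Phi^{\hat\odot 0}=\mathbb F$). Write $\mathcal L(V,W)$ for the continuous linear operators from $V$ to $W$. Let $\mathcal P(\Phi')$ be the space of polynomials $p(\omega)=\sum_{k=0}^K\langle\omega^{\otimes k},f^{(k)}\rangle$ on $\Phi'$, $f^{(k)}\in\Phi^{\hat\odot k}$, with the topology of the locally convex direct sum of the spaces $\Phi^{\hat\odot k}$. Let $\mathbb M(\Phi)$ be the set of all continuous linear operators $P$ on $\mathcal P(\Phi')$ such that, for all $k$ and all $f\in\Phi^{\hat\odot k}$, $P\langle\cdot^{\otimes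 k},f\rangle-\langle\cdot^{\otimes k},f\rangle$ is a polynomial of degree less than $k$ (zero if $k=0$), and let $\mathbb V(\Phi)$ be the space of all continuous linear operators on $\mathcal P(\Phi')$ that map polynomials of degree at most $n$ to polynomials of degree at most $n-1$ for every $n\ge0$ (to $0$ if $n=0$). For $V\in\mathbb V(\Phi)$ put $\exp(V)=\sum_{n\ge0}\frac1{n!}V^n$, which is a finite sum on each polynomial. Let $\mathcal W_0(\Phi)$ be the set of formal series $\alpha(\xi)=\sum_{k\ge1}\alpha_k\xi^{\otimes k}$ with $\alpha_k\in(\Phi^{\hat\odot k})'$, and $\mathcal W_1(\Phi)$ the set of formal series $\beta(\xi)=\sum_{k\ge2}\beta_k\xi^{\otimes k}$ with $\beta_k\in\mathcal L(\Phi^{\hat\odot k},\Phi)$. An operator $P\in\mathbb M(\Phi)$ is called a Sheffer operator if there are $A(\xi)=1+\sum_{k\ge1}A_k\xi^{\otimes k}$ and $B(\xi)=\xi+\sum_{k\ge2}B_k\xi^{\otimes k}$, with $A-1\in\mathcal W_0(\Phi)$ and $B-\xi\in\mathcal W_1(\Phi)$, such that for every $\omega\in\Phi'$, as formal tensor power series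 in $\xi\in\Phi$, $$\sum_{k=0}^\infty\frac1{k!}\big(P\langle\cdot^{\otimes k},\xi^{\otimes k}\rangle\big)(\omega)=\exp\big[\langle\omega,B(\xi)\rangle\big]A(\xi).$$ For $p\in\mathcal P(\Phi')$ and $\omega\in\Phi'$, let $\nabla^kp(\omega)\in\Phi^{\hat\odot k}$ be the element with $\langle\sigma_1\odot\dots\odot\sigma_k,\nabla^kp(\omega)\rangle=(D_{\sigma_1}\cdots D_{\sigma_k}p)(\omega)$ for all $\sigma_1,\dots,\sigma_k\in\Phi'$, where $D_\sigma$ is the derivative in direction $\sigma$. For $\alpha\in\mathcal W_0(\Phi)$ and $\beta\in\mathcal W_1(\Phi)$ put $$(\alpha(\nabla)p)(\omega)=\sum_{k\ge1}\alpha_k\big(\nabla^kp(\omega)\big),\qquad (M(\beta(\nabla))p)(\omega)=\sum_{k\ge2}\big\langle\omega,\beta_k\big(\nabla^kp(\omega)\big)\big\rangle .$$ Then $\alpha(\nabla)+M(\beta(\nabla))$ is a well-defined element of $\mathbb V(\Phi)$ for all $\alpha\in\mathcal W_0(\Phi)$ and $\beta\in\mathcal W_1(\Phi)$, and an operator $P\in\mathbb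 M(\Phi)$ is a Sheffer operator if and only if there exist $\alpha\in\mathcal W_0(\Phi)$ and $\beta\in\mathcal W_1(\Phi)$ such that $$P=\exp\big[\alpha(\nabla)+M(\beta(\nabla))\big].$$ -/

import Mathlib

set_option maxSynthPendingDepth 3

open scoped Nat

noncomputable section

/-! ### Locally convex inductive limits and (LB)-spaces -/

section InductiveLimit

variable (𝕜 : Type*) [RCLike 𝕜] {ι : Type*} {E : ι → Type*} {V : Type*}
  [∀ i, AddCommGroup (E i)] [∀ i, Module 𝕜 (E i)] [∀ i, TopologicalSpace (E i)]
  [AddCommGroup V] [Module 𝕜 V]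

/-- All seminorms on `V` whose composition with every map `j i : E i → V` is continuous. -/
def limSeminorms (j : ∀ i, E i →ₗ[𝕜] V) :
    SeminormFamily 𝕜 V {p : Seminorm 𝕜 V // ∀ i, Continuous fun x => p (j i x)} :=
  fun p => p.1

/-- The locally convex inductive limit (final) topology on `V` with respect to the linear maps
`j i : E i → V`: the finest locally convex topology for which all `j i` are continuous, that is,
the topology generated by all seminorms on `V` that are continuous along every `j i`. -/
@[reducible]
def indLimTopology (j : ∀ i, E i →ₗ[𝕜] V) : TopologicalSpace V :=
  (limSeminorms 𝕜 j).moduleFilterBasis.topology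

end InductiveLimit

/-- The topological vector space `Φ` is the (strict) (LB)-space `ind lim E n`: each Banach space
`E n` is (through `incl n`) a subspace of `Φ`, `E n` is a subspace of `E (n + 1)` with the
restricted norm, `Φ` is the union of the `E n`, and the topology of `Φ` is the locally convex
inductive limit topology. -/
structure LBSpace (𝕜 : Type*) [RCLike 𝕜] (E : ℕ → Type*)
    [∀ n, NormedAddCommGroup (E n)] [∀ n, NormedSpace 𝕜 (E n)] [∀ n, CompleteSpace (E n)]
    (Φ : Type*) [AddCommGroup Φ] [Module 𝕜 Φ] [TopologicalSpace Φ] where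
  incl : ∀ n, E n →L[𝕜] Φ
  incl_injective : ∀ n, Function.Injective (incl n)
  step : ∀ n, E n →ₗᵢ[𝕜] E (n + 1)
  incl_step : ∀ n x, incl (n + 1) (step n x) = incl n x
  exists_incl : ∀ ξ : Φ, ∃ n x, incl n x = ξ
  topology_eq : ‹TopologicalSpace Φ› = indLimTopology 𝕜 fun n => (incl n : E n →ₗ[𝕜] Φ)

/-! ### Injective tensor powers of a Banach space -/

section Tensor

variable (𝕜 : Type*) [RCLike 𝕜] (B : Type*) [NormedAddCommGroup B] [NormedSpace 𝕜 B]

/-- The elementary tensor `b₁ ⊗ ⋯ ⊗ b_k`, as the `k`-linear form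
`(ω₁, …, ω_k) ↦ ω₁(b₁) ⋯ ω_k(b_k)` on the dual of `B`. -/
def elemTensor {k : ℕ} (b : Fin k → B) :
    ContinuousMultilinearMap 𝕜 (fun _ : Fin k => StrongDual 𝕜 B) 𝕜 :=
  (ContinuousMultilinearMap.mkPiAlgebra 𝕜 (Fin k) 𝕜).compContinuousLinearMap
    fun i => NormedSpace.inclusionInDoubleDual 𝕜 B (b i)

/-- The `k`th injective tensor power of `B`. The injective norm of `u` in the algebraic tensor power
is the supremum of `|(ω₁ ⊗ ⋯ ⊗ ω_k)(u)|` over `ω_i` in the dual unit ball, that is, the norm of the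
form `(ω₁, …, ω_k) ↦ (ω₁ ⊗ ⋯ ⊗ ω_k)(u)`; hence the completion is the closure of the
span of the elementary tensors in the Banach space of bounded `k`-linear forms on the dual. -/
def injTensorPow (k : ℕ) :
    Submodule 𝕜 (ContinuousMultilinearMap 𝕜 (fun _ : Fin k => StrongDual 𝕜 B) 𝕜) :=
  (Submodule.span 𝕜 (Set.range (elemTensor 𝕜 B (k := k)))).topologicalClosure

/-- The `k`th symmetric injective tensor power of `B`: the tensors that are invariant under all
permutations of the factors (equivalently, the range of the symmetrization operator), normed as
a subspace of the injective tensor power. -/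
def symTensorPow (k : ℕ) :
    Submodule 𝕜 (ContinuousMultilinearMap 𝕜 (fun _ : Fin k => StrongDual 𝕜 B) 𝕜) where
  carrier := {T | T ∈ injTensorPow 𝕜 B k ∧ ∀ s : Equiv.Perm (Fin k), T.domDomCongr s = T}
  add_mem' := fun {S T} hS hT => ⟨add_mem hS.1 hT.1, fun s => by
    conv_rhs => rw [← hS.2 s, ← hT.2 s]
    rfl⟩
  zero_mem' := ⟨zero_mem _, fun _ => rfl⟩
  smul_mem' := fun c T hT => ⟨Submodule.smul_mem _ c hT.1, fun s => by
    conv_rhs => rw [← hT.2 s]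
    rfl⟩

variable {𝕜 B}

theorem elemTensor_apply {k : ℕ} (b : Fin k → B) (ω : Fin k → StrongDual 𝕜 B) :
    elemTensor 𝕜 B b ω = ∏ i, ω i (b i) := by
  simp [elemTensor]

theorem elemTensor_const_mem {k : ℕ} (b : B) :
    elemTensor 𝕜 B (fun _ : Fin k => b) ∈ symTensorPow 𝕜 B k := by
  refine ⟨Submodule.le_topologicalClosure _ (Submodule.subset_span ⟨_, rfl⟩), fun s => ?_⟩
  ext ω
  simp only [ContinuousMultilinearMap.domDomCongr_apply, elemTensor_apply]
  exact Equiv.prod_comp s fun i => ω i b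

/-- Insertion of `τ` into the last slot, as a bounded operator. -/
def lastContr (n : ℕ) (τ : StrongDual 𝕜 B) :
    ContinuousMultilinearMap 𝕜 (fun _ : Fin (n + 1) => StrongDual 𝕜 B) 𝕜 →L[𝕜]
      ContinuousMultilinearMap 𝕜 (fun _ : Fin n => StrongDual 𝕜 B) 𝕜 :=
  (ContinuousLinearMap.compContinuousMultilinearMapL 𝕜 (fun _ : Fin n => StrongDual 𝕜 B)
    (StrongDual 𝕜 B →L[𝕜] 𝕜) 𝕜 (ContinuousLinearMap.apply 𝕜 𝕜 τ)).comp
    (continuousMultilinearCurryRightEquiv 𝕜 (fun _ : Fin (n + 1) => StrongDual 𝕜 B) 𝕜 :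
      _ →L[𝕜] _)

theorem lastContr_apply (n : ℕ) (τ : StrongDual 𝕜 B)
    (T : ContinuousMultilinearMap 𝕜 (fun _ : Fin (n + 1) => StrongDual 𝕜 B) 𝕜)
    (ω : Fin n → StrongDual 𝕜 B) :
    lastContr n τ T ω = T (Fin.snoc ω τ : Fin (n + 1) → StrongDual 𝕜 B) := rfl

theorem lastContr_mem {n : ℕ} (τ : StrongDual 𝕜 B)
    {T : ContinuousMultilinearMap 𝕜 (fun _ : Fin (n + 1) => StrongDual 𝕜 B) 𝕜}
    (hT : T ∈ symTensorPow 𝕜 B (n + 1)) : lastContr n τ T ∈ symTensorPow 𝕜 B n := by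
  refine ⟨?_, fun s => ?_⟩
  · have h : injTensorPow 𝕜 B (n + 1) ≤
        (injTensorPow 𝕜 B n).comap (lastContr n τ : _ →ₗ[𝕜] _) := by
      refine Submodule.topologicalClosure_minimal _ (Submodule.span_le.2 ?_) ?_
      · rintro _ ⟨b, rfl⟩
        have : lastContr n τ (elemTensor 𝕜 B b) =
            τ (b (Fin.last n)) • elemTensor 𝕜 B fun i : Fin n => b i.castSucc := by
          ext ω
          rw [lastContr_apply, elemTensor_apply, Fin.prod_univ_castSucc]
          simp [elemTensor_apply, mul_comm]
        change lastContr n τ (elemTensor 𝕜 B b) ∈ injTensorPow 𝕜 B n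
        rw [this]
        exact Submodule.smul_mem _ _
          (Submodule.le_topologicalClosure _ (Submodule.subset_span ⟨_, rfl⟩))
      · exact (Submodule.isClosed_topologicalClosure _).preimage (lastContr n τ).continuous
    exact h hT.1
  · ext ω
    rw [ContinuousMultilinearMap.domDomCongr_apply, lastContr_apply, lastContr_apply]
    let e : Equiv.Perm (Fin (n + 1)) :=
      finSuccEquivLast.trans ((Equiv.optionCongr s).trans finSuccEquivLast.symm)
    have key := congrArg (fun S => S (Fin.snoc ω τ : Fin (n + 1) → StrongDual 𝕜 B)) (hT.2 e)
    simp only [ContinuousMultilinearMap.domDomCongr_apply] at key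
    rw [← key]
    congr 1
    funext i
    refine Fin.lastCases ?_ (fun i => ?_) i <;> simp [e]

end Tensor

/-! ### Symmetric tensor powers of an (LB)-space -/

namespace LBSpace

variable {𝕜 : Type*} [RCLike 𝕜] {E : ℕ → Type*}
  [∀ n, NormedAddCommGroup (E n)] [∀ n, NormedSpace 𝕜 (E n)] [∀ n, CompleteSpace (E n)]
  {Φ : Type*} [AddCommGroup Φ] [Module 𝕜 Φ] [TopologicalSpace Φ]
  (L : LBSpace 𝕜 E Φ)

/-- Restriction of a functional on `Φ` to the Banach space `E n`. -/
def restr (n : ℕ) : StrongDual 𝕜 Φ →ₗ[𝕜] StrongDual 𝕜 (E n) where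
  toFun ω := ω.comp (L.incl n)
  map_add' _ _ := rfl
  map_smul' _ _ := rfl

/-- A `k`-tensor `T` over `E n`, regarded as the `k`-linear form
`(ω₁, …, ω_k) ↦ ⟨ω₁ ⊗ ⋯ ⊗ ω_k, T⟩` on the dual `Φ'`. Every functional on `E n` extends to `Φ`, so
this is injective, and it is compatible with the inclusions of the tensor powers of `E n` into those
of `E (n + 1)`. -/
def toForm (n k : ℕ) : symTensorPow 𝕜 (E n) k →ₗ[𝕜]
    MultilinearMap 𝕜 (fun _ : Fin k => StrongDual 𝕜 Φ) 𝕜 where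
  toFun T := T.1.toMultilinearMap.compLinearMap fun _ => L.restr n
  map_add' _ _ := rfl
  map_smul' _ _ := rfl

/-- The union over `n` of the `k`th symmetric injective tensor powers of the spaces `E n`. -/
def symPowSubmodule (k : ℕ) :
    Submodule 𝕜 (MultilinearMap 𝕜 (fun _ : Fin k => StrongDual 𝕜 Φ) 𝕜) :=
  ⨆ n, LinearMap.range (L.toForm n k)

/-- The (LB)-space `Φ^{⊙k}`, the `k`th symmetric injective tensor power of `Φ`. An element `f` is
represented by the form `(ω₁, …, ω_k) ↦ ⟨ω₁ ⊗ ⋯ ⊗ ω_k, f⟩` on `Φ'`. -/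
def SymPow (k : ℕ) : Type _ := L.symPowSubmodule k

instance (k : ℕ) : AddCommGroup (L.SymPow k) :=
  inferInstanceAs (AddCommGroup (L.symPowSubmodule k))

instance (k : ℕ) : Module 𝕜 (L.SymPow k) :=
  inferInstanceAs (Module 𝕜 (L.symPowSubmodule k))

/-- The inclusion of the `k`th symmetric tensor power of `E n` into that of `Φ`. -/
def toSymPow (n k : ℕ) : symTensorPow 𝕜 (E n) k →ₗ[𝕜] L.SymPow k :=
  (L.toForm n k).codRestrict (L.symPowSubmodule k) fun T =>
    Submodule.mem_iSup_of_mem n ⟨T, rfl⟩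

/-- `Φ^{⊙k}` carries the inductive limit topology of the symmetric tensor powers of the `E n`. -/
instance (k : ℕ) : TopologicalSpace (L.SymPow k) :=
  indLimTopology 𝕜 fun n => L.toSymPow n k

variable {L} in
/-- The pairing `⟨ω₁ ⊗ ⋯ ⊗ ω_k, f⟩`. -/
def pair {k : ℕ} (f : L.SymPow k) (ω : Fin k → StrongDual 𝕜 Φ) : 𝕜 := f.1 ω

variable {L} in
theorem symPow_ext {k : ℕ} {f g : L.SymPow k} (h : ∀ ω, pair f ω = pair g ω) : f = g :=
  Subtype.ext (MultilinearMap.ext h)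

theorem pair_toSymPow (n : ℕ) {k : ℕ} (T : symTensorPow 𝕜 (E n) k)
    (ω : Fin k → StrongDual 𝕜 Φ) :
    pair (L.toSymPow n k T) ω = T.1 fun i => L.restr n (ω i) := rfl

theorem pow_mem (k : ℕ) (ξ : Φ) :
    (MultilinearMap.mkPiAlgebra 𝕜 (Fin k) 𝕜).compLinearMap
      (fun _ => (ContinuousLinearMap.coeLM 𝕜 : StrongDual 𝕜 Φ →ₗ[𝕜] _).flip ξ) ∈
      L.symPowSubmodule k := by
  obtain ⟨n, x, rfl⟩ := L.exists_incl ξ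
  refine Submodule.mem_iSup_of_mem n ⟨⟨_, elemTensor_const_mem x⟩, ?_⟩
  ext ω
  rw [MultilinearMap.compLinearMap_apply, MultilinearMap.mkPiAlgebra_apply]
  exact elemTensor_apply _ _

/-- The tensor power `ξ^{⊗k}`, that is, the form `(ω₁, …, ω_k) ↦ ω₁(ξ) ⋯ ω_k(ξ)`. -/
def pow (k : ℕ) (ξ : Φ) : L.SymPow k := ⟨_, L.pow_mem k ξ⟩

theorem pair_pow (k : ℕ) (ξ : Φ) (ω : Fin k → StrongDual 𝕜 Φ) :
    pair (L.pow k ξ) ω = ∏ i, ω i ξ := by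
  simp [pair, pow]

/-! ### Polynomials on the dual -/

/-- The monomial `ω ↦ ⟨ω^{⊗k}, f⟩`, as a function on `Φ'`. -/
def monoFun (k : ℕ) : L.SymPow k →ₗ[𝕜] (StrongDual 𝕜 Φ → 𝕜) where
  toFun f ω := pair f fun _ => ω
  map_add' _ _ := rfl
  map_smul' _ _ := rfl

/-- The functions `ω ↦ ∑_{k ≤ K} ⟨ω^{⊗k}, f_k⟩` on `Φ'`. -/
def polySubmodule : Submodule 𝕜 (StrongDual 𝕜 Φ → 𝕜) :=
  ⨆ k, LinearMap.range (L.monoFun k)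

/-- The space `𝒫(Φ')` of polynomials on `Φ'`. -/
def Poly : Type _ := L.polySubmodule

instance : AddCommGroup L.Poly := inferInstanceAs (AddCommGroup L.polySubmodule)

instance : Module 𝕜 L.Poly := inferInstanceAs (Module 𝕜 L.polySubmodule)

instance : CoeFun L.Poly fun _ => StrongDual 𝕜 Φ → 𝕜 := ⟨Subtype.val⟩

/-- The monomial `⟨·^{⊗k}, f⟩` as an element of `𝒫(Φ')`. -/
def mono (k : ℕ) : L.SymPow k →ₗ[𝕜] L.Poly :=
  (L.monoFun k).codRestrict L.polySubmodule fun f => Submodule.mem_iSup_of_mem k ⟨f, rfl⟩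

/-- `𝒫(Φ')` carries the topology of the locally convex direct sum of the spaces `Φ^{⊙k}`: the finest
locally convex topology for which all the maps `f ↦ ⟨·^{⊗k}, f⟩` are continuous. -/
instance : TopologicalSpace L.Poly := indLimTopology 𝕜 L.mono

/-- The polynomials of degree less than `n` (only `0` if `n = 0`). -/
def polyLT (n : ℕ) : Submodule 𝕜 L.Poly := ⨆ k : Fin n, LinearMap.range (L.mono k)

/-! ### Powers of the gradient -/

/-- The iterated directional derivative `D_{σ₁} ⋯ D_{σ_k} q` of a function `q` on `Φ'`. -/
def iterD : ∀ k : ℕ, (Fin k → StrongDual 𝕜 Φ) → (StrongDual 𝕜 Φ → 𝕜) → StrongDual 𝕜 Φ → 𝕜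
  | 0, _, q => q
  | k + 1, σ, q => iterD k (Fin.init σ) fun ω => lineDeriv 𝕜 q ω (σ (Fin.last k))

variable {L}

theorem symPow_induction {k : ℕ} {motive : L.SymPow k → Prop} (zero : motive 0)
    (add : ∀ f g, motive f → motive g → motive (f + g))
    (incl : ∀ n T, motive (L.toSymPow n k T)) (f : L.SymPow k) : motive f := by
  obtain ⟨f, hf⟩ := f
  refine Submodule.iSup_induction' _ (motive := fun f hf => motive ⟨f, hf⟩) ?_ zero
    (fun f g hf hg h h' => add ⟨f, hf⟩ ⟨g, hg⟩ h h') hf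
  rintro n _ ⟨T, rfl⟩
  exact incl n T

@[simp] theorem pair_add {k : ℕ} (f g : L.SymPow k) (ω : Fin k → StrongDual 𝕜 Φ) :
    pair (f + g) ω = pair f ω + pair g ω := rfl

@[simp] theorem pair_zero {k : ℕ} (ω : Fin k → StrongDual 𝕜 Φ) :
    pair (0 : L.SymPow k) ω = 0 := rfl

@[simp] theorem pair_smul {k : ℕ} (c : 𝕜) (f : L.SymPow k) (ω : Fin k → StrongDual 𝕜 Φ) :
    pair (c • f) ω = c * pair f ω := rfl

theorem pair_perm {k : ℕ} (f : L.SymPow k) (s : Equiv.Perm (Fin k))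
    (ω : Fin k → StrongDual 𝕜 Φ) : pair f (fun i => ω (s i)) = pair f ω := by
  induction f using symPow_induction with
  | zero => rfl
  | add f g hf hg => rw [pair_add, pair_add, hf, hg]
  | incl n T =>
    rw [pair_toSymPow, pair_toSymPow]
    exact congrArg (fun S => S fun i => L.restr n (ω i)) (T.2.2 s)

theorem exists_contr {n : ℕ} (f : L.SymPow (n + 1)) (τ : StrongDual 𝕜 Φ) :
    ∃ g : L.SymPow n, ∀ ω : Fin n → StrongDual 𝕜 Φ,
      pair g ω = pair f (Fin.snoc ω τ : Fin (n + 1) → StrongDual 𝕜 Φ) := by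
  induction f using symPow_induction with
  | zero => exact ⟨0, fun _ => rfl⟩
  | add f g hf hg =>
    obtain ⟨f', hf⟩ := hf
    obtain ⟨g', hg⟩ := hg
    exact ⟨f' + g', fun ω => by rw [pair_add, pair_add, hf, hg]⟩
  | incl m T =>
    refine ⟨L.toSymPow m n ⟨_, lastContr_mem (L.restr m τ) T.2⟩, fun ω => ?_⟩
    rw [pair_toSymPow, pair_toSymPow, lastContr_apply]
    congr 1
    funext i
    refine Fin.lastCases ?_ (fun i => ?_) i <;> simp

theorem hasLineDerivAt_monoFun {n : ℕ} (f : L.SymPow (n + 1)) (ω τ : StrongDual 𝕜 Φ) :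
    HasLineDerivAt 𝕜 (L.monoFun (n + 1) f)
      ((n + 1) * pair f (Fin.snoc (fun _ => ω) τ : Fin (n + 1) → StrongDual 𝕜 Φ)) ω τ := by
  induction f using symPow_induction with
  | zero => simpa [HasLineDerivAt] using hasDerivAt_const (0 : 𝕜) (0 : 𝕜)
  | add f g hf hg =>
    rw [pair_add, mul_add, map_add]
    exact HasDerivAt.add hf hg
  | incl m T =>
    rw [pair_toSymPow]
    have h1 : HasDerivAt (fun (t : 𝕜) (_ : Fin (n + 1)) => L.restr m ω + t • L.restr m τ)
        (fun _ => L.restr m τ) 0 := by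
      rw [hasDerivAt_pi]
      intro _
      simpa using ((hasDerivAt_id (0 : 𝕜)).smul_const (L.restr m τ)).const_add (L.restr m ω)
    have h2 := (T.1.hasFDerivAt (fun _ => L.restr m ω + (0 : 𝕜) • L.restr m τ)).comp_hasDerivAt
      (0 : 𝕜) h1
    have h3 : T.1.linearDeriv (fun _ => L.restr m ω + (0 : 𝕜) • L.restr m τ)
        (fun _ => L.restr m τ) = (n + 1) * T.1 fun i => L.restr m
          ((Fin.snoc (fun _ => ω) τ : Fin (n + 1) → StrongDual 𝕜 Φ) i) := by
      rw [ContinuousMultilinearMap.linearDeriv_apply]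
      have : ∀ i ∈ (Finset.univ : Finset (Fin (n + 1))),
          T.1 (Function.update (fun _ => L.restr m ω + (0 : 𝕜) • L.restr m τ) i (L.restr m τ)) =
          T.1 fun i => L.restr m
            ((Fin.snoc (fun _ => ω) τ : Fin (n + 1) → StrongDual 𝕜 Φ) i) := by
        intro i _
        rw [← pair_toSymPow, ← pair_perm _ (Equiv.swap i (Fin.last n)), pair_toSymPow]
        congr 1
        funext j
        by_cases hj : j = i
        · subst hj
          simp
        · have : Equiv.swap i (Fin.last n) j ≠ Fin.last n := by
            intro h
            rw [Equiv.swap_apply_eq_iff, Equiv.swap_apply_right] at h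
            exact hj h
          rw [Function.update_of_ne hj, ← Fin.castSucc_castPred _ this, Fin.snoc_castSucc]
          simp
      rw [Finset.sum_congr rfl this]
      simp
    rw [h3] at h2
    refine HasDerivAt.congr_of_eventuallyEq h2 (Filter.Eventually.of_forall fun t => ?_)
    change T.1 (fun _ => L.restr m (ω + t • τ)) = T.1 fun _ => L.restr m ω + t • L.restr m τ
    rw [map_add, map_smul]

theorem lineDeriv_monoFun_succ {n : ℕ} (f : L.SymPow (n + 1)) (τ : StrongDual 𝕜 Φ) :
    ∃ g : L.SymPow n, (∀ ω : Fin n → StrongDual 𝕜 Φ,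
      pair g ω = (n + 1) * pair f (Fin.snoc ω τ : Fin (n + 1) → StrongDual 𝕜 Φ)) ∧
      ∀ ω, HasLineDerivAt 𝕜 (L.monoFun (n + 1) f) (L.monoFun n g ω) ω τ := by
  obtain ⟨g, hg⟩ := exists_contr f τ
  refine ⟨((n : 𝕜) + 1) • g, fun ω => by rw [pair_smul, hg], fun ω => ?_⟩
  have := hasLineDerivAt_monoFun f ω τ
  rwa [← hg] at this

theorem lineDeriv_monoFun_zero (f : L.SymPow 0) (ω τ : StrongDual 𝕜 Φ) :
    HasLineDerivAt 𝕜 (L.monoFun 0 f) 0 ω τ := by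
  refine HasDerivAt.congr_of_eventuallyEq (hasDerivAt_const (0 : 𝕜) (pair f ![]))
    (Filter.Eventually.of_forall fun t => ?_)
  exact congrArg (pair f) (Subsingleton.elim _ _)

theorem exists_lineDeriv {q : StrongDual 𝕜 Φ → 𝕜} (hq : q ∈ L.polySubmodule)
    (τ : StrongDual 𝕜 Φ) :
    ∃ q' ∈ L.polySubmodule, ∀ ω, HasLineDerivAt 𝕜 q (q' ω) ω τ := by
  refine Submodule.iSup_induction _ (motive := fun q => ∃ q' ∈ L.polySubmodule,
    ∀ ω, HasLineDerivAt 𝕜 q (q' ω) ω τ) hq ?_ ?_ ?_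
  · rintro (_ | n) _ ⟨f, rfl⟩
    · exact ⟨0, zero_mem _, fun ω => lineDeriv_monoFun_zero f ω τ⟩
    · obtain ⟨g, -, hg⟩ := lineDeriv_monoFun_succ f τ
      exact ⟨_, Submodule.mem_iSup_of_mem n ⟨g, rfl⟩, hg⟩
  · exact ⟨0, zero_mem _, fun ω => hasDerivAt_const (0 : 𝕜) (0 : 𝕜)⟩
  · rintro q r ⟨q', hq', hq⟩ ⟨r', hr', hr⟩
    exact ⟨q' + r', add_mem hq' hr', fun ω => HasDerivAt.add (hq ω) (hr ω)⟩

theorem iterD_zero (k : ℕ) (σ : Fin k → StrongDual 𝕜 Φ) :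
    iterD k σ (0 : StrongDual 𝕜 Φ → 𝕜) = 0 := by
  induction k with
  | zero => rfl
  | succ k ih =>
    have : (fun ω => lineDeriv 𝕜 (0 : StrongDual 𝕜 Φ → 𝕜) ω (σ (Fin.last k))) = 0 := by
      funext ω
      exact (hasDerivAt_const (0 : 𝕜) (0 : 𝕜)).deriv
    rw [iterD, this, ih]

theorem iterD_add (k : ℕ) (σ : Fin k → StrongDual 𝕜 Φ) {q r : StrongDual 𝕜 Φ → 𝕜}
    (hq : q ∈ L.polySubmodule) (hr : r ∈ L.polySubmodule) :
    iterD k σ (q + r) = iterD k σ q + iterD k σ r := by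
  induction k generalizing q r with
  | zero => rfl
  | succ k ih =>
    obtain ⟨q', hq', hq⟩ := exists_lineDeriv hq (σ (Fin.last k))
    obtain ⟨r', hr', hr⟩ := exists_lineDeriv hr (σ (Fin.last k))
    have h1 : (fun ω => lineDeriv 𝕜 q ω (σ (Fin.last k))) = q' :=
      funext fun ω => (hq ω).lineDeriv
    have h2 : (fun ω => lineDeriv 𝕜 r ω (σ (Fin.last k))) = r' :=
      funext fun ω => (hr ω).lineDeriv
    have h3 : (fun ω => lineDeriv 𝕜 (q + r) ω (σ (Fin.last k))) = q' + r' :=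
      funext fun ω => (HasDerivAt.add (hq ω) (hr ω)).deriv
    rw [iterD, iterD, iterD, h1, h2, h3, ih _ hq' hr']

/-- The tuple `(σ₁, …, σ_k, ω, …, ω)` of length `n`. -/
def fill {k : ℕ} (n : ℕ) (σ : Fin k → StrongDual 𝕜 Φ) (ω : StrongDual 𝕜 Φ) :
    Fin n → StrongDual 𝕜 Φ :=
  fun i => if h : (i : ℕ) < k then σ ⟨i, h⟩ else ω

theorem pair_fill_succ {k n : ℕ} (hk : k ≤ n) (f : L.SymPow (n + 1))
    (σ : Fin (k + 1) → StrongDual 𝕜 Φ) (ω : StrongDual 𝕜 Φ) :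
    pair f (Fin.snoc (fill n (Fin.init σ) ω) (σ (Fin.last k)) : Fin (n + 1) → StrongDual 𝕜 Φ) =
      pair f (fill (n + 1) σ ω) := by
  rw [← pair_perm f (Equiv.swap ⟨k, by omega⟩ (Fin.last n)) (fill (n + 1) σ ω)]
  congr 1
  funext i
  refine Fin.lastCases ?_ (fun i => ?_) i
  · rw [Fin.snoc_last, Equiv.swap_apply_right]
    simp [fill, Fin.last]
  · rw [Fin.snoc_castSucc]
    by_cases hi : (i : ℕ) = k
    · have : i.castSucc = ⟨k, by omega⟩ := Fin.ext hi
      rw [this, Equiv.swap_apply_left]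
      have hn : k < n := hi ▸ i.2
      simp [fill, hi]
      omega
    · rw [Equiv.swap_apply_of_ne_of_ne (fun h => hi (congrArg Fin.val h)) (Fin.castSucc_ne_last i)]
      have : (i : ℕ) < k ↔ (i : ℕ) < k + 1 := by omega
      simp only [fill, Fin.val_castSucc]
      by_cases h : (i : ℕ) < k
      · rw [dif_pos h, dif_pos (this.1 h)]
        rfl
      · rw [dif_neg h, dif_neg (mt this.2 h)]

theorem iterD_monoFun (k n : ℕ) (f : L.SymPow n) (σ : Fin k → StrongDual 𝕜 Φ)
    (ω : StrongDual 𝕜 Φ) :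
    iterD k σ (L.monoFun n f) ω = (n.descFactorial k : 𝕜) * pair f (fill n σ ω) := by
  induction k generalizing n with
  | zero =>
    rw [iterD, Nat.descFactorial_zero, Nat.cast_one, one_mul]
    exact congrArg (pair f) (by funext i; simp [fill])
  | succ k ih =>
    cases n with
    | zero =>
      have : (fun ω => lineDeriv 𝕜 (L.monoFun 0 f) ω (σ (Fin.last k))) = 0 :=
        funext fun ω => (lineDeriv_monoFun_zero f ω _).lineDeriv
      rw [iterD, this, iterD_zero]
      simp
    | succ n =>
      obtain ⟨g, hg, hg'⟩ := lineDeriv_monoFun_succ f (σ (Fin.last k))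
      have : (fun ω => lineDeriv 𝕜 (L.monoFun (n + 1) f) ω (σ (Fin.last k))) = L.monoFun n g :=
        funext fun ω => (hg' ω).lineDeriv
      rw [iterD, this, ih, hg, Nat.succ_descFactorial_succ]
      by_cases hk : k ≤ n
      · rw [pair_fill_succ hk]
        push_cast
        ring
      · simp [Nat.descFactorial_of_lt (not_le.1 hk)]

theorem exists_fill (j : ℕ) {k n : ℕ} (hn : n = k + j) (f : L.SymPow n) (ω : StrongDual 𝕜 Φ) :
    ∃ g : L.SymPow k, ∀ σ : Fin k → StrongDual 𝕜 Φ, pair g σ = pair f (fill n σ ω) := by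
  induction j generalizing n with
  | zero =>
    subst hn
    exact ⟨f, fun σ => congrArg (pair f) (by funext i; simp [fill])⟩
  | succ j ih =>
    subst hn
    obtain ⟨g, hg⟩ := exists_contr (n := k + j) f ω
    obtain ⟨g', hg'⟩ := ih rfl g
    refine ⟨g', fun σ => ?_⟩
    rw [hg', hg]
    congr 1
    funext i
    refine Fin.lastCases ?_ (fun i => ?_) i <;> simp [fill]

theorem exists_grad (k : ℕ) (p : L.Poly) (ω : StrongDual 𝕜 Φ) :
    ∃ g : L.SymPow k, ∀ σ : Fin k → StrongDual 𝕜 Φ, pair g σ = iterD k σ p ω := by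
  obtain ⟨p, hp⟩ := p
  change ∃ g : L.SymPow k, ∀ σ : Fin k → StrongDual 𝕜 Φ, pair g σ = iterD k σ p ω
  refine Submodule.iSup_induction' _ (motive := fun p _ => ∃ g : L.SymPow k,
    ∀ σ : Fin k → StrongDual 𝕜 Φ, pair g σ = iterD k σ p ω) ?_ ?_ ?_ hp
  · rintro n _ ⟨f, rfl⟩
    by_cases hk : k ≤ n
    · obtain ⟨g, hg⟩ := exists_fill (n - k) (by omega : n = k + (n - k)) f ω
      exact ⟨(n.descFactorial k : 𝕜) • g, fun σ => by rw [pair_smul, hg, iterD_monoFun]⟩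
    · refine ⟨0, fun σ => ?_⟩
      rw [iterD_monoFun, Nat.descFactorial_of_lt (not_le.1 hk)]
      simp
  · exact ⟨0, fun σ => by rw [iterD_zero]; rfl⟩
  · rintro q r hq hr ⟨g, hg⟩ ⟨h, hh⟩
    exact ⟨g + h, fun σ => by rw [pair_add, hg, hh, iterD_add k σ hq hr]; rfl⟩

/-- The `k`th power of the gradient of `p` at `ω`: the unique element `∇^k p(ω)` of `Φ^{⊙k}` with
`⟨σ₁ ⊙ ⋯ ⊙ σ_k, ∇^k p(ω)⟩ = D_{σ₁} ⋯ D_{σ_k} p(ω)` for all `σ₁, …, σ_k ∈ Φ'`. -/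
def grad (k : ℕ) (p : L.Poly) (ω : StrongDual 𝕜 Φ) : L.SymPow k := (exists_grad k p ω).choose

theorem pair_grad (k : ℕ) (p : L.Poly) (ω : StrongDual 𝕜 Φ) (σ : Fin k → StrongDual 𝕜 Φ) :
    pair (grad k p ω) σ = iterD k σ p ω := (exists_grad k p ω).choose_spec σ

variable (L)

/-! ### Formal tensor power series and the operators `α(∇)`, `M(β(∇))` -/

/-- The space `𝒲₀(Φ)` of formal tensor power series `∑_{k ≥ 1} α_k ξ^{⊗k}` with
`α_k ∈ (Φ^{⊙k})'`; the term `α k` is the coefficient with index `k + 1`. -/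
abbrev W0 : Type _ := ∀ k : ℕ, L.SymPow (k + 1) →L[𝕜] 𝕜

/-- The space `𝒲₁(Φ)` of formal tensor power series `∑_{k ≥ 2} β_k ξ^{⊗k}` with
`β_k ∈ ℒ(Φ^{⊙k}, Φ)`; the term `β k` is the coefficient with index `k + 2`. -/
abbrev W1 : Type _ := ∀ k : ℕ, L.SymPow (k + 2) →L[𝕜] Φ

variable {L}

/-- The function `α(∇)p : ω ↦ ∑_{k ≥ 1} α_k(∇^k p(ω))` (a finite sum). -/
def alphaNabla (α : L.W0) (p : L.Poly) (ω : StrongDual 𝕜 Φ) : 𝕜 :=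
  ∑ᶠ k : ℕ, α k (grad (k + 1) p ω)

/-- The function `M(β(∇))p : ω ↦ ∑_{k ≥ 2} ⟨ω, β_k(∇^k p(ω))⟩` (a finite sum). -/
def mulBetaNabla (β : L.W1) (p : L.Poly) (ω : StrongDual 𝕜 Φ) : 𝕜 :=
  ∑ᶠ k : ℕ, ω (β k (grad (k + 2) p ω))

/-- `V` is the operator `α(∇) + M(β(∇))` on `𝒫(Φ')`. -/
def IsGenerator (V : L.Poly →L[𝕜] L.Poly) (α : L.W0) (β : L.W1) : Prop :=
  ∀ (p : L.Poly) (ω : StrongDual 𝕜 Φ), V p ω = alphaNabla α p ω + mulBetaNabla β p ω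

/-! ### Operators on polynomials -/

/-- The class `𝕄(Φ)`: the continuous operators `P` on `𝒫(Φ')` with
`P⟨·^{⊗k}, f⟩ = ⟨·^{⊗k}, f⟩ + (a polynomial of degree less than k)` for all `f ∈ Φ^{⊙k}`. -/
def IsMonic (P : L.Poly →L[𝕜] L.Poly) : Prop :=
  ∀ (k : ℕ) (f : L.SymPow k), P (L.mono k f) - L.mono k f ∈ L.polyLT k

/-- The class `𝕍(Φ)`: the continuous operators on `𝒫(Φ')` that map every polynomial of degree at
most `n` to a polynomial of degree at most `n - 1` (to `0` if `n = 0`). -/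
def LowersDegree (V : L.Poly →L[𝕜] L.Poly) : Prop :=
  ∀ (n : ℕ), ∀ p ∈ L.polyLT (n + 1), V p ∈ L.polyLT n

/-- `exp(V) p = ∑_{n ≥ 0} V^n p / n!`, a finite sum if `V` lowers the degree. -/
def expOp (V : L.Poly →L[𝕜] L.Poly) (p : L.Poly) : L.Poly :=
  ∑ᶠ n : ℕ, ((n ! : 𝕜)⁻¹) • ((V : L.Poly →ₗ[𝕜] L.Poly) ^ n) p

/-- The generating function `G(ω, ξ) = ∑_k P⟨·^{⊗k}, ξ^{⊗k}⟩(ω) / k!` of `P`. As everywhere below, a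
formal tensor power series `C(ξ) = ∑_k C_k ξ^{⊗k}` is given through the formal power
series `C(sξ) = ∑_k s^k C_k ξ^{⊗k}` in `s`, for all `ξ ∈ Φ`; continuous `C_k` are determined by
their values on the tensor powers `ξ^{⊗k}`. -/
def genFun (P : L.Poly →L[𝕜] L.Poly) (ω : StrongDual 𝕜 Φ) (ξ : Φ) : PowerSeries 𝕜 :=
  PowerSeries.mk fun k => (k ! : 𝕜)⁻¹ * P (L.mono k (L.pow k ξ)) ω

/-- The element `A(ξ) = 1 + ∑_{k ≥ 1} A_k ξ^{⊗k}` of `ℱ₀(Φ)`, graded by the degree in `ξ`. -/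
def seriesF0 (A : L.W0) (ξ : Φ) : PowerSeries 𝕜 :=
  PowerSeries.mk fun
    | 0 => 1
    | k + 1 => A k (L.pow (k + 1) ξ)

/-- The series `⟨ω, B(ξ)⟩`, graded by the degree in `ξ`, for the element
`B(ξ) = ξ + ∑_{k ≥ 2} B_k ξ^{⊗k}` of `ℱ₁(Φ)`. -/
def pairSeriesF1 (B : L.W1) (ω : StrongDual 𝕜 Φ) (ξ : Φ) : PowerSeries 𝕜 :=
  PowerSeries.mk fun
    | 0 => 0
    | 1 => ω ξ
    | k + 2 => ω (B k (L.pow (k + 2) ξ))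

/-- `P` is a Sheffer operator: `G(ω, ξ) = exp[⟨ω, B(ξ)⟩] A(ξ)` for some `A ∈ ℱ₀(Φ)` and
`B ∈ ℱ₁(Φ)`, as formal tensor power series in `ξ` for every `ω ∈ Φ'`. -/
def IsSheffer (P : L.Poly →L[𝕜] L.Poly) : Prop :=
  IsMonic P ∧ ∃ (A : L.W0) (B : L.W1), ∀ (ω : StrongDual 𝕜 Φ) (ξ : Φ),
    genFun P ω ξ = (PowerSeries.exp 𝕜).subst (pairSeriesF1 B ω ξ) * seriesF0 A ξ

end LBSpace

end

/-! By polarization, continuous operators on `L.Poly` are determined by their values on polynomials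
`p(⟨·, ξ⟩)` in one linear form, so the exponentials `e^{⟨·, ξ⟩}` serve as formal test functions. `P`
acts on them through its generating function: `P(p(⟨·, ξ⟩))(ω)` is `G(ω, ξ)(d/dx) p` at `0`
(`apply_ofLinear_eq_genFun`).

For a monic `P`, the Sheffer form `G = exp⟨ω, B(ξ)⟩ A(ξ)` is equivalent to `SolvesODE P`: formally
`D_σ P e^{⟨·, ξ⟩} = b P e^{⟨·, ξ⟩}` with a series `b` in `d/dx`, or again, `P⁻¹ D_σ P` commutes with
all derivatives (is shift-invariant). One direction differentiates `G` along `σ`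
(`solvesODE_of_genFun`); the other is Taylor's formula `q(ω) = (exp(D_ω) q)(0)`, with the continuous
coefficients `A`, `B` recovered in `isSheffer_of_solvesODE`.

Since `P - 1` lowers the degree, `P = exp(V)` with `V` the logarithm of `P` (`IsMonic.exists_log`).
The core is that all `exp(-V) D_σ exp(V)` are shift-invariant exactly when all commutators `[D_σ,
V]` are. If the commutators are, the Jacobi identity keeps the iterated ones shift-invariant, and
`exp(-V) D_σ exp(V)` is a locally finite sum of these (`isShiftInvariant_conj_exp`). Conversely,
conjugation by `P` preserves shift-invariance, so every `exp(-nV) D_σ exp(nV)` commutes with `D_ρ`.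
This is a polynomial identity in `n`, and its linear coefficient is `[[D_σ, V], D_ρ] = 0`
(`commute_rightAd_of_conj`).

Finally, a degree-lowering `V` has shift-invariant commutators exactly when `V = α(∇) + M(β(∇))`:
the commutator of `D_σ` with `M(β(∇))` is `⟨σ, β(∇)⟩`, while `α` and `β` are read off from the
constant and linear parts of `V e^{⟨·, ξ⟩}` (`exists_isGenerator_of_rightAd`). Continuity of
`M(β(∇))` rests on the factorization of each `β_k` through a Banach step of `Φ` (`exists_factor`).
-/

noncomputable section

/-! ### Topology of locally convex inductive limits -/

section InductiveLimit

variable {𝕜 : Type*} [RCLike 𝕜] {ι : Type*} {E : ι → Type*} {V : Type*}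
  [∀ i, AddCommGroup (E i)] [∀ i, Module 𝕜 (E i)] [∀ i, TopologicalSpace (E i)]
  [AddCommGroup V] [Module 𝕜 V] [t : TopologicalSpace V]
  {j : ∀ i, E i →ₗ[𝕜] V}

theorem withSeminorms_of_eq_indLimTopology (ht : t = indLimTopology 𝕜 j) :
    WithSeminorms (limSeminorms 𝕜 j) := ⟨ht⟩

theorem polynormableSpace_of_eq_indLimTopology (ht : t = indLimTopology 𝕜 j) :
    PolynormableSpace 𝕜 V :=
  (withSeminorms_of_eq_indLimTopology ht).toPolynormableSpace

theorem isTopologicalAddGroup_of_eq_indLimTopology (ht : t = indLimTopology 𝕜 j) :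
    IsTopologicalAddGroup V :=
  (withSeminorms_of_eq_indLimTopology ht).topologicalAddGroup

theorem continuousSMul_of_eq_indLimTopology (ht : t = indLimTopology 𝕜 j) :
    ContinuousSMul 𝕜 V :=
  (withSeminorms_of_eq_indLimTopology ht).continuousSMul

theorem continuous_inclusion_of_eq_indLimTopology [∀ i, IsTopologicalAddGroup (E i)]
    (ht : t = indLimTopology 𝕜 j) (i : ι) : Continuous (j i) :=
  (withSeminorms_of_eq_indLimTopology ht).continuous_of_continuous_comp (j i) fun p => p.2 i

/-- A continuous seminorm on `F` pulled back along `f` is continuous on every `E i`, hence is one of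
the seminorms defining the limit topology. -/
theorem continuous_of_eq_indLimTopology {F : Type*} [AddCommGroup F] [Module 𝕜 F]
    [TopologicalSpace F] [PolynormableSpace 𝕜 F] (ht : t = indLimTopology 𝕜 j)
    (f : V →ₗ[𝕜] F) (hf : ∀ i, Continuous fun x => f (j i x)) : Continuous f := by
  have := isTopologicalAddGroup_of_eq_indLimTopology ht
  refine (PolynormableSpace.withSeminorms 𝕜 F).continuous_of_continuous_comp f fun q => ?_
  exact (withSeminorms_of_eq_indLimTopology ht).continuous_seminorm
    ⟨q.1.comp f, fun i => q.2.comp (hf i)⟩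

end InductiveLimit

/-! ### Power series in a locally nilpotent operator -/

section LocallyNilpotent

open PowerSeries

/-- The triangle and the square differ only where `f` vanishes. This rearranges products of series
truncated by nilpotency. -/
theorem sum_range_sum_antidiagonal {M : Type*} [AddCommMonoid M] (N : ℕ) (f : ℕ → ℕ → M)
    (hf : ∀ i j, N ≤ i + j → f i j = 0) :
    ∑ n ∈ Finset.range N, ∑ x ∈ Finset.HasAntidiagonal.antidiagonal n, f x.1 x.2 =
      ∑ i ∈ Finset.range N, ∑ j ∈ Finset.range N, f i j := by
  rw [Finset.sum_sigma', Finset.sum_sigma']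
  refine Finset.sum_of_injOn (fun p => ⟨p.2.1, p.2.2⟩) ?_ ?_ ?_ ?_
  · rintro ⟨a, b, c⟩ h ⟨a', b', c'⟩ h' heq
    simp at h h' heq
    obtain ⟨rfl, rfl⟩ := heq
    obtain ⟨-, rfl⟩ := h
    obtain ⟨-, rfl⟩ := h'
    rfl
  · rintro ⟨a, b, c⟩ h
    simp at h ⊢
    omega
  · rintro ⟨b, c⟩ h h'
    by_cases hbc : b + c < N
    · exact absurd ⟨⟨b + c, b, c⟩, by simpa using hbc, rfl⟩ h'
    · exact hf _ _ (not_lt.1 hbc)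
  · rintro ⟨a, b, c⟩ h
    rfl

variable {K : Type*} [Field K] {M M' : Type*} [AddCommGroup M] [Module K M]
  [AddCommGroup M'] [Module K M']

/-- Every vector is annihilated by some power of `N`. -/
def IsLocallyNilpotent (N : Module.End K M) : Prop := ∀ x, ∃ m, (N ^ m) x = 0

theorem Module.End.pow_apply_eq_zero_of_le {N : Module.End K M} {x : M} {m n : ℕ}
    (hm : (N ^ m) x = 0) (h : m ≤ n) : (N ^ n) x = 0 := by
  rw [← Nat.sub_add_cancel h, pow_add, Module.End.mul_apply, hm, map_zero]

/-- `f(N) x = ∑ f_n N^n x`. -/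
def psEval (N : Module.End K M) (f : K⟦X⟧) (x : M) : M := ∑ᶠ n, coeff n f • (N ^ n) x

theorem psEval_eq_sum {N : Module.End K M} {x : M} {m : ℕ} (hm : (N ^ m) x = 0) (f : K⟦X⟧) :
    psEval N f x = ∑ n ∈ Finset.range m, coeff n f • (N ^ n) x := by
  refine finsum_eq_sum_of_support_subset _ fun n hn => ?_
  by_contra h
  simp only [Finset.coe_range, Set.mem_Iio, not_lt] at h
  exact hn (by simp [Module.End.pow_apply_eq_zero_of_le hm h])

/-- The action of the algebra of formal power series through a locally nilpotent operator. -/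
def psAct (N : Module.End K M) (hN : IsLocallyNilpotent N) : K⟦X⟧ →ₐ[K] Module.End K M :=
  AlgHom.ofLinearMap
    { toFun f :=
        { toFun := psEval N f
          map_add' x y := by
            obtain ⟨m, hx⟩ := hN x
            obtain ⟨n, hy⟩ := hN y
            have hx := Module.End.pow_apply_eq_zero_of_le hx (le_max_left m n)
            have hy := Module.End.pow_apply_eq_zero_of_le hy (le_max_right m n)
            rw [psEval_eq_sum hx, psEval_eq_sum hy, psEval_eq_sum (by rw [map_add, hx, hy, add_zero]),
              ← Finset.sum_add_distrib]
            simp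
          map_smul' c x := by
            obtain ⟨m, hx⟩ := hN x
            rw [psEval_eq_sum hx, psEval_eq_sum (by rw [map_smul, hx, smul_zero]),
              RingHom.id_apply, Finset.smul_sum]
            simp [smul_comm c] }
      map_add' f g := by
        ext x
        obtain ⟨m, hx⟩ := hN x
        simp [psEval_eq_sum hx, add_smul, Finset.sum_add_distrib]
      map_smul' c f := by
        ext x
        obtain ⟨m, hx⟩ := hN x
        simp [psEval_eq_sum hx, Finset.smul_sum, mul_smul] }
    (by
      ext x
      obtain ⟨m, hx⟩ := hN x
      -- Enlarging the exponent keeps the index `0` inside the range even if `m = 0`.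
      have hx := Module.End.pow_apply_eq_zero_of_le hx (Nat.le_succ m)
      simp [psEval_eq_sum hx, coeff_one])
    (by
      intro f g
      ext x
      obtain ⟨m, hx⟩ := hN x
      -- The exponent that truncates at `x` also truncates at `g(N) x`, a combination of vectors `N
      -- ^ n x`.
      have hg : (N ^ m) (psEval N g x) = 0 := by
        rw [psEval_eq_sum hx, map_sum]
        refine Finset.sum_eq_zero fun n _ => ?_
        rw [map_smul, ← Module.End.mul_apply, ← pow_add,
          Module.End.pow_apply_eq_zero_of_le hx (by omega), smul_zero]
      simp only [LinearMap.coe_mk, AddHom.coe_mk, Module.End.mul_apply]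
      rw [psEval_eq_sum hx, psEval_eq_sum hg, psEval_eq_sum hx]
      simp_rw [coeff_mul, Finset.sum_smul, map_sum, map_smul, Finset.smul_sum, smul_smul,
        ← Module.End.mul_apply, ← pow_add]
      refine (Finset.sum_congr rfl fun n _ => Finset.sum_congr rfl fun y hy => ?_).trans
        (sum_range_sum_antidiagonal m (fun i j => (coeff i f * coeff j g) • (N ^ (i + j)) x)
          fun i j h => ?_)
      · rw [Finset.HasAntidiagonal.mem_antidiagonal.1 hy]
      · rw [Module.End.pow_apply_eq_zero_of_le hx h, smul_zero])

variable {N : Module.End K M} (hN : IsLocallyNilpotent N)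

theorem psAct_apply (f : K⟦X⟧) (x : M) :
    psAct N hN f x = ∑ᶠ n, coeff n f • (N ^ n) x := rfl

theorem psAct_eq_sum {x : M} {m : ℕ} (hm : (N ^ m) x = 0) (f : K⟦X⟧) :
    psAct N hN f x = ∑ n ∈ Finset.range m, coeff n f • (N ^ n) x := psEval_eq_sum hm f

@[simp] theorem psAct_X : psAct N hN X = N := by
  ext x
  obtain ⟨m, hx⟩ := hN x
  have hx := Module.End.pow_apply_eq_zero_of_le hx (Nat.le_add_right m 2)
  rw [psAct_eq_sum hN hx, Finset.sum_eq_single 1]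
  · simp
  · intro b _ hb
    simp [coeff_X, hb]
  · simp

/-- An operator intertwining `N` and `N'` intertwines `f(N)` and `f(N')`. -/
theorem psAct_intertwine {N' : Module.End K M'} (hN' : IsLocallyNilpotent N') {T : M →ₗ[K] M'}
    (h : ∀ x, T (N x) = N' (T x)) (f : K⟦X⟧) (x : M) :
    T (psAct N hN f x) = psAct N' hN' f (T x) := by
  have key : ∀ n x, T ((N ^ n) x) = (N' ^ n) (T x) := by
    intro n
    induction n with
    | zero => simp
    | succ n ih => intro x; rw [pow_succ, pow_succ, Module.End.mul_apply, ih, h, Module.End.mul_apply]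
  obtain ⟨m, hx⟩ := hN x
  have hTx : (N' ^ m) (T x) = 0 := by rw [← key, hx, map_zero]
  rw [psAct_eq_sum hN hx, psAct_eq_sum hN' hTx, map_sum]
  simp [key]

theorem coeff_pow_eq_zero_of_constantCoeff {l : K⟦X⟧} (hl : constantCoeff l = 0) {n k : ℕ}
    (h : n < k) : coeff n (l ^ k) = 0 :=
  coeff_of_lt_order _ <| lt_of_lt_of_le (by exact_mod_cast h) (le_order_pow_of_constantCoeff_eq_zero k hl)

theorem psAct_pow_apply_eq_zero {l : K⟦X⟧} (hl : constantCoeff l = 0) {x : M} {m : ℕ}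
    (hm : (N ^ m) x = 0) : ((psAct N hN l) ^ m) x = 0 := by
  rw [← map_pow, psAct_eq_sum hN hm]
  refine Finset.sum_eq_zero fun n hn => ?_
  rw [coeff_pow_eq_zero_of_constantCoeff hl (Finset.mem_range.1 hn), zero_smul]

theorem isLocallyNilpotent_psAct {l : K⟦X⟧} (hl : constantCoeff l = 0) :
    IsLocallyNilpotent (psAct N hN l) := fun x =>
  (hN x).imp fun _ hm => psAct_pow_apply_eq_zero hN hl hm

/-- As `l ^ k` has order at least `k`, both sides are finite double sums on each vector, and
interchanging them gives the claim. This is how a logarithm of an operator is produced from a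
logarithmic power series. -/
theorem psAct_subst {l : K⟦X⟧} (hl : constantCoeff l = 0) (f : K⟦X⟧) :
    psAct (psAct N hN l) (isLocallyNilpotent_psAct hN hl) f = psAct N hN (f.subst l) := by
  ext x
  obtain ⟨m, hm⟩ := hN x
  rw [psAct_eq_sum _ (psAct_pow_apply_eq_zero hN hl hm), psAct_eq_sum hN hm]
  simp_rw [← map_pow, psAct_eq_sum hN hm, Finset.smul_sum, smul_smul]
  rw [Finset.sum_comm]
  refine Finset.sum_congr rfl fun n hn => ?_
  rw [← Finset.sum_smul, coeff_subst' (HasSubst.of_constantCoeff_zero' hl)]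
  congr 1
  symm
  refine finsum_eq_sum_of_support_subset _ fun k hk => ?_
  by_contra h
  simp only [Finset.coe_range, Set.mem_Iio, not_lt] at h
  refine hk ?_
  rw [Finset.mem_range] at hn
  simp [coeff_pow_eq_zero_of_constantCoeff hl (hn.trans_le h)]

/-- The logarithm inverts the exponential: there is `l` with `l(0) = 0` and `exp(l) = 1 + X`. -/
theorem exists_exp_subst_eq_one_add_X [Algebra ℚ K] :
    ∃ l : K⟦X⟧, constantCoeff l = 0 ∧ (exp K).subst l = 1 + X := by
  -- The series `l` is the compositional inverse of `exp - 1`, which exists because the linear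
  -- coefficient is `1`.
  have h1 : IsUnit (coeff 1 (exp K - 1)) := by simp [coeff_one]
  have h0 : constantCoeff (exp K - 1) = 0 := by simp
  refine ⟨(exp K - 1).substInvOfIsUnit h1, by simp, ?_⟩
  have h := (exp K - 1).subst_substInvOfIsUnit_right h0 h1
  have hs : HasSubst ((exp K - 1).substInvOfIsUnit h1) := HasSubst.substInvOfIsUnit _ h1
  rw [subst_sub hs, sub_eq_iff_eq_add] at h
  rw [h, add_comm]
  congr 1
  rw [← coe_substAlgHom hs, map_one]

end LocallyNilpotent

/-! ### Polarization and density of powers -/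

/-- Complementation gives an alternating sum over the subsets of `Aᶜ`, which vanishes unless `Aᶜ` is
empty. -/
theorem sum_ite_image_subset_neg_one_pow {ι : Type*} [Fintype ι] [DecidableEq ι] (A : Finset ι) :
    (∑ S : Finset ι, if A ⊆ S then (-1 : ℤ) ^ Sᶜ.card else 0) = if A = Finset.univ then 1 else 0 := by
  have h1 : (∑ S : Finset ι, if A ⊆ S then (-1 : ℤ) ^ Sᶜ.card else 0) =
      ∑ S ∈ Aᶜ.powerset, (-1 : ℤ) ^ S.card := by
    rw [← Finset.sum_filter]
    refine Finset.sum_nbij' compl compl ?_ ?_ ?_ ?_ ?_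
    · intro S hS
      simpa using hS
    · intro S hS
      rw [Finset.mem_filter]
      refine ⟨Finset.mem_univ _, ?_⟩
      rw [Finset.mem_powerset] at hS
      rw [← compl_compl A]
      exact Finset.compl_subset_compl.2 hS
    all_goals simp
  rw [h1, Finset.sum_powerset_neg_one_pow_card]
  simp [Finset.compl_eq_empty_iff]

/-- The polarization formula. -/
theorem MultilinearMap.sum_neg_one_pow_smul_apply_const {R ι V W : Type*} [CommRing R] [Fintype ι]
    [DecidableEq ι] [AddCommGroup V] [Module R V] [AddCommGroup W] [Module R W]
    (g : MultilinearMap R (fun _ : ι => V) W) (b : ι → V) :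
    ∑ S : Finset ι, ((-1 : ℤ) ^ Sᶜ.card) • g (fun _ => ∑ i ∈ S, b i) =
      ∑ s : Equiv.Perm ι, g fun i => b (s i) := by
  -- Multilinear expansion runs over maps `r` with image in `S`; the alternating sum over `S` then
  -- keeps only surjective `r`, that is, permutations.
  have h1 : ∀ S : Finset ι, g (fun _ => ∑ i ∈ S, b i) =
      ∑ r : ι → ι, if Finset.univ.image r ⊆ S then g (fun i => b (r i)) else 0 := by
    intro S
    rw [g.map_sum_finset, ← Finset.sum_filter]
    refine Finset.sum_congr ?_ fun _ _ => rfl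
    ext r
    simp [Fintype.mem_piFinset, Finset.image_subset_iff]
  have h2 : ∀ r : ι → ι, (∑ S : Finset ι, ((-1 : ℤ) ^ Sᶜ.card) •
      if Finset.univ.image r ⊆ S then g (fun i => b (r i)) else 0) =
      if Finset.univ.image r = Finset.univ then g (fun i => b (r i)) else 0 := by
    intro r
    have := congrArg (fun z : ℤ => z • g (fun i => b (r i)))
      (sum_ite_image_subset_neg_one_pow (Finset.univ.image r))
    simpa [Finset.sum_smul, ite_smul, smul_ite] using this
  simp_rw [h1, Finset.smul_sum]
  rw [Finset.sum_comm]
  simp_rw [h2]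
  rw [← Finset.sum_filter]
  symm
  refine Finset.sum_bij (fun s _ => (s : ι → ι)) ?_ ?_ ?_ ?_
  · intro s _
    simp
  · intro s _ t _ h
    exact DFunLike.coe_injective h
  · intro r hr
    have hr' : Function.Surjective r := by
      intro x
      have hx := Finset.mem_univ x
      rw [← (Finset.mem_filter.1 hr).2] at hx
      simpa using hx
    exact ⟨Equiv.ofBijective r ⟨Finite.injective_iff_surjective.2 hr', hr'⟩,
      Finset.mem_univ _, rfl⟩
  · intro s _
    rfl

section Tensor

variable {𝕜 : Type*} [RCLike 𝕜] {B : Type*} [NormedAddCommGroup B] [NormedSpace 𝕜 B]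

/-- The symmetrization operator. -/
def symmetrize (𝕜 : Type*) [RCLike 𝕜] (B : Type*) [NormedAddCommGroup B] [NormedSpace 𝕜 B] (k : ℕ) :
    ContinuousMultilinearMap 𝕜 (fun _ : Fin k => StrongDual 𝕜 B) 𝕜 →L[𝕜]
      ContinuousMultilinearMap 𝕜 (fun _ : Fin k => StrongDual 𝕜 B) 𝕜 :=
  (k ! : 𝕜)⁻¹ • ∑ s : Equiv.Perm (Fin k),
    ((ContinuousMultilinearMap.domDomCongrₗᵢ 𝕜 (StrongDual 𝕜 B) 𝕜 s).toContinuousLinearEquiv :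
      _ →L[𝕜] _)

theorem symmetrize_apply {k : ℕ}
    (T : ContinuousMultilinearMap 𝕜 (fun _ : Fin k => StrongDual 𝕜 B) 𝕜)
    (ω : Fin k → StrongDual 𝕜 B) :
    symmetrize 𝕜 B k T ω = (k ! : 𝕜)⁻¹ * ∑ s : Equiv.Perm (Fin k), T fun i => ω (s i) := by
  simp [symmetrize, ContinuousMultilinearMap.domDomCongrₗᵢ]

theorem symmetrize_of_mem {k : ℕ}
    {T : ContinuousMultilinearMap 𝕜 (fun _ : Fin k => StrongDual 𝕜 B) 𝕜}
    (hT : T ∈ symTensorPow 𝕜 B k) : symmetrize 𝕜 B k T = T := by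
  ext ω
  have h : ∀ s : Equiv.Perm (Fin k), T (fun i => ω (s i)) = T ω := fun s =>
    congrArg (fun S => S ω) (hT.2 s)
  have hk : (k ! : 𝕜) ≠ 0 := Nat.cast_ne_zero.2 (Nat.factorial_ne_zero k)
  rw [symmetrize_apply]
  simp [h, Fintype.card_perm, hk]

theorem symmetrize_const {k : ℕ}
    (T : ContinuousMultilinearMap 𝕜 (fun _ : Fin k => StrongDual 𝕜 B) 𝕜) (ω : StrongDual 𝕜 B) :
    symmetrize 𝕜 B k T (fun _ => ω) = T fun _ => ω := by
  have hk : (k ! : 𝕜) ≠ 0 := Nat.cast_ne_zero.2 (Nat.factorial_ne_zero k)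
  rw [symmetrize_apply]
  simp [Fintype.card_perm, hk]

/-- The span of the tensor powers `b^{⊗k}`. -/
def powSpan (𝕜 : Type*) [RCLike 𝕜] (B : Type*) [NormedAddCommGroup B] [NormedSpace 𝕜 B] (k : ℕ) :
    Submodule 𝕜 (ContinuousMultilinearMap 𝕜 (fun _ : Fin k => StrongDual 𝕜 B) 𝕜) :=
  Submodule.span 𝕜 (Set.range fun b : B => elemTensor 𝕜 B fun _ : Fin k => b)

theorem symmetrize_elemTensor_mem_powSpan {k : ℕ} (b : Fin k → B) :
    symmetrize 𝕜 B k (elemTensor 𝕜 B b) ∈ powSpan 𝕜 B k := by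
  have h : symmetrize 𝕜 B k (elemTensor 𝕜 B b) = (k ! : 𝕜)⁻¹ •
      ∑ S : Finset (Fin k), ((-1 : ℤ) ^ Sᶜ.card) • elemTensor 𝕜 B fun _ => ∑ i ∈ S, b i := by
    ext ω
    have := MultilinearMap.sum_neg_one_pow_smul_apply_const
      ((MultilinearMap.mkPiAlgebra 𝕜 (Fin k) 𝕜).compLinearMap
        fun i => (ω i : B →ₗ[𝕜] 𝕜)) b
    simp only [MultilinearMap.compLinearMap_apply, MultilinearMap.mkPiAlgebra_apply,
      ContinuousLinearMap.coe_coe] at this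
    rw [symmetrize_apply, smul_apply, sum_apply]
    simp only [smul_apply, elemTensor_apply, smul_eq_mul]
    rw [this]
    congr 1
    -- Symmetrization permutes the functionals and polarization permutes the vectors, so the two
    -- sums match after inverting the permutation.
    rw [← Equiv.sum_comp (Equiv.inv (Equiv.Perm (Fin k)))]
    refine Finset.sum_congr rfl fun s _ => ?_
    exact (Equiv.prod_comp s fun i => ω (s⁻¹ i) (b i)).symm.trans
      (Finset.prod_congr rfl fun i _ => by rw [show s⁻¹ (s i) = i from s.symm_apply_apply i])
  rw [h]
  refine Submodule.smul_mem _ _ (Submodule.sum_mem _ fun S _ => ?_)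
  exact zsmul_mem (Submodule.subset_span (Set.mem_range_self (∑ i ∈ S, b i))) _

/-- A symmetric tensor is fixed by `symmetrize`, which is continuous and sends elementary tensors
into `powSpan`. -/
theorem symTensorPow_le_topologicalClosure_powSpan (k : ℕ) :
    symTensorPow 𝕜 B k ≤ (powSpan 𝕜 B k).topologicalClosure := by
  intro T hT
  have h : injTensorPow 𝕜 B k ≤
      (powSpan 𝕜 B k).topologicalClosure.comap (symmetrize 𝕜 B k : _ →ₗ[𝕜] _) := by
    refine Submodule.topologicalClosure_minimal _ (Submodule.span_le.2 ?_) ?_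
    · rintro _ ⟨b, rfl⟩
      exact Submodule.le_topologicalClosure _ (symmetrize_elemTensor_mem_powSpan b)
    · exact (Submodule.isClosed_topologicalClosure _).preimage (symmetrize 𝕜 B k).continuous
  have := h hT.1
  rwa [Submodule.mem_comap, ContinuousLinearMap.coe_coe, symmetrize_of_mem hT] at this

theorem isClosed_symTensorPow (k : ℕ) :
    IsClosed (symTensorPow 𝕜 B k :
      Set (ContinuousMultilinearMap 𝕜 (fun _ : Fin k => StrongDual 𝕜 B) 𝕜)) := by
  have : (symTensorPow 𝕜 B k :
      Set (ContinuousMultilinearMap 𝕜 (fun _ : Fin k => StrongDual 𝕜 B) 𝕜)) =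
      (injTensorPow 𝕜 B k : Set _) ∩ ⋂ s : Equiv.Perm (Fin k),
        {T | ContinuousMultilinearMap.domDomCongrₗᵢ 𝕜 (StrongDual 𝕜 B) 𝕜 s T = T} := by
    ext T
    simp only [Set.mem_inter_iff, Set.mem_iInter, Set.mem_ofPred_eq]
    rfl
  rw [this]
  refine (Submodule.isClosed_topologicalClosure _).inter (isClosed_iInter fun s => ?_)
  exact isClosed_eq (LinearIsometryEquiv.continuous _) continuous_id

instance (k : ℕ) : CompleteSpace (symTensorPow 𝕜 B k) :=
  (isClosed_symTensorPow k).completeSpace_coe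

theorem symmetrize_mem {k : ℕ}
    {T : ContinuousMultilinearMap 𝕜 (fun _ : Fin k => StrongDual 𝕜 B) 𝕜}
    (hT : T ∈ injTensorPow 𝕜 B k) : symmetrize 𝕜 B k T ∈ symTensorPow 𝕜 B k := by
  have h : injTensorPow 𝕜 B k ≤ (symTensorPow 𝕜 B k).comap (symmetrize 𝕜 B k : _ →ₗ[𝕜] _) := by
    refine Submodule.topologicalClosure_minimal _ (Submodule.span_le.2 ?_) ?_
    · rintro _ ⟨b, rfl⟩
      refine (Submodule.span_le (p := symTensorPow 𝕜 B k)).2 ?_ (symmetrize_elemTensor_mem_powSpan b)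
      rintro _ ⟨b, rfl⟩
      exact elemTensor_const_mem b
    · exact (isClosed_symTensorPow k).preimage (symmetrize 𝕜 B k).continuous
  exact h hT

/-- The tensor power `b^{⊗k}` as an element of the symmetric tensor power. -/
def symPow (𝕜 : Type*) [RCLike 𝕜] {B : Type*} [NormedAddCommGroup B] [NormedSpace 𝕜 B] (k : ℕ)
    (b : B) : symTensorPow 𝕜 B k := ⟨_, elemTensor_const_mem b⟩

theorem symPow_apply {k : ℕ} (b : B) (ω : Fin k → StrongDual 𝕜 B) :
    (symPow 𝕜 k b).1 ω = ∏ i, ω i b := elemTensor_apply _ _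

/-- The density of the span of the powers, in the form used below: closed linear conditions on
symmetric tensors need checking on `b^{⊗k}` only. -/
theorem eq_top_of_symPow_mem {k : ℕ} {C : Submodule 𝕜 (symTensorPow 𝕜 B k)}
    (hC : IsClosed (C : Set (symTensorPow 𝕜 B k))) (h : ∀ b, symPow 𝕜 k b ∈ C) : C = ⊤ := by
  rw [eq_top_iff]
  rintro T -
  have h1 : (T : ContinuousMultilinearMap 𝕜 (fun _ : Fin k => StrongDual 𝕜 B) 𝕜) ∈
      closure ((↑) '' (C : Set (symTensorPow 𝕜 B k))) := by
    refine closure_mono ?_ (symTensorPow_le_topologicalClosure_powSpan k T.2)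
    have : powSpan 𝕜 B k ≤ C.map (symTensorPow 𝕜 B k).subtype := by
      refine Submodule.span_le.2 ?_
      rintro _ ⟨b, rfl⟩
      exact ⟨_, h b, rfl⟩
    exact this
  have h2 : T ∈ closure (C : Set (symTensorPow 𝕜 B k)) := by
    rw [Topology.IsInducing.subtypeVal.closure_eq_preimage_closure_image]
    exact h1
  rwa [hC.closure_eq] at h2

/-- Continuous linear maps on a symmetric tensor power are determined by the powers. -/
theorem eq_of_symPow {k : ℕ} {Y : Type*} [AddCommGroup Y] [Module 𝕜 Y] [TopologicalSpace Y]
    [T2Space Y] {f g : symTensorPow 𝕜 B k →ₗ[𝕜] Y} (hf : Continuous f) (hg : Continuous g)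
    (h : ∀ b, f (symPow 𝕜 k b) = g (symPow 𝕜 k b)) : f = g := by
  have : LinearMap.eqLocus f g = ⊤ := eq_top_of_symPow_mem (isClosed_eq hf hg) h
  exact LinearMap.ext fun T => by
    have hT : T ∈ LinearMap.eqLocus f g := this ▸ Submodule.mem_top
    exact hT

/-- A continuous linear map that maps powers into a closed subspace maps everything into it. -/
theorem mem_of_symPow_mem {k : ℕ} {Y : Type*} [AddCommGroup Y] [Module 𝕜 Y] [TopologicalSpace Y]
    (f : symTensorPow 𝕜 B k →L[𝕜] Y) {C : Submodule 𝕜 Y} (hC : IsClosed (C : Set Y))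
    (h : ∀ b, f (symPow 𝕜 k b) ∈ C) (T : symTensorPow 𝕜 B k) : f T ∈ C := by
  have hC' : IsClosed (C.comap (f : symTensorPow 𝕜 B k →ₗ[𝕜] Y) : Set (symTensorPow 𝕜 B k)) :=
    hC.preimage f.continuous
  have hT : T ∈ C.comap (f : symTensorPow 𝕜 B k →ₗ[𝕜] Y) :=
    eq_top_of_symPow_mem hC' (fun b => h b) ▸ Submodule.mem_top
  exact hT

/-! ### Contraction -/

/-- The last `j` arguments of a form with `k + j` arguments. -/
def splitForm (𝕜 : Type*) [RCLike 𝕜] (B : Type*) [NormedAddCommGroup B] [NormedSpace 𝕜 B] (k j : ℕ) :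
    ContinuousMultilinearMap 𝕜 (fun _ : Fin (k + j) => StrongDual 𝕜 B) 𝕜 →L[𝕜]
      ContinuousMultilinearMap 𝕜 (fun _ : Fin j => StrongDual 𝕜 B)
        (ContinuousMultilinearMap 𝕜 (fun _ : Fin k => StrongDual 𝕜 B) 𝕜) :=
  (((ContinuousMultilinearMap.domDomCongrₗᵢ 𝕜 (StrongDual 𝕜 B) 𝕜
    (finSumFinEquiv.symm.trans (Equiv.sumComm (Fin k) (Fin j)))).trans
    (ContinuousMultilinearMap.currySumEquiv 𝕜 (Fin j) (Fin k) (StrongDual 𝕜 B)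
      𝕜)).toContinuousLinearEquiv : _ →L[𝕜] _)

theorem splitForm_apply {k j : ℕ}
    (T : ContinuousMultilinearMap 𝕜 (fun _ : Fin (k + j) => StrongDual 𝕜 B) 𝕜)
    (ω : Fin j → StrongDual 𝕜 B) (σ : Fin k → StrongDual 𝕜 B) :
    splitForm 𝕜 B k j T ω σ = T (Fin.append σ ω) := by
  change T (fun i => Sum.elim ω σ ((finSumFinEquiv.symm.trans (Equiv.sumComm (Fin k) (Fin j))) i)) = _
  congr 1
  funext i
  refine Fin.addCases (fun i => ?_) (fun i => ?_) i <;> simp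

theorem norm_splitForm {k j : ℕ}
    (T : ContinuousMultilinearMap 𝕜 (fun _ : Fin (k + j) => StrongDual 𝕜 B) 𝕜) :
    ‖splitForm 𝕜 B k j T‖ = ‖T‖ :=
  LinearIsometryEquiv.norm_map _ T

theorem splitForm_symPow {k j : ℕ} (b : B) (ω : Fin j → StrongDual 𝕜 B) :
    splitForm 𝕜 B k j (symPow 𝕜 (k + j) b).1 ω = (∏ i, ω i b) • (symPow 𝕜 k b).1 := by
  ext σ
  rw [splitForm_apply, symPow_apply, smul_apply, symPow_apply,
    Fin.prod_univ_add]
  simp [mul_comm]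

/-- Fixing the last `j` arguments of a power leaves a multiple of a power; density and closedness of
`symTensorPow` give the general case. -/
theorem splitForm_mem {k j : ℕ} (T : symTensorPow 𝕜 B (k + j)) (ω : Fin j → StrongDual 𝕜 B) :
    splitForm 𝕜 B k j T.1 ω ∈ symTensorPow 𝕜 B k := by
  refine mem_of_symPow_mem (((ContinuousMultilinearMap.apply 𝕜 _ _ ω).comp
    (splitForm 𝕜 B k j)).comp (symTensorPow 𝕜 B (k + j)).subtypeL)
    (isClosed_symTensorPow k) (fun b => ?_) T
  change splitForm 𝕜 B k j (symPow 𝕜 (k + j) b).1 ω ∈ _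
  rw [splitForm_symPow]
  exact Submodule.smul_mem _ _ (symPow 𝕜 k b).2

variable {X : Type*} [NormedAddCommGroup X] [NormedSpace 𝕜 X]

/-- Contraction of `T` with an operator `ψ` acting on the first `k` factors. -/
def contrOp {k : ℕ} (j : ℕ) (ψ : symTensorPow 𝕜 B k →L[𝕜] X) :
    symTensorPow 𝕜 B (k + j) →L[𝕜]
      ContinuousMultilinearMap 𝕜 (fun _ : Fin j => StrongDual 𝕜 B) X :=
  LinearMap.mkContinuous
    { toFun T := ψ.compContinuousMultilinearMap
        ((splitForm 𝕜 B k j T.1).codRestrict (symTensorPow 𝕜 B k) (splitForm_mem T))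
      map_add' S T := by
        ext ω
        exact ψ.map_add ⟨_, splitForm_mem S ω⟩ ⟨_, splitForm_mem T ω⟩
      map_smul' c T := by
        ext ω
        exact ψ.map_smul c ⟨_, splitForm_mem T ω⟩ }
    ‖ψ‖ fun T => by
      refine ContinuousMultilinearMap.opNorm_le_bound (by positivity) fun ω => ?_
      refine (ψ.le_opNorm ⟨_, splitForm_mem T ω⟩).trans ?_
      rw [mul_assoc]
      refine mul_le_mul_of_nonneg_left ?_ (norm_nonneg _)
      refine ((splitForm 𝕜 B k j T.1).le_opNorm ω).trans_eq ?_
      rw [norm_splitForm]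
      rfl

theorem contrOp_apply {k j : ℕ} (ψ : symTensorPow 𝕜 B k →L[𝕜] X)
    (T : symTensorPow 𝕜 B (k + j)) (ω : Fin j → StrongDual 𝕜 B) :
    contrOp j ψ T ω = ψ ⟨splitForm 𝕜 B k j T.1 ω, splitForm_mem T ω⟩ := rfl

theorem contrOp_symPow {k j : ℕ} (ψ : symTensorPow 𝕜 B k →L[𝕜] X) (b : B)
    (ω : Fin j → StrongDual 𝕜 B) :
    contrOp j ψ (symPow 𝕜 (k + j) b) ω = (∏ i, ω i b) • ψ (symPow 𝕜 k b) := by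
  rw [contrOp_apply, ← map_smul]
  congr 1
  exact Subtype.ext (splitForm_symPow b ω)

theorem contrOp_mem {k j : ℕ} (l : symTensorPow 𝕜 B k →L[𝕜] 𝕜) (T : symTensorPow 𝕜 B (k + j)) :
    contrOp j l T ∈ symTensorPow 𝕜 B j := by
  refine mem_of_symPow_mem (contrOp j l) (isClosed_symTensorPow j) (fun b => ?_) T
  have : contrOp j l (symPow 𝕜 (k + j) b) = l (symPow 𝕜 k b) • (symPow 𝕜 j b).1 := by
    ext ω
    rw [contrOp_symPow, smul_apply, symPow_apply, smul_eq_mul, smul_eq_mul,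
      mul_comm]
  rw [this]
  exact Submodule.smul_mem _ _ (symPow 𝕜 j b).2

/-- Contraction of the first `k` factors with a functional. -/
def contrFunctional {k : ℕ} (j : ℕ) (l : symTensorPow 𝕜 B k →L[𝕜] 𝕜) :
    symTensorPow 𝕜 B (k + j) →L[𝕜] symTensorPow 𝕜 B j :=
  (contrOp j l).codRestrict _ (contrOp_mem l)

/-- The form `(ω₁, …, ω_{j+1}) ↦ ω_{j+1}(ψ(T(·, ω₁, …, ω_j)))`. -/
def contrForm {k : ℕ} (j : ℕ) (e : B →L[𝕜] X) (ψ : symTensorPow 𝕜 B k →L[𝕜] X) :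
    symTensorPow 𝕜 B (k + j) →L[𝕜]
      ContinuousMultilinearMap 𝕜 (fun _ : Fin (j + 1) => StrongDual 𝕜 X) 𝕜 :=
  ((continuousMultilinearCurryRightEquiv 𝕜
      (fun _ : Fin (j + 1) => StrongDual 𝕜 X) 𝕜).symm.toContinuousLinearEquiv : _ →L[𝕜] _).comp
    ((ContinuousLinearMap.compContinuousMultilinearMapL 𝕜 (fun _ : Fin j => StrongDual 𝕜 X) X
      (StrongDual 𝕜 X →L[𝕜] 𝕜) (NormedSpace.inclusionInDoubleDual 𝕜 X)).comp
    ((ContinuousMultilinearMap.compContinuousLinearMapL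
      (fun _ : Fin j => (ContinuousLinearMap.compL 𝕜 B X 𝕜).flip e)).comp (contrOp j ψ)))

theorem contrForm_apply {k j : ℕ} (e : B →L[𝕜] X) (ψ : symTensorPow 𝕜 B k →L[𝕜] X)
    (T : symTensorPow 𝕜 B (k + j)) (ω : Fin (j + 1) → StrongDual 𝕜 X) :
    contrForm j e ψ T ω =
      ω (Fin.last j) (contrOp j ψ T fun i => (ω i.castSucc).comp e) := rfl

theorem contrForm_symPow {k j : ℕ} (e : B →L[𝕜] X) (ψ : symTensorPow 𝕜 B k →L[𝕜] X) (b : B) :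
    contrForm j e ψ (symPow 𝕜 (k + j) b) =
      elemTensor 𝕜 X (Fin.snoc (fun _ : Fin j => e b) (ψ (symPow 𝕜 k b)) : Fin (j + 1) → X) := by
  ext ω
  rw [contrForm_apply, contrOp_symPow, elemTensor_apply, Fin.prod_univ_castSucc]
  simp

/-- Contraction of the first `k` factors with an operator `ψ`, followed by symmetrization. -/
def contrSymm {k : ℕ} (j : ℕ) (e : B →L[𝕜] X) (ψ : symTensorPow 𝕜 B k →L[𝕜] X) :
    symTensorPow 𝕜 B (k + j) →L[𝕜] symTensorPow 𝕜 X (j + 1) :=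
  ((symmetrize 𝕜 X (j + 1)).comp (contrForm j e ψ)).codRestrict _ fun T => by
    refine mem_of_symPow_mem ((symmetrize 𝕜 X (j + 1)).comp (contrForm j e ψ))
      (isClosed_symTensorPow (j + 1)) (fun b => ?_) T
    rw [ContinuousLinearMap.comp_apply, contrForm_symPow]
    exact symmetrize_mem (Submodule.le_topologicalClosure _ (Submodule.subset_span ⟨_, rfl⟩))

/-- Symmetrization does not affect diagonal values, so it leaves the associated polynomial
unchanged. -/
theorem contrSymm_const {k j : ℕ} (e : B →L[𝕜] X) (ψ : symTensorPow 𝕜 B k →L[𝕜] X)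
    (T : symTensorPow 𝕜 B (k + j)) (ω : StrongDual 𝕜 X) :
    (contrSymm j e ψ T).1 (fun _ => ω) = ω (contrOp j ψ T fun _ => ω.comp e) :=
  (symmetrize_const _ ω).trans (contrForm_apply e ψ T _)

end Tensor

/-- A closed subspace of a normed space is the intersection of the kernels of functionals. -/
theorem exists_dual_ne_zero_of_notMem {𝕜 : Type*} [RCLike 𝕜] {B : Type*} [NormedAddCommGroup B]
    [NormedSpace 𝕜 B] {p : Submodule 𝕜 B} (hp : IsClosed (p : Set B)) {x : B} (hx : x ∉ p) :
    ∃ f : StrongDual 𝕜 B, (∀ y ∈ p, f y = 0) ∧ f x ≠ 0 := by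
  have : IsClosed (p : Set B) := hp
  -- The functional comes from Hahn–Banach in the quotient by `p`, whose seminorm is a norm because
  -- `p` is closed.
  have hq : ‖p.mkQ x‖ ≠ 0 := by
    rw [norm_ne_zero_iff, Submodule.mkQ_apply, ne_eq, Submodule.Quotient.mk_eq_zero]
    exact hx
  obtain ⟨g, -, hg⟩ := exists_dual_vector 𝕜 (p.mkQ x) hq
  refine ⟨g.comp p.mkQL, fun y hy => ?_, ?_⟩
  · change g (p.mkQ y) = 0
    rw [Submodule.mkQ_apply, (Submodule.Quotient.mk_eq_zero p).2 hy, map_zero]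
  · change g (p.mkQ x) ≠ 0
    rw [hg]
    exact_mod_cast hq

/-- Extension of functionals along an isometry. -/
theorem LinearIsometry.exists_dual_extension {𝕜 : Type*} [RCLike 𝕜] {B C : Type*}
    [NormedAddCommGroup B] [NormedSpace 𝕜 B] [NormedAddCommGroup C] [NormedSpace 𝕜 C]
    (e : B →ₗᵢ[𝕜] C) (f : StrongDual 𝕜 B) : ∃ g : StrongDual 𝕜 C, ∀ x, g (e x) = f x := by
  obtain ⟨g, hg, -⟩ := exists_extension_norm_eq (LinearMap.range e.toLinearMap)
    (f.comp (e.equivRange.symm.toContinuousLinearEquiv : _ →L[𝕜] B))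
  refine ⟨g, fun x => (hg ⟨e x, x, rfl⟩).trans ?_⟩
  exact congrArg f (e.equivRange.symm_apply_apply x)

/-! ### Functionals, closed steps and factorization in an (LB)-space -/

namespace LBSpace

variable {𝕜 : Type*} [RCLike 𝕜] {E : ℕ → Type*}
  [∀ n, NormedAddCommGroup (E n)] [∀ n, NormedSpace 𝕜 (E n)] [∀ n, CompleteSpace (E n)]
  {Φ : Type*} [AddCommGroup Φ] [Module 𝕜 Φ] [TopologicalSpace Φ]
  (L : LBSpace 𝕜 E Φ)

include L

theorem isTopologicalAddGroup : IsTopologicalAddGroup Φ :=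
  isTopologicalAddGroup_of_eq_indLimTopology L.topology_eq

theorem polynormableSpace : PolynormableSpace 𝕜 Φ :=
  polynormableSpace_of_eq_indLimTopology L.topology_eq

theorem exists_isometry {m n : ℕ} (h : m ≤ n) :
    ∃ e : E m →ₗᵢ[𝕜] E n, ∀ x, L.incl n (e x) = L.incl m x := by
  induction n, h using Nat.le_induction with
  | base => exact ⟨LinearIsometry.id, fun _ => rfl⟩
  | succ n _ ih =>
    obtain ⟨e, he⟩ := ih
    exact ⟨(L.step n).comp e, fun x => (L.incl_step n _).trans (he x)⟩

theorem exists_incl_le (m : ℕ) (ξ : Φ) : ∃ n, m ≤ n ∧ ∃ x, L.incl n x = ξ := by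
  obtain ⟨n, x, rfl⟩ := L.exists_incl ξ
  obtain ⟨e, he⟩ := L.exists_isometry (le_max_right m n)
  exact ⟨_, le_max_left m n, e x, he x⟩

/-- Every functional on `E m` extends to `Φ`. -/
theorem exists_restr_eq (m : ℕ) (f : StrongDual 𝕜 (E m)) :
    ∃ ω : StrongDual 𝕜 Φ, L.restr m ω = f := by
  choose ext hext using fun n => (L.step n).exists_dual_extension
  -- Iterated Hahn–Banach: `g k` extends `f` to `E (m + k)`, compatibly along the chain.
  let g : ∀ k, StrongDual 𝕜 (E (m + k)) := fun k => Nat.rec f (fun k g => ext (m + k) g) k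
  have hg : ∀ k d, ∃ e : E (m + k) →ₗᵢ[𝕜] E (m + (k + d)),
      (∀ x, L.incl _ (e x) = L.incl _ x) ∧ ∀ x, g (k + d) (e x) = g k x := by
    intro k d
    induction d with
    | zero => exact ⟨LinearIsometry.id, fun _ => rfl, fun _ => rfl⟩
    | succ d ih =>
      obtain ⟨e, he, he'⟩ := ih
      exact ⟨(L.step (m + (k + d))).comp e, fun x => (L.incl_step _ _).trans (he x),
        fun x => (hext _ _ _).trans (he' x)⟩
  have hrep₂ : ∀ ξ η : Φ, ∃ k x y, L.incl (m + k) x = ξ ∧ L.incl (m + k) y = η := by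
    intro ξ η
    obtain ⟨n, hn, x, rfl⟩ := L.exists_incl_le m ξ
    obtain ⟨l, hl, y, rfl⟩ := L.exists_incl_le n η
    obtain ⟨e, he⟩ := L.exists_isometry hl
    obtain ⟨k, rfl⟩ := Nat.exists_eq_add_of_le (hn.trans hl)
    exact ⟨k, e x, y, he x, rfl⟩
  have hrep : ∀ ξ : Φ, ∃ k x, L.incl (m + k) x = ξ := fun ξ => by
    obtain ⟨k, x, -, hx, -⟩ := hrep₂ ξ ξ
    exact ⟨k, x, hx⟩
  -- The value does not depend on the representative, since two representatives of one vector
  -- coincide in the larger step.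
  have huniq : ∀ k l x y, L.incl (m + k) x = L.incl (m + l) y → g k x = g l y := by
    intro k l x y h
    wlog hkl : k ≤ l generalizing k l x y
    · exact (this l k y x h.symm (le_of_not_ge hkl)).symm
    obtain ⟨d, rfl⟩ := Nat.exists_eq_add_of_le hkl
    obtain ⟨e, he, he'⟩ := hg k d
    rw [← he' x]
    congr 1
    exact L.incl_injective _ ((he x).trans h)
  choose r x hx using hrep
  have hval : ∀ k y, g (r (L.incl (m + k) y)) (x (L.incl (m + k) y)) = g k y := fun k y =>
    huniq _ _ _ _ (hx _)
  let ω : Φ →ₗ[𝕜] 𝕜 :=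
    { toFun ξ := g (r ξ) (x ξ)
      map_add' ξ η := by
        obtain ⟨k, a, b, rfl, rfl⟩ := hrep₂ ξ η
        rw [← map_add, hval, hval, hval, map_add]
      map_smul' c ξ := by
        rw [RingHom.id_apply, smul_eq_mul, ← smul_eq_mul, ← map_smul]
        refine huniq _ _ _ _ ?_
        rw [hx, map_smul, hx] }
  have hω : Continuous ω := by
    refine continuous_of_eq_indLimTopology L.topology_eq ω fun n => ?_
    obtain ⟨e, he⟩ := L.exists_isometry (Nat.le_add_left n m)
    have : (fun x => ω (L.incl n x)) = fun x => g n (e x) := by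
      funext x
      rw [← he]
      exact hval n (e x)
    exact this ▸ (g n).continuous.comp e.continuous
  exact ⟨⟨ω, hω⟩, ContinuousLinearMap.ext fun y => hval 0 y⟩

/-- The dual of `Φ` separates points. -/
theorem eq_of_forall_dual {ξ η : Φ} (h : ∀ ω : StrongDual 𝕜 Φ, ω ξ = ω η) : ξ = η := by
  have := L.isTopologicalAddGroup
  rw [← sub_eq_zero]
  obtain ⟨n, x, hx⟩ := L.exists_incl (ξ - η)
  rw [← hx]
  by_contra hne
  have hx0 : ‖x‖ ≠ 0 := fun h0 => hne (by rw [norm_eq_zero.1 h0, map_zero])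
  obtain ⟨f, -, hf⟩ := exists_dual_vector 𝕜 x hx0
  obtain ⟨ω, rfl⟩ := L.exists_restr_eq n f
  have h1 : L.restr n ω x = ω (ξ - η) := congrArg ω hx
  rw [hf, map_sub, h, sub_self] at h1
  exact hx0 (by exact_mod_cast h1)

theorem t2Space : T2Space Φ :=
  T2Space.of_injective_continuous (f := fun (ξ : Φ) (ω : StrongDual 𝕜 Φ) => ω ξ)
    (fun _ _ h => L.eq_of_forall_dual fun ω => congrFun h ω)
    (continuous_pi fun ω => ω.continuous)

/-- `E m` is the common kernel of the functionals that vanish on it: a vector outside `E m` lies in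
some `E n` with `n ≥ m`, where the complete subspace `E m` is closed, and a functional separating
the two on `E n` extends to `Φ`. -/
theorem isClosed_range_incl (m : ℕ) : IsClosed (Set.range (L.incl m)) := by
  have h : Set.range (L.incl m) =
      ⋂ ω ∈ {ω : StrongDual 𝕜 Φ | L.restr m ω = 0}, {ξ | ω ξ = 0} := by
    refine Set.Subset.antisymm ?_ fun ξ hξ => ?_
    · rintro _ ⟨x, rfl⟩
      simp only [Set.mem_iInter]
      exact fun ω hω => show L.restr m ω x = 0 from by
        rw [show L.restr m ω = 0 from hω]; rfl
    · simp only [Set.mem_iInter] at hξ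
      obtain ⟨n, hn, x, rfl⟩ := L.exists_incl_le m ξ
      obtain ⟨e, he⟩ := L.exists_isometry hn
      by_contra hx
      obtain ⟨f, hf, hfx⟩ := exists_dual_ne_zero_of_notMem
        (p := LinearMap.range e.toLinearMap) (x := x)
        (e.isometry.isClosedEmbedding.isClosed_range)
        (by rintro ⟨y, rfl⟩; exact hx ⟨y, (he y).symm⟩)
      obtain ⟨ω, rfl⟩ := L.exists_restr_eq n f
      refine hfx (hξ ω (ContinuousLinearMap.ext fun y => ?_))
      exact (congrArg ω (he y).symm).trans (hf _ ⟨y, rfl⟩)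
  have := L.isTopologicalAddGroup
  rw [h]
  exact isClosed_biInter fun ω _ => isClosed_eq ω.continuous continuous_const

/-- A continuous operator from a Banach space to `Φ` factors through one of the steps. -/
theorem exists_factor {X : Type*} [NormedAddCommGroup X] [NormedSpace 𝕜 X] [CompleteSpace X]
    (g : X →L[𝕜] Φ) (m : ℕ) :
    ∃ n, m ≤ n ∧ ∃ ψ : X →L[𝕜] E n, ∀ x, L.incl n (ψ x) = g x := by
  have := L.t2Space
  -- Baire: the closed subspaces `S n = g⁻¹(E n)` cover `X`, so one of them has interior points and
  -- is all of `X`.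
  let S : ℕ → Submodule 𝕜 X := fun n => (LinearMap.range (L.incl n : E n →ₗ[𝕜] Φ)).comap (g : X →ₗ[𝕜] Φ)
  have hS : ∀ n x, x ∈ S n ↔ ∃ y, L.incl n y = g x := fun n x => Iff.rfl
  have hcl : ∀ n, IsClosed (S n : Set X) := fun n => (L.isClosed_range_incl n).preimage g.continuous
  have hU : ⋃ n, (S n : Set X) = Set.univ := by
    refine Set.eq_univ_of_forall fun x => ?_
    obtain ⟨n, y, hy⟩ := L.exists_incl (g x)
    exact Set.mem_iUnion.2 ⟨n, y, hy⟩
  obtain ⟨r, hr⟩ := nonempty_interior_of_iUnion_of_closed hcl hU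
  have hr := (S r).eq_top_of_nonempty_interior' hr
  obtain ⟨e, he⟩ := L.exists_isometry (le_max_right m r)
  have hfac : ∀ x, ∃ y, L.incl (max m r) y = g x := by
    intro x
    obtain ⟨y, hy⟩ := (hS r x).1 (hr ▸ Submodule.mem_top)
    exact ⟨e y, (he y).trans hy⟩
  choose ψ hψ using hfac
  let ψ' : X →ₗ[𝕜] E (max m r) :=
    { toFun := ψ
      map_add' x y := L.incl_injective _ (by rw [hψ, map_add, map_add, hψ, hψ])
      map_smul' c x := L.incl_injective _ (by
        rw [hψ, map_smul, map_smul, hψ, RingHom.id_apply]) }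
  -- Closed graph theorem: limits in the Banach step are limits in the Hausdorff space `Φ`, where
  -- `g` is continuous.
  have hc : Continuous ψ' := by
    refine ψ'.continuous_of_seq_closed_graph fun u x y hu hv => L.incl_injective _ ?_
    have h1 := ((L.incl (max m r)).continuous.tendsto y).comp hv
    have h2 := (g.continuous.tendsto x).comp hu
    have h3 : ⇑(L.incl (max m r)) ∘ ψ' ∘ u = g ∘ u := funext fun n => hψ _
    rw [h3] at h1
    exact (tendsto_nhds_unique h1 h2).trans (hψ x).symm
  exact ⟨_, le_max_left m r, ⟨ψ', hc⟩, hψ⟩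

end LBSpace

/-! ### The first tensor power -/

section Tensor

variable {𝕜 : Type*} [RCLike 𝕜] {B : Type*} [NormedAddCommGroup B] [NormedSpace 𝕜 B]
  [CompleteSpace B]

/-- A Banach space is its own first tensor power. -/
theorem exists_symTensorPow_one : ∃ r : symTensorPow 𝕜 B 1 →L[𝕜] B,
    ∀ (T : symTensorPow 𝕜 B 1) (ω : Fin 1 → StrongDual 𝕜 B), T.1 ω = ω 0 (r T) := by
  let J₀ : B →ₗᵢ[𝕜] ContinuousMultilinearMap 𝕜 (fun _ : Fin 1 => StrongDual 𝕜 B) 𝕜 :=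
    (ContinuousMultilinearMap.ofSubsingletonₗᵢ 𝕜 (StrongDual 𝕜 B)
      (0 : Fin 1)).toLinearIsometry.comp (NormedSpace.inclusionInDoubleDualLi 𝕜)
  have hJ₀ : ∀ b ω, J₀ b ω = ω 0 b := fun b ω => rfl
  have hJ₁ : ∀ b, J₀ b = (symPow 𝕜 1 b).1 := by
    intro b
    ext ω
    rw [hJ₀, symPow_apply]
    simp
  let J : B →ₗᵢ[𝕜] symTensorPow 𝕜 B 1 :=
    { toLinearMap := J₀.toLinearMap.codRestrict (symTensorPow 𝕜 B 1)
        fun b => by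
          have h : J₀ b ∈ symTensorPow 𝕜 B 1 := by rw [hJ₁]; exact (symPow 𝕜 1 b).2
          exact h
      norm_map' := fun b => J₀.norm_map b }
  -- The range of the isometry is closed, as `B` is complete, and it contains all first powers.
  have hsurj : LinearMap.range J.toLinearMap = ⊤ :=
    eq_top_of_symPow_mem J.isometry.isClosedEmbedding.isClosed_range
      fun b => ⟨b, Subtype.ext (hJ₁ b)⟩
  let e := LinearIsometryEquiv.ofSurjective J (LinearMap.range_eq_top.1 hsurj)
  refine ⟨(e.symm.toContinuousLinearEquiv : _ →L[𝕜] B), fun T ω => ?_⟩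
  obtain ⟨b, rfl⟩ := e.surjective T
  exact (hJ₀ b ω).trans (congrArg (ω 0) (e.symm_apply_apply b).symm)

end Tensor

namespace LBSpace

variable {𝕜 : Type*} [RCLike 𝕜] {E : ℕ → Type*}
  [∀ n, NormedAddCommGroup (E n)] [∀ n, NormedSpace 𝕜 (E n)] [∀ n, CompleteSpace (E n)]
  {Φ : Type*} [AddCommGroup Φ] [Module 𝕜 Φ] [TopologicalSpace Φ]
  {L : LBSpace 𝕜 E Φ}

/-! ### The topologies of the symmetric powers and of the space of polynomials -/

instance (k : ℕ) : IsTopologicalAddGroup (L.SymPow k) :=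
  isTopologicalAddGroup_of_eq_indLimTopology (j := fun n => L.toSymPow n k) rfl

instance (k : ℕ) : ContinuousSMul 𝕜 (L.SymPow k) :=
  continuousSMul_of_eq_indLimTopology (j := fun n => L.toSymPow n k) rfl

instance : IsTopologicalAddGroup L.Poly :=
  isTopologicalAddGroup_of_eq_indLimTopology (j := L.mono) rfl

instance : ContinuousSMul 𝕜 L.Poly := continuousSMul_of_eq_indLimTopology (j := L.mono) rfl

instance : PolynormableSpace 𝕜 L.Poly := polynormableSpace_of_eq_indLimTopology (j := L.mono) rfl

theorem continuous_toSymPow (n k : ℕ) : Continuous (L.toSymPow n k) :=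
  continuous_inclusion_of_eq_indLimTopology (j := fun n => L.toSymPow n k) rfl n

theorem continuous_mono (k : ℕ) : Continuous (L.mono k) :=
  continuous_inclusion_of_eq_indLimTopology (j := L.mono) rfl k

theorem continuous_of_toSymPow {F : Type*} [AddCommGroup F] [Module 𝕜 F] [TopologicalSpace F]
    [PolynormableSpace 𝕜 F] {k : ℕ} (f : L.SymPow k →ₗ[𝕜] F)
    (hf : ∀ n, Continuous fun T => f (L.toSymPow n k T)) : Continuous f :=
  continuous_of_eq_indLimTopology (j := fun n => L.toSymPow n k) rfl f hf

theorem continuous_of_mono {F : Type*} [AddCommGroup F] [Module 𝕜 F] [TopologicalSpace F]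
    [PolynormableSpace 𝕜 F] (f : L.Poly →ₗ[𝕜] F)
    (hf : ∀ k n, Continuous fun T => f (L.mono k (L.toSymPow n k T))) : Continuous f :=
  continuous_of_eq_indLimTopology (j := L.mono) rfl f fun k =>
    continuous_of_toSymPow (f.comp (L.mono k)) (hf k)

/-! ### Polynomials as functions -/

theorem poly_ext {p q : L.Poly} (h : ∀ ω, p ω = q ω) : p = q := Subtype.ext (funext h)

@[simp] theorem poly_add_apply (p q : L.Poly) (ω : StrongDual 𝕜 Φ) : (p + q) ω = p ω + q ω := rfl

@[simp] theorem poly_sub_apply (p q : L.Poly) (ω : StrongDual 𝕜 Φ) : (p - q) ω = p ω - q ω := rfl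

@[simp] theorem poly_zero_apply (ω : StrongDual 𝕜 Φ) : (0 : L.Poly) ω = 0 := rfl

@[simp] theorem poly_smul_apply (c : 𝕜) (p : L.Poly) (ω : StrongDual 𝕜 Φ) :
    (c • p) ω = c * p ω := rfl

theorem mono_apply {k : ℕ} (f : L.SymPow k) (ω : StrongDual 𝕜 Φ) :
    L.mono k f ω = pair f fun _ => ω := rfl

theorem poly_induction {motive : L.Poly → Prop} (zero : motive 0)
    (add : ∀ p q, motive p → motive q → motive (p + q))
    (mono : ∀ k f, motive (L.mono k f)) (p : L.Poly) : motive p := by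
  obtain ⟨p, hp⟩ := p
  refine Submodule.iSup_induction' _ (motive := fun p hp => motive ⟨p, hp⟩) ?_ zero
    (fun p q hp hq h h' => add ⟨p, hp⟩ ⟨q, hq⟩ h h') hp
  rintro k _ ⟨f, rfl⟩
  exact mono k f

theorem polyLT_induction {n : ℕ} {motive : L.Poly → Prop} (zero : motive 0)
    (add : ∀ p q, motive p → motive q → motive (p + q))
    (mono : ∀ k < n, ∀ f, motive (L.mono k f)) {p : L.Poly} (hp : p ∈ L.polyLT n) : motive p := by
  refine Submodule.iSup_induction _ (motive := motive) hp ?_ zero add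
  rintro k _ ⟨f, rfl⟩
  exact mono k k.2 f

theorem mono_mem_polyLT {k n : ℕ} (h : k < n) (f : L.SymPow k) : L.mono k f ∈ L.polyLT n :=
  Submodule.mem_iSup_of_mem (⟨k, h⟩ : Fin n) ⟨f, rfl⟩

theorem polyLT_mono {m n : ℕ} (h : m ≤ n) : L.polyLT m ≤ L.polyLT n := fun _ hp =>
  polyLT_induction (zero_mem _) (fun _ _ => add_mem) (fun _ hk f => mono_mem_polyLT (hk.trans_le h) f)
    hp

theorem polyLT_zero : L.polyLT 0 = ⊥ := by
  refine eq_bot_iff.2 fun p hp => ?_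
  exact polyLT_induction (motive := fun p => p ∈ (⊥ : Submodule 𝕜 L.Poly)) (zero_mem _)
    (fun _ _ => add_mem) (fun k hk => absurd hk (Nat.not_lt_zero k)) hp

theorem exists_mem_polyLT (p : L.Poly) : ∃ n, p ∈ L.polyLT n := by
  induction p using poly_induction with
  | zero => exact ⟨0, zero_mem _⟩
  | add p q hp hq =>
    obtain ⟨m, hp⟩ := hp
    obtain ⟨n, hq⟩ := hq
    exact ⟨max m n, add_mem (polyLT_mono (le_max_left m n) hp) (polyLT_mono (le_max_right m n) hq)⟩
  | mono k f => exact ⟨k + 1, mono_mem_polyLT (Nat.lt_succ_self k) f⟩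

variable (L) in
/-- Evaluation of polynomials at `ω`. -/
def ev (ω : StrongDual 𝕜 Φ) : L.Poly →ₗ[𝕜] 𝕜 where
  toFun p := p ω
  map_add' _ _ := rfl
  map_smul' _ _ := rfl

@[simp] theorem ev_apply (ω : StrongDual 𝕜 Φ) (p : L.Poly) : L.ev ω p = p ω := rfl

theorem continuous_ev (ω : StrongDual 𝕜 Φ) : Continuous (L.ev ω) := by
  refine continuous_of_mono _ fun k n => ?_
  exact (ContinuousMultilinearMap.apply 𝕜 _ 𝕜 fun _ : Fin k => L.restr n ω).continuous.comp
    continuous_subtype_val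

instance : T2Space L.Poly :=
  T2Space.of_injective_continuous (f := fun (p : L.Poly) (ω : StrongDual 𝕜 Φ) => p ω)
    (fun _ _ h => poly_ext fun ω => congrFun h ω) (continuous_pi fun ω => continuous_ev ω)

/-! ### Directional derivatives -/

theorem exists_dirDeriv (σ : StrongDual 𝕜 Φ) (p : L.Poly) :
    ∃ q : L.Poly, ∀ ω, HasLineDerivAt 𝕜 p (q ω) ω σ := by
  obtain ⟨q, hq, h⟩ := exists_lineDeriv p.2 σ
  exact ⟨⟨q, hq⟩, h⟩

variable (L) in
/-- The derivative `D_σ` in direction `σ`. -/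
def dirDeriv (σ : StrongDual 𝕜 Φ) : L.Poly →ₗ[𝕜] L.Poly where
  toFun p := (exists_dirDeriv σ p).choose
  map_add' p q := poly_ext fun ω =>
    ((exists_dirDeriv σ (p + q)).choose_spec ω).unique
      (HasDerivAt.add ((exists_dirDeriv σ p).choose_spec ω) ((exists_dirDeriv σ q).choose_spec ω))
  map_smul' c p := poly_ext fun ω =>
    ((exists_dirDeriv σ (c • p)).choose_spec ω).unique
      (HasDerivAt.const_mul c ((exists_dirDeriv σ p).choose_spec ω))

theorem hasLineDerivAt_dirDeriv (σ : StrongDual 𝕜 Φ) (p : L.Poly) (ω : StrongDual 𝕜 Φ) :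
    HasLineDerivAt 𝕜 p (L.dirDeriv σ p ω) ω σ := (exists_dirDeriv σ p).choose_spec ω

theorem dirDeriv_apply_of_hasLineDerivAt {σ ω : StrongDual 𝕜 Φ} {p : L.Poly} {c : 𝕜}
    (h : HasLineDerivAt 𝕜 p c ω σ) : L.dirDeriv σ p ω = c :=
  (hasLineDerivAt_dirDeriv σ p ω).unique h

theorem dirDeriv_mono_succ_apply (σ : StrongDual 𝕜 Φ) {n : ℕ} (f : L.SymPow (n + 1))
    (ω : StrongDual 𝕜 Φ) : L.dirDeriv σ (L.mono (n + 1) f) ω =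
      (n + 1) * pair f (Fin.snoc (fun _ => ω) σ : Fin (n + 1) → StrongDual 𝕜 Φ) :=
  dirDeriv_apply_of_hasLineDerivAt (hasLineDerivAt_monoFun f ω σ)

theorem dirDeriv_mono_zero (σ : StrongDual 𝕜 Φ) (f : L.SymPow 0) : L.dirDeriv σ (L.mono 0 f) = 0 :=
  poly_ext fun ω => dirDeriv_apply_of_hasLineDerivAt (lineDeriv_monoFun_zero f ω σ)

theorem dirDeriv_mono_toSymPow (σ : StrongDual 𝕜 Φ) (n m : ℕ) (T : symTensorPow 𝕜 (E m) (n + 1)) :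
    L.dirDeriv σ (L.mono (n + 1) (L.toSymPow m (n + 1) T)) =
      L.mono n (L.toSymPow m n (((n : 𝕜) + 1) • ⟨_, lastContr_mem (L.restr m σ) T.2⟩)) := by
  refine poly_ext fun ω => ?_
  rw [dirDeriv_mono_succ_apply, mono_apply, map_smul, pair_smul, pair_toSymPow, pair_toSymPow,
    lastContr_apply]
  congr 2
  funext i
  refine Fin.lastCases ?_ (fun i => ?_) i <;> simp

theorem continuous_dirDeriv (σ : StrongDual 𝕜 Φ) : Continuous (L.dirDeriv σ) := by
  refine continuous_of_mono _ fun k m => ?_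
  cases k with
  | zero => simpa only [dirDeriv_mono_zero] using continuous_const
  | succ n =>
    simp only [dirDeriv_mono_toSymPow]
    have h : Continuous fun T : symTensorPow 𝕜 (E m) (n + 1) =>
        (⟨_, lastContr_mem (L.restr m σ) T.2⟩ : symTensorPow 𝕜 (E m) n) :=
      ((lastContr n (L.restr m σ)).continuous.comp continuous_subtype_val).subtype_mk _
    exact (continuous_mono n).comp ((continuous_toSymPow m n).comp (h.const_smul ((n : 𝕜) + 1)))

theorem dirDeriv_mem_polyLT (σ : StrongDual 𝕜 Φ) {n : ℕ} {p : L.Poly} (hp : p ∈ L.polyLT (n + 1)) :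
    L.dirDeriv σ p ∈ L.polyLT n := by
  refine polyLT_induction (motive := fun p => L.dirDeriv σ p ∈ L.polyLT n)
    (by simp) (fun p q hp hq => by rw [map_add]; exact add_mem hp hq) (fun k hk f => ?_) hp
  cases k with
  | zero => simp [dirDeriv_mono_zero]
  | succ k =>
    induction f using symPow_induction with
    | zero => simp
    | add f g hf hg => rw [map_add, map_add]; exact add_mem hf hg
    | incl m T =>
      rw [dirDeriv_mono_toSymPow]
      exact mono_mem_polyLT (by omega) _

/-- A polynomial all of whose derivatives vanish is constant. -/
theorem apply_eq_apply_zero_of_dirDeriv_eq_zero {p : L.Poly}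
    (h : ∀ σ, L.dirDeriv σ p = 0) (ω : StrongDual 𝕜 Φ) : p ω = p 0 := by
  -- On the line from `0` to `ω` the derivative of `p` is `D_ω p`.
  have hd : ∀ t : 𝕜, HasDerivAt (fun t : 𝕜 => p (t • ω)) 0 t := by
    intro t
    have h1 := hasLineDerivAt_dirDeriv ω p (t • ω)
    rw [h ω] at h1
    have h2 : HasDerivAt (fun s : 𝕜 => p (t • ω + s • ω)) 0 (t - t) := by
      rw [sub_self]; exact h1
    have h3 := h2.comp_sub_const t t
    refine h3.congr_of_eventuallyEq (Filter.Eventually.of_forall fun s => ?_)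
    change p (s • ω) = p (t • ω + (s - t) • ω)
    rw [← add_smul, add_sub_cancel]
  have := is_const_of_deriv_eq_zero (fun t => (hd t).differentiableAt) (fun t => (hd t).deriv) 1 0
  simpa using this

/-! ### Polynomials in one linear form -/

variable (L) in
/-- The polynomial `ω ↦ p(ω(ξ))`. -/
def ofLinear (ξ : Φ) : Polynomial 𝕜 →ₗ[𝕜] L.Poly :=
  Polynomial.lsum fun n => LinearMap.toSpanSingleton 𝕜 L.Poly (L.mono n (L.pow n ξ))

theorem ofLinear_X_pow (ξ : Φ) (n : ℕ) :
    L.ofLinear ξ (Polynomial.X ^ n) = L.mono n (L.pow n ξ) := by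
  rw [← Polynomial.monomial_one_right_eq_X_pow, ofLinear, Polynomial.lsum_apply,
    Polynomial.sum_monomial_index] <;> simp

theorem mono_pow_apply (k : ℕ) (ξ : Φ) (ω : StrongDual 𝕜 Φ) :
    L.mono k (L.pow k ξ) ω = ω ξ ^ k := by
  rw [mono_apply, pair_pow]
  simp

theorem ofLinear_apply (ξ : Φ) (p : Polynomial 𝕜) (ω : StrongDual 𝕜 Φ) :
    L.ofLinear ξ p ω = p.eval (ω ξ) := by
  induction p using Polynomial.induction_on' with
  | add p q hp hq => rw [map_add, poly_add_apply, hp, hq, Polynomial.eval_add]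
  | monomial n a =>
    rw [← Polynomial.C_mul_X_pow_eq_monomial, ← Polynomial.smul_eq_C_mul, map_smul, ofLinear_X_pow,
      poly_smul_apply, mono_pow_apply]
    simp

theorem dirDeriv_ofLinear (σ : StrongDual 𝕜 Φ) (ξ : Φ) (p : Polynomial 𝕜) :
    L.dirDeriv σ (L.ofLinear ξ p) = σ ξ • L.ofLinear ξ p.derivative := by
  refine poly_ext fun ω => dirDeriv_apply_of_hasLineDerivAt ?_
  rw [poly_smul_apply, ofLinear_apply]
  have h1 : HasDerivAt (fun t : 𝕜 => ω ξ + t * σ ξ) (σ ξ) 0 := by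
    simpa using ((hasDerivAt_id (0 : 𝕜)).mul_const (σ ξ)).const_add (ω ξ)
  have h2 : HasDerivAt (fun x => p.eval x) (p.derivative.eval (ω ξ)) (ω ξ + 0 * σ ξ) := by
    simpa using p.hasDerivAt (ω ξ)
  have h3 := h2.comp (0 : 𝕜) h1
  rw [mul_comm] at h3
  refine h3.congr_of_eventuallyEq (Filter.Eventually.of_forall fun t => ?_)
  change L.ofLinear ξ p (ω + t • σ) = p.eval (ω ξ + t * σ ξ)
  rw [ofLinear_apply]
  rfl

theorem pow_incl (n k : ℕ) (x : E n) : L.pow k (L.incl n x) = L.toSymPow n k (symPow 𝕜 k x) := by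
  refine symPow_ext fun ω => ?_
  rw [pair_pow, pair_toSymPow, symPow_apply]
  rfl

/-- Continuous operators are determined by their values on polynomials in one linear form. -/
theorem eq_of_ofLinear {F : Type*} [AddCommGroup F] [Module 𝕜 F] [TopologicalSpace F] [T2Space F]
    {S T : L.Poly →ₗ[𝕜] F} (hS : Continuous S) (hT : Continuous T)
    (h : ∀ ξ p, S (L.ofLinear ξ p) = T (L.ofLinear ξ p)) : S = T := by
  refine LinearMap.ext fun p => ?_
  induction p using poly_induction with
  | zero => simp
  | add p q hp hq => rw [map_add, map_add, hp, hq]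
  | mono k f =>
    induction f using symPow_induction with
    | zero => simp
    | add f g hf hg => rw [map_add, map_add, map_add, hf, hg]
    | incl n T' =>
      have hc : Continuous ((L.mono k).comp (L.toSymPow n k)) :=
        (continuous_mono k).comp (continuous_toSymPow n k)
      exact congrArg (fun f => f T') (eq_of_symPow (f := S.comp ((L.mono k).comp (L.toSymPow n k)))
        (g := T.comp ((L.mono k).comp (L.toSymPow n k))) (hS.comp hc) (hT.comp hc) fun b => by
          have := h (L.incl n b) (Polynomial.X ^ k)
          rw [ofLinear_X_pow, pow_incl] at this
          exact this)

end LBSpace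

namespace LBSpace

variable {𝕜 : Type*} [RCLike 𝕜] {E : ℕ → Type*}
  [∀ n, NormedAddCommGroup (E n)] [∀ n, NormedSpace 𝕜 (E n)] [∀ n, CompleteSpace (E n)]
  {Φ : Type*} [AddCommGroup Φ] [Module 𝕜 Φ] [TopologicalSpace Φ]
  {L : LBSpace 𝕜 E Φ}

/-! ### Powers of the gradient -/

/-- Realizing the function-level `iterD` as an endomorphism of `L.Poly` yields the linearity of
`grad` and its vanishing in orders at or above the degree bound. -/
theorem exists_iterD_eq (k : ℕ) (σ : Fin k → StrongDual 𝕜 Φ) :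
    ∃ T : L.Poly →ₗ[𝕜] L.Poly, (∀ p : L.Poly, iterD k σ p = T p) ∧
      ∀ n, ∀ p ∈ L.polyLT (n + k), T p ∈ L.polyLT n := by
  induction k with
  | zero => exact ⟨LinearMap.id, fun p => rfl, fun n p hp => hp⟩
  | succ k ih =>
    obtain ⟨T, hT, hT'⟩ := ih (Fin.init σ)
    refine ⟨T.comp (L.dirDeriv (σ (Fin.last k))), fun p => ?_,
      fun n p hp => hT' n _ (dirDeriv_mem_polyLT _ hp)⟩
    have : (fun ω => lineDeriv 𝕜 (p : StrongDual 𝕜 Φ → 𝕜) ω (σ (Fin.last k))) =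
        L.dirDeriv (σ (Fin.last k)) p :=
      funext fun ω => (hasLineDerivAt_dirDeriv _ p ω).lineDeriv
    rw [iterD, this, hT]
    rfl

theorem grad_add (k : ℕ) (p q : L.Poly) (ω : StrongDual 𝕜 Φ) :
    grad k (p + q) ω = grad k p ω + grad k q ω := by
  refine symPow_ext fun σ => ?_
  obtain ⟨T, hT, -⟩ := exists_iterD_eq (L := L) k σ
  rw [pair_add, pair_grad, pair_grad, pair_grad, hT, hT, hT, map_add, poly_add_apply]

theorem grad_smul (k : ℕ) (c : 𝕜) (p : L.Poly) (ω : StrongDual 𝕜 Φ) :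
    grad k (c • p) ω = c • grad k p ω := by
  refine symPow_ext fun σ => ?_
  obtain ⟨T, hT, -⟩ := exists_iterD_eq (L := L) k σ
  rw [pair_smul, pair_grad, pair_grad, hT, hT, map_smul, poly_smul_apply]

theorem grad_eq_zero {k n : ℕ} (h : n ≤ k) {p : L.Poly} (hp : p ∈ L.polyLT n)
    (ω : StrongDual 𝕜 Φ) : grad k p ω = 0 := by
  refine symPow_ext fun σ => ?_
  obtain ⟨T, hT, hT'⟩ := exists_iterD_eq (L := L) k σ
  have h0 := hT' 0 p (polyLT_mono (by omega) hp)
  rw [polyLT_zero, Submodule.mem_bot] at h0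
  rw [pair_grad, hT, h0, pair_zero, poly_zero_apply]

/-- Chain rule: every `D_σ` contributes a factor `σ ξ`, and the product of these factors is the
pairing with `ξ^{⊗k}`. -/
theorem grad_ofLinear (k : ℕ) (ξ : Φ) (p : Polynomial 𝕜) (ω : StrongDual 𝕜 Φ) :
    grad k (L.ofLinear ξ p) ω = (Polynomial.derivative^[k] p).eval (ω ξ) • L.pow k ξ := by
  refine symPow_ext fun σ => ?_
  have key : iterD k σ (L.ofLinear ξ p) =
      L.ofLinear ξ ((∏ i, σ i ξ) • Polynomial.derivative^[k] p) := by
    induction k generalizing p with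
    | zero => simp [iterD]
    | succ k ih =>
      have : (fun ω => lineDeriv 𝕜 (L.ofLinear ξ p : StrongDual 𝕜 Φ → 𝕜) ω (σ (Fin.last k))) =
          L.ofLinear ξ (σ (Fin.last k) ξ • p.derivative) := by
        funext ω
        rw [(hasLineDerivAt_dirDeriv _ _ ω).lineDeriv, dirDeriv_ofLinear, map_smul]
      rw [iterD, this, ih, Polynomial.iterate_derivative_smul, smul_smul,
        Function.iterate_succ_apply, Fin.prod_univ_castSucc]
      rfl
  rw [pair_grad, key, pair_smul, pair_pow, map_smul, poly_smul_apply, ofLinear_apply, mul_comm]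

/-- Differentiating `k` times a form of degree `k + j` gives the falling factorial; the other `j`
slots are filled with `ω`. -/
theorem grad_mono_toSymPow (k j m : ℕ) (T : symTensorPow 𝕜 (E m) (k + j)) (ω : StrongDual 𝕜 Φ) :
    grad k (L.mono (k + j) (L.toSymPow m (k + j) T)) ω =
      L.toSymPow m k (((k + j).descFactorial k : 𝕜) •
        ⟨splitForm 𝕜 (E m) k j T.1 fun _ => L.restr m ω, splitForm_mem T _⟩) := by
  refine symPow_ext fun σ => ?_
  rw [pair_grad, map_smul, pair_smul, pair_toSymPow, splitForm_apply]
  refine (iterD_monoFun k (k + j) _ σ ω).trans ?_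
  rw [pair_toSymPow]
  congr 2
  funext i
  refine Fin.addCases (fun i => ?_) (fun i => ?_) i <;> simp [fill]

/-! ### The operators `α(∇) + M(β(∇))` -/

theorem alphaNabla_eq_sum (α : L.W0) {n : ℕ} {p : L.Poly} (hp : p ∈ L.polyLT n)
    (ω : StrongDual 𝕜 Φ) :
    alphaNabla α p ω = ∑ k ∈ Finset.range n, α k (grad (k + 1) p ω) := by
  refine finsum_eq_sum_of_support_subset _ fun k hk => ?_
  by_contra h
  simp only [Finset.coe_range, Set.mem_Iio, not_lt] at h
  exact hk (by simp [grad_eq_zero (Nat.le_succ_of_le h) hp ω])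

theorem mulBetaNabla_eq_sum (β : L.W1) {n : ℕ} {p : L.Poly} (hp : p ∈ L.polyLT n)
    (ω : StrongDual 𝕜 Φ) :
    mulBetaNabla β p ω = ∑ k ∈ Finset.range n, ω (β k (grad (k + 2) p ω)) := by
  refine finsum_eq_sum_of_support_subset _ fun k hk => ?_
  by_contra h
  simp only [Finset.coe_range, Set.mem_Iio, not_lt] at h
  exact hk (by simp [grad_eq_zero (le_add_right h : n ≤ k + 2) hp ω])

/-- The map `p ↦ α(∇)p + M(β(∇))p`, with values in the functions on `Φ'`. -/
def genFunctions (α : L.W0) (β : L.W1) : L.Poly →ₗ[𝕜] (StrongDual 𝕜 Φ → 𝕜) where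
  toFun p ω := alphaNabla α p ω + mulBetaNabla β p ω
  map_add' p q := by
    obtain ⟨m, hp⟩ := exists_mem_polyLT p
    obtain ⟨n, hq⟩ := exists_mem_polyLT q
    have hp := polyLT_mono (le_max_left m n) hp
    have hq := polyLT_mono (le_max_right m n) hq
    funext ω
    rw [Pi.add_apply]
    simp only [alphaNabla_eq_sum α hp, alphaNabla_eq_sum α hq, alphaNabla_eq_sum α (add_mem hp hq),
      mulBetaNabla_eq_sum β hp, mulBetaNabla_eq_sum β hq, mulBetaNabla_eq_sum β (add_mem hp hq),
      grad_add, map_add, Finset.sum_add_distrib]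
    ring
  map_smul' c p := by
    obtain ⟨m, hp⟩ := exists_mem_polyLT p
    funext ω
    rw [Pi.smul_apply]
    simp only [alphaNabla_eq_sum α hp, alphaNabla_eq_sum α (Submodule.smul_mem _ c hp),
      mulBetaNabla_eq_sum β hp, mulBetaNabla_eq_sum β (Submodule.smul_mem _ c hp),
      grad_smul, map_smul, smul_eq_mul, ← Finset.mul_sum, RingHom.id_apply, mul_add]

/-- Contracting `k ≥ 1` slots with a functional leaves a tensor of degree `n - k < n`, boundedly on
each Banach step, which is the continuity that the direct sum topology requires. -/
theorem exists_functional_grad {k : ℕ} (a : L.SymPow k →L[𝕜] 𝕜) (hk : 1 ≤ k) (n m : ℕ) :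
    ∃ S : symTensorPow 𝕜 (E m) n →L[𝕜] L.Poly, ∀ T, S T ∈ L.polyLT n ∧
      ∀ ω, S T ω = a (grad k (L.mono n (L.toSymPow m n T)) ω) := by
  by_cases hkn : k ≤ n
  · obtain ⟨j, rfl⟩ := Nat.exists_eq_add_of_le hkn
    let b : symTensorPow 𝕜 (E m) k →L[𝕜] 𝕜 := a.comp ⟨L.toSymPow m k, continuous_toSymPow m k⟩
    let M : symTensorPow 𝕜 (E m) j →L[𝕜] L.Poly :=
      ⟨(L.mono j).comp (L.toSymPow m j), (continuous_mono j).comp (continuous_toSymPow m j)⟩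
    refine ⟨((k + j).descFactorial k : 𝕜) • M.comp (contrFunctional j b), fun T => ⟨?_, fun ω => ?_⟩⟩
    · exact Submodule.smul_mem _ _ (mono_mem_polyLT (by omega) _)
    · rw [grad_mono_toSymPow, map_smul, map_smul]
      rfl
  · refine ⟨0, fun T => ⟨zero_mem _, fun ω => ?_⟩⟩
    rw [grad_eq_zero (not_le.1 hkn) (mono_mem_polyLT (Nat.lt_succ_self n) _), map_zero]
    rfl

/-- Here `k` slots are replaced by one, and `k ≥ 2` makes the degree drop. The operator `b` factors
through a step `E r` with `r ≥ m`, so that its value and the remaining slots, moved from `E m` by an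
isometry, form a tensor over the single Banach space `E r`. -/
theorem exists_operator_grad {k : ℕ} (b : L.SymPow k →L[𝕜] Φ) (hk : 2 ≤ k) (n m : ℕ) :
    ∃ S : symTensorPow 𝕜 (E m) n →L[𝕜] L.Poly, ∀ T, S T ∈ L.polyLT n ∧
      ∀ ω : StrongDual 𝕜 Φ, S T ω = ω (b (grad k (L.mono n (L.toSymPow m n T)) ω)) := by
  by_cases hkn : k ≤ n
  · obtain ⟨j, rfl⟩ := Nat.exists_eq_add_of_le hkn
    obtain ⟨r, hr, ψ, hψ⟩ := L.exists_factor
      (b.comp (⟨L.toSymPow m k, continuous_toSymPow m k⟩ : symTensorPow 𝕜 (E m) k →L[𝕜] _)) m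
    obtain ⟨e, he⟩ := L.exists_isometry hr
    let M : symTensorPow 𝕜 (E r) (j + 1) →L[𝕜] L.Poly :=
      ⟨(L.mono (j + 1)).comp (L.toSymPow r (j + 1)),
        (continuous_mono (j + 1)).comp (continuous_toSymPow r (j + 1))⟩
    refine ⟨((k + j).descFactorial k : 𝕜) • M.comp (contrSymm j e.toContinuousLinearMap ψ),
      fun T => ⟨?_, fun ω => ?_⟩⟩
    · exact Submodule.smul_mem _ _ (mono_mem_polyLT (by omega) _)
    · rw [grad_mono_toSymPow, map_smul, map_smul, map_smul]
      refine congrArg (fun z => ((k + j).descFactorial k : 𝕜) * z) ?_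
      change (contrSymm j e.toContinuousLinearMap ψ T).1 (fun _ => L.restr r ω) = _
      have h1 : (L.restr r ω).comp e.toContinuousLinearMap = L.restr m ω :=
        ContinuousLinearMap.ext fun x => congrArg ω (he x)
      rw [contrSymm_const, h1, contrOp_apply]
      exact congrArg ω (hψ _)
  · refine ⟨0, fun T => ⟨zero_mem _, fun ω => ?_⟩⟩
    rw [grad_eq_zero (not_le.1 hkn) (mono_mem_polyLT (Nat.lt_succ_self n) _), map_zero, map_zero]
    rfl

variable (L) in
theorem coe_sum_apply {ι : Type*} (s : Finset ι) (f : ι → L.Poly) (ω : StrongDual 𝕜 Φ) :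
    (∑ i ∈ s, f i) ω = ∑ i ∈ s, f i ω := map_sum (L.ev ω) f s

/-- `α(∇) + M(β(∇))` is a well-defined element of `𝕍(Φ)`. -/
theorem exists_isGenerator (α : L.W0) (β : L.W1) :
    ∃ V : L.Poly →L[𝕜] L.Poly, IsGenerator V α β ∧ LowersDegree V := by
  -- On each homogeneous Banach step only finitely many coefficients act, so a finite sum of the
  -- bounded operators above suffices.
  have key : ∀ n m, ∃ S : symTensorPow 𝕜 (E m) n →L[𝕜] L.Poly, ∀ T, S T ∈ L.polyLT n ∧
      ∀ ω, S T ω = genFunctions α β (L.mono n (L.toSymPow m n T)) ω := by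
    intro n m
    choose A hA using fun k => exists_functional_grad (α k) (Nat.le_add_left 1 k) n m
    choose B hB using fun k => exists_operator_grad (β k) (Nat.le_add_left 2 k) n m
    refine ⟨∑ k ∈ Finset.range (n + 1), (A k + B k), fun T => ⟨?_, fun ω => ?_⟩⟩
    · rw [sum_apply]
      exact Submodule.sum_mem _ fun k _ => add_mem (hA k T).1 (hB k T).1
    · have hmem := mono_mem_polyLT (Nat.lt_succ_self n) (L.toSymPow m n T)
      rw [sum_apply, coe_sum_apply]
      change _ = alphaNabla α _ ω + mulBetaNabla β _ ω
      rw [alphaNabla_eq_sum α hmem, mulBetaNabla_eq_sum β hmem, ← Finset.sum_add_distrib]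
      exact Finset.sum_congr rfl fun k _ => congrArg₂ (· + ·) ((hA k T).2 ω) ((hB k T).2 ω)
  have hmem : ∀ n (f : L.SymPow n), ∃ q ∈ L.polyLT n, ∀ ω, q ω = genFunctions α β (L.mono n f) ω := by
    intro n f
    induction f using symPow_induction with
    | zero => exact ⟨0, zero_mem _, fun ω => by simp⟩
    | add f g hf hg =>
      obtain ⟨q, hq, hq'⟩ := hf
      obtain ⟨r, hr, hr'⟩ := hg
      exact ⟨q + r, add_mem hq hr, fun ω => by
        rw [map_add, map_add, Pi.add_apply, poly_add_apply, hq', hr']⟩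
    | incl m T =>
      obtain ⟨S, hS⟩ := key n m
      exact ⟨S T, (hS T).1, (hS T).2⟩
  have hpoly : ∀ p : L.Poly, genFunctions α β p ∈ L.polySubmodule := by
    intro p
    induction p using poly_induction with
    | zero => rw [map_zero]; exact zero_mem _
    | add p q hp hq => rw [map_add]; exact add_mem hp hq
    | mono k f =>
      obtain ⟨q, -, hq⟩ := hmem k f
      exact (funext hq : q.1 = _) ▸ q.2
  let V₀ : L.Poly →ₗ[𝕜] L.Poly := (genFunctions α β).codRestrict L.polySubmodule hpoly
  have hV₀ : ∀ p ω, V₀ p ω = genFunctions α β p ω := fun _ _ => rfl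
  have hc : Continuous V₀ := by
    refine continuous_of_mono _ fun n m => ?_
    obtain ⟨S, hS⟩ := key n m
    exact S.continuous.congr fun T => poly_ext (hS T).2
  refine ⟨⟨V₀, hc⟩, fun p ω => rfl, fun n p hp => ?_⟩
  refine polyLT_induction (motive := fun p => V₀ p ∈ L.polyLT n) (by simp)
    (fun p q hp hq => by rw [map_add]; exact add_mem hp hq) (fun k hk f => ?_) hp
  obtain ⟨q, hq, hq'⟩ := hmem k f
  have : V₀ (L.mono k f) = q := poly_ext fun ω => (hV₀ _ ω).trans (hq' ω).symm
  rw [this]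
  exact polyLT_mono (Nat.lt_succ_iff.1 hk) hq

end LBSpace

/-! ### Shift-invariant operators on polynomials in one variable -/

section OneVariable

open PowerSeries

variable {𝕜 : Type*} [Field 𝕜]

theorem isLocallyNilpotent_derivative :
    IsLocallyNilpotent (Polynomial.derivative : Module.End 𝕜 (Polynomial 𝕜)) := fun p =>
  ⟨p.natDegree + 1, by
    rw [Module.End.pow_apply]
    exact Polynomial.iterate_derivative_eq_zero (Nat.lt_succ_self _)⟩

variable (𝕜) in
/-- The operator `c(d/dx)` on polynomials. -/
def diffOp : 𝕜⟦X⟧ →ₐ[𝕜] Module.End 𝕜 (Polynomial 𝕜) :=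
  psAct Polynomial.derivative isLocallyNilpotent_derivative

@[simp] theorem diffOp_X : diffOp 𝕜 X = Polynomial.derivative :=
  psAct_X isLocallyNilpotent_derivative

theorem diffOp_comm (a b : 𝕜⟦X⟧) (p : Polynomial 𝕜) :
    diffOp 𝕜 a (diffOp 𝕜 b p) = diffOp 𝕜 b (diffOp 𝕜 a p) := by
  rw [← Module.End.mul_apply, ← Module.End.mul_apply, ← map_mul, ← map_mul, mul_comm]

theorem diffOp_smul_X (r : 𝕜) (p : Polynomial 𝕜) :
    diffOp 𝕜 (r • X) p = r • Polynomial.derivative p := by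
  rw [map_smul, diffOp_X]
  rfl

theorem diffOp_eq_sum {m : ℕ} {p : Polynomial 𝕜} (hp : p.natDegree < m) (c : 𝕜⟦X⟧) :
    diffOp 𝕜 c p = ∑ n ∈ Finset.range m, coeff n c • Polynomial.derivative^[n] p := by
  have h : ((Polynomial.derivative : Module.End 𝕜 (Polynomial 𝕜)) ^ m) p = 0 := by
    rw [Module.End.pow_apply]
    exact Polynomial.iterate_derivative_eq_zero hp
  rw [diffOp, psAct_eq_sum _ h]
  simp only [Module.End.pow_apply]

/-- Only the `n`th derivative of `X ^ n` survives at `0`. This puts power series in duality with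
polynomials through `p ↦ (c(d/dx) p)(0)`. -/
theorem eval_zero_diffOp_X_pow (c : 𝕜⟦X⟧) (n : ℕ) :
    (diffOp 𝕜 c (Polynomial.X ^ n)).eval 0 = n ! * coeff n c := by
  rw [diffOp_eq_sum (m := n + 1) (by simp), Polynomial.eval_finsetSum, Finset.sum_eq_single n]
  · simp [Polynomial.iterate_derivative_X_pow_eq_smul, Nat.descFactorial_self, mul_comm]
  · intro i hi hin
    have : i < n := lt_of_le_of_ne (Nat.lt_succ_iff.1 (Finset.mem_range.1 hi)) hin
    simp [Polynomial.iterate_derivative_X_pow_eq_smul, Nat.sub_ne_zero_of_lt this]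
  · simp

/-- Every functional on polynomials is of the form `p ↦ (c(d/dx) p)(0)`. -/
theorem exists_eval_zero_diffOp_eq [CharZero 𝕜] (F : Polynomial 𝕜 →ₗ[𝕜] 𝕜) :
    ∃ c : 𝕜⟦X⟧, ∀ p, F p = (diffOp 𝕜 c p).eval 0 := by
  refine ⟨PowerSeries.mk fun n => (n ! : 𝕜)⁻¹ * F (Polynomial.X ^ n), fun p => ?_⟩
  have h : F = (Polynomial.leval 0).comp
      (diffOp 𝕜 (PowerSeries.mk fun n => (n ! : 𝕜)⁻¹ * F (Polynomial.X ^ n))) := by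
    refine Polynomial.lhom_ext' fun n => LinearMap.ext_ring ?_
    have hn : (n ! : 𝕜) ≠ 0 := Nat.cast_ne_zero.2 (Nat.factorial_ne_zero n)
    simp only [LinearMap.comp_apply, Polynomial.monomial_one_right_eq_X_pow, Polynomial.leval_apply,
      eval_zero_diffOp_X_pow, coeff_mk]
    rw [mul_inv_cancel_left₀ hn]
  exact congrArg (fun f => f p) h

theorem constantCoeff_eq_eval_zero_diffOp (c : 𝕜⟦X⟧) :
    constantCoeff c = (diffOp 𝕜 c 1).eval 0 := by
  simpa using (eval_zero_diffOp_X_pow c 0).symm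

end OneVariable

/-! ### Uniqueness for differential equations on polynomials -/

namespace LBSpace

open PowerSeries

variable {𝕜 : Type*} [RCLike 𝕜] {E : ℕ → Type*}
  [∀ n, NormedAddCommGroup (E n)] [∀ n, NormedSpace 𝕜 (E n)] [∀ n, CompleteSpace (E n)]
  {Φ : Type*} [AddCommGroup Φ] [Module 𝕜 Φ] [TopologicalSpace Φ]
  {L : LBSpace 𝕜 E Φ}

theorem dirDeriv_ofLinear_eq_diffOp (σ : StrongDual 𝕜 Φ) (ξ : Φ) (p : Polynomial 𝕜) :
    L.dirDeriv σ (L.ofLinear ξ p) = L.ofLinear ξ (diffOp 𝕜 (σ ξ • X) p) := by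
  rw [dirDeriv_ofLinear, diffOp_smul_X, map_smul]

/-- A family of polynomials satisfying `D_ρ Z = Z b_ρ(d/dx)` is determined by its values at `0`. -/
theorem eq_zero_of_dirDeriv {Z : Polynomial 𝕜 →ₗ[𝕜] L.Poly}
    (hZ : ∀ ρ, ∃ b : 𝕜⟦X⟧, constantCoeff b = 0 ∧ ∀ p, L.dirDeriv ρ (Z p) = Z (diffOp 𝕜 b p))
    (h0 : ∀ p, Z p 0 = 0) (p : Polynomial 𝕜) : Z p = 0 := by
  -- Induction on the number of derivatives that annihilate `p`. As `b` has no constant term,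
  -- `b(d/dx)` lowers this number, so all derivatives of `Z p` vanish and `Z p` is the constant `Z p
  -- 0 = 0`.
  obtain ⟨n, hn⟩ := isLocallyNilpotent_derivative p
  induction n generalizing p with
  | zero =>
    have : p = 0 := hn
    rw [this, map_zero]
  | succ n ih =>
    refine poly_ext fun ω => ?_
    rw [apply_eq_apply_zero_of_dirDeriv_eq_zero (fun ρ => ?_) ω, h0]
    · rfl
    · obtain ⟨b, hb, h⟩ := hZ ρ
      rw [h]
      refine ih _ ?_
      obtain ⟨c, rfl⟩ := X_dvd_iff.2 hb
      have : (Polynomial.derivative : Module.End 𝕜 (Polynomial 𝕜)) ^ n * diffOp 𝕜 (X * c) =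
          diffOp 𝕜 c * (Polynomial.derivative : Module.End 𝕜 (Polynomial 𝕜)) ^ (n + 1) := by
        rw [← diffOp_X, ← map_pow, ← map_pow, ← map_mul, ← map_mul]
        congr 1
        ring
      rw [← Module.End.mul_apply, this, Module.End.mul_apply, hn, map_zero]

/-- `T ∘ Y` satisfies the same differential equations as `Y`, and solutions are determined by their
values at `0`; so `T` acts on `Y` as multiplication by the quotient of the initial values. -/
theorem exists_diffOp_of_commute {Y : Polynomial 𝕜 →ₗ[𝕜] L.Poly}
    (hY : ∀ ρ, ∃ b : 𝕜⟦X⟧, constantCoeff b = 0 ∧ ∀ p, L.dirDeriv ρ (Y p) = Y (diffOp 𝕜 b p))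
    (h1 : Y 1 0 ≠ 0) {T : Module.End 𝕜 L.Poly} (hT : ∀ ρ, Commute T (L.dirDeriv ρ)) :
    ∃ c : 𝕜⟦X⟧, ∀ p, T (Y p) = Y (diffOp 𝕜 c p) := by
  obtain ⟨a, ha⟩ := exists_eval_zero_diffOp_eq ((L.ev 0).comp Y)
  obtain ⟨f, hf⟩ := exists_eval_zero_diffOp_eq ((L.ev 0).comp (T.comp Y))
  have ha0 : constantCoeff a ≠ 0 := by
    rw [constantCoeff_eq_eval_zero_diffOp, ← ha]
    exact h1
  -- The series `a` and `f` represent the initial values of `Y` and `T ∘ Y`; `a` is invertible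
  -- because its constant term is `Y 1 0 ≠ 0`.
  refine ⟨a⁻¹ * f, fun p => ?_⟩
  have key := eq_zero_of_dirDeriv (Z := T.comp Y - Y.comp (diffOp 𝕜 (a⁻¹ * f))) ?_ ?_ p
  · exact sub_eq_zero.1 key
  · intro ρ
    obtain ⟨b, hb, h⟩ := hY ρ
    refine ⟨b, hb, fun p => ?_⟩
    have hcomm : ∀ q, L.dirDeriv ρ (T q) = T (L.dirDeriv ρ q) := fun q =>
      (congrArg (fun S : Module.End 𝕜 L.Poly => S q) (hT ρ).eq).symm
    simp only [LinearMap.sub_apply, LinearMap.comp_apply, map_sub]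
    rw [hcomm, h, h, diffOp_comm]
  · intro p
    have h2 : Y (diffOp 𝕜 (a⁻¹ * f) p) 0 = T (Y p) 0 := by
      refine (ha _).trans (Eq.trans ?_ (hf p).symm)
      rw [← Module.End.mul_apply, ← map_mul, ← mul_assoc, PowerSeries.mul_inv_cancel a ha0, one_mul]
    rw [LinearMap.sub_apply, poly_sub_apply, LinearMap.comp_apply, LinearMap.comp_apply, h2, sub_self]

/-! ### Shift-invariant operators -/

/-- Continuous operators on polynomials that commute with all derivatives. -/
structure IsShiftInvariant (T : Module.End 𝕜 L.Poly) : Prop where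
  continuous : Continuous T
  commute : ∀ ρ, Commute T (L.dirDeriv ρ)

theorem ofLinear_one (ξ : Φ) (ω : StrongDual 𝕜 Φ) : L.ofLinear ξ 1 ω = 1 := by
  rw [ofLinear_apply, Polynomial.eval_one]

theorem IsShiftInvariant.exists_diffOp {T : Module.End 𝕜 L.Poly} (hT : IsShiftInvariant T) (ξ : Φ) :
    ∃ c : 𝕜⟦X⟧, ∀ p, T (L.ofLinear ξ p) = L.ofLinear ξ (diffOp 𝕜 c p) :=
  exists_diffOp_of_commute
    (fun ρ => ⟨ρ ξ • X, by simp, fun p => dirDeriv_ofLinear_eq_diffOp ρ ξ p⟩)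
    (by rw [ofLinear_one]; exact one_ne_zero) hT.commute

/-- On polynomials in a fixed linear form both operators are power series in `d/dx`, which commute;
density extends this to all polynomials. -/
theorem commute_of_diffOp {S T : Module.End 𝕜 L.Poly} (hS : Continuous S) (hT : Continuous T)
    (hS' : ∀ ξ, ∃ c : 𝕜⟦X⟧, ∀ p, S (L.ofLinear ξ p) = L.ofLinear ξ (diffOp 𝕜 c p))
    (hT' : ∀ ξ, ∃ c : 𝕜⟦X⟧, ∀ p, T (L.ofLinear ξ p) = L.ofLinear ξ (diffOp 𝕜 c p)) :
    Commute S T := by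
  refine eq_of_ofLinear (hS.comp hT) (hT.comp hS) fun ξ p => ?_
  obtain ⟨a, ha⟩ := hS' ξ
  obtain ⟨b, hb⟩ := hT' ξ
  rw [Module.End.mul_apply, Module.End.mul_apply, ha, hb, ha, hb, diffOp_comm]

theorem IsShiftInvariant.of_diffOp {T : Module.End 𝕜 L.Poly} (hT : Continuous T)
    (h : ∀ ξ, ∃ c : 𝕜⟦X⟧, ∀ p, T (L.ofLinear ξ p) = L.ofLinear ξ (diffOp 𝕜 c p)) :
    IsShiftInvariant T :=
  ⟨hT, fun ρ => commute_of_diffOp hT (continuous_dirDeriv ρ) h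
    fun ξ => ⟨_, fun p => dirDeriv_ofLinear_eq_diffOp ρ ξ p⟩⟩

theorem isShiftInvariant_dirDeriv (σ : StrongDual 𝕜 Φ) : IsShiftInvariant (L.dirDeriv σ) :=
  .of_diffOp (continuous_dirDeriv σ) fun ξ => ⟨_, fun p => dirDeriv_ofLinear_eq_diffOp σ ξ p⟩

theorem IsShiftInvariant.commute_of {S T : Module.End 𝕜 L.Poly} (hS : IsShiftInvariant S)
    (hT : IsShiftInvariant T) : Commute S T :=
  commute_of_diffOp hS.continuous hT.continuous hS.exists_diffOp hT.exists_diffOp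

/-! ### Power series in an operator that lowers the degree -/

/-- The operator `V` lowers the degree of polynomials. -/
def Lowers (V : Module.End 𝕜 L.Poly) : Prop := ∀ n, ∀ p ∈ L.polyLT (n + 1), V p ∈ L.polyLT n

theorem Lowers.pow_mem {V : Module.End 𝕜 L.Poly} (hV : Lowers V) (k n : ℕ) {p : L.Poly}
    (hp : p ∈ L.polyLT (n + k)) : (V ^ k) p ∈ L.polyLT n := by
  induction k generalizing p with
  | zero => exact hp
  | succ k ih =>
    rw [pow_succ, Module.End.mul_apply]
    exact ih (hV _ _ hp)

theorem Lowers.pow_eq_zero {V : Module.End 𝕜 L.Poly} (hV : Lowers V) {n k : ℕ} (h : n ≤ k)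
    {p : L.Poly} (hp : p ∈ L.polyLT n) : (V ^ k) p = 0 := by
  have := hV.pow_mem k 0 (polyLT_mono (by omega) hp)
  rwa [polyLT_zero, Submodule.mem_bot] at this

theorem Lowers.isLocallyNilpotent {V : Module.End 𝕜 L.Poly} (hV : Lowers V) :
    IsLocallyNilpotent V := fun p =>
  (exists_mem_polyLT p).imp fun _ hp => hV.pow_eq_zero le_rfl hp

/-- On polynomials of a fixed degree the series is a fixed finite sum, and continuity on a direct
sum is tested degree by degree. -/
theorem Lowers.continuous_psAct {V : Module.End 𝕜 L.Poly} (hV : Lowers V) (hc : Continuous V)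
    (f : 𝕜⟦X⟧) : Continuous (psAct V hV.isLocallyNilpotent f) := by
  refine continuous_of_mono _ fun k m => ?_
  have h : ∀ T : symTensorPow 𝕜 (E m) k,
      psAct V hV.isLocallyNilpotent f (L.mono k (L.toSymPow m k T)) =
      ∑ n ∈ Finset.range (k + 1), coeff n f • (V ^ n) (L.mono k (L.toSymPow m k T)) := fun T =>
    psAct_eq_sum _ (hV.pow_eq_zero le_rfl (mono_mem_polyLT (Nat.lt_succ_self k) _)) f
  have hpow : ∀ n : ℕ, Continuous (V ^ n : Module.End 𝕜 L.Poly) := by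
    intro n
    induction n with
    | zero => exact continuous_id
    | succ n ih => rw [pow_succ]; exact ih.comp hc
  simp only [h]
  refine continuous_finsetSum _ fun n _ => ?_
  have hn := (hpow n).comp ((continuous_mono (L := L) k).comp (continuous_toSymPow m k))
  exact hn.const_smul (coeff n f)

theorem Lowers.psAct_lowers {V : Module.End 𝕜 L.Poly} (hV : Lowers V) {f : 𝕜⟦X⟧}
    (hf : constantCoeff f = 0) : Lowers (psAct V hV.isLocallyNilpotent f) := by
  intro n p hp
  rw [psAct_eq_sum _ (hV.pow_eq_zero le_rfl hp)]
  refine Submodule.sum_mem _ fun k _ => ?_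
  cases k with
  | zero => simp [hf]
  | succ k => exact Submodule.smul_mem _ _ (hV.pow_mem (k + 1) n (polyLT_mono (by omega) hp))

/-! ### Conjugation with exponentials -/

/-- The commutator `T ↦ T V - V T`. -/
def rightAd (V : Module.End 𝕜 L.Poly) : Module.End 𝕜 (Module.End 𝕜 L.Poly) :=
  LinearMap.mulRight 𝕜 V - LinearMap.mulLeft 𝕜 V

theorem rightAd_apply (V T : Module.End 𝕜 L.Poly) : rightAd V T = T * V - V * T := rfl

/-- Right multiplication by `V` is the sum of left multiplication and the commutator map, which
commute; this is their binomial theorem. -/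
theorem mul_pow_eq_sum_rightAd (V T : Module.End 𝕜 L.Poly) (n : ℕ) :
    T * V ^ n = ∑ x ∈ Finset.HasAntidiagonal.antidiagonal n, n.choose x.1 • (V ^ x.1 * (rightAd V ^ x.2) T) := by
  have hc : Commute (LinearMap.mulLeft 𝕜 V) (rightAd V) := by
    refine LinearMap.ext fun T => ?_
    simp only [Module.End.mul_apply, rightAd_apply, LinearMap.mulLeft_apply, mul_sub, mul_assoc]
  have h1 : LinearMap.mulRight 𝕜 V = LinearMap.mulLeft 𝕜 V + rightAd V :=
    (add_sub_cancel _ _).symm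
  have h2 : T * V ^ n = (LinearMap.mulRight 𝕜 V ^ n) T := by
    rw [LinearMap.pow_mulRight, LinearMap.mulRight_apply]
  rw [h2, h1, hc.add_pow', LinearMap.sum_apply]
  refine Finset.sum_congr rfl fun x _ => ?_
  rw [LinearMap.smul_apply, Module.End.mul_apply, LinearMap.pow_mulLeft, LinearMap.mulLeft_apply]

/-- Each further commutator with `V` lowers the degree by one more, so the series of iterated
commutators is finite on every polynomial. -/
theorem rightAd_pow_dirDeriv_mem {V : Module.End 𝕜 L.Poly} (hV : Lowers V) (σ : StrongDual 𝕜 Φ)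
    (k : ℕ) : ∀ n, ∀ p ∈ L.polyLT (n + k + 1), (rightAd V ^ k) (L.dirDeriv σ) p ∈ L.polyLT n := by
  induction k with
  | zero => exact fun n p hp => dirDeriv_mem_polyLT σ hp
  | succ k ih =>
    intro n p hp
    rw [pow_succ', Module.End.mul_apply, rightAd_apply, LinearMap.sub_apply]
    refine sub_mem (ih n _ (hV _ _ hp)) (hV _ _ (ih (n + 1) p ?_))
    rwa [show n + 1 + k + 1 = n + (k + 1) + 1 by ring]

theorem isShiftInvariant_rightAd_pow {V : Module.End 𝕜 L.Poly} (hc : Continuous V)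
    (h : ∀ σ, IsShiftInvariant (rightAd V (L.dirDeriv σ))) (σ : StrongDual 𝕜 Φ) (k : ℕ) :
    IsShiftInvariant ((rightAd V ^ k) (L.dirDeriv σ)) := by
  induction k with
  | zero => exact isShiftInvariant_dirDeriv σ
  | succ k ih =>
    rw [pow_succ', Module.End.mul_apply]
    set T := (rightAd V ^ k) (L.dirDeriv σ)
    refine ⟨(ih.continuous.comp hc).sub (hc.comp ih.continuous), fun ρ => ?_⟩
    have h1 : T * L.dirDeriv ρ = L.dirDeriv ρ * T := (ih.commute ρ).eq
    have h2 : T * rightAd V (L.dirDeriv ρ) = rightAd V (L.dirDeriv ρ) * T := (ih.commute_of (h ρ)).eq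
    rw [rightAd_apply] at h2 ⊢
    change (T * V - V * T) * L.dirDeriv ρ = L.dirDeriv ρ * (T * V - V * T)
    -- Jacobi: `[[T, V], D] = [[T, D], V] - [T, [D, V]]`. The first term vanishes by induction, the
    -- second because shift-invariant operators commute with each other.
    have h3 : (T * V - V * T) * L.dirDeriv ρ - L.dirDeriv ρ * (T * V - V * T) =
        (T * L.dirDeriv ρ - L.dirDeriv ρ * T) * V - V * (T * L.dirDeriv ρ - L.dirDeriv ρ * T) -
        (T * (L.dirDeriv ρ * V - V * L.dirDeriv ρ) - (L.dirDeriv ρ * V - V * L.dirDeriv ρ) * T) := by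
      noncomm_ring
    rw [← sub_eq_zero, h3, h1, h2]
    simp

/-- The expansion `D exp(V) = exp(V) ∑ ad^k(D) / k!`, obtained by summing the binomial formula for
`D V ^ n`; the truncation at `N` is exact on `polyLT N`. -/
theorem dirDeriv_psAct_exp {V : Module.End 𝕜 L.Poly} (hV : Lowers V) (σ : StrongDual 𝕜 Φ) {N : ℕ}
    {p : L.Poly} (hp : p ∈ L.polyLT N) :
    L.dirDeriv σ (psAct V hV.isLocallyNilpotent (exp 𝕜) p) =
      psAct V hV.isLocallyNilpotent (exp 𝕜)
        (∑ k ∈ Finset.range N, (k ! : 𝕜)⁻¹ • (rightAd V ^ k) (L.dirDeriv σ) p) := by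
  have hT : ∀ k, k < N → (rightAd V ^ k) (L.dirDeriv σ) p ∈ L.polyLT (N - k - 1) := fun k hk =>
    rightAd_pow_dirDeriv_mem hV σ k _ p (polyLT_mono (by omega) hp)
  have hT' : ∀ k, N ≤ k → (rightAd V ^ k) (L.dirDeriv σ) p = 0 := by
    intro k hk
    have := rightAd_pow_dirDeriv_mem hV σ k 0 p (polyLT_mono (by omega) hp)
    rwa [polyLT_zero, Submodule.mem_bot] at this
  have hsum : ∑ k ∈ Finset.range N, (k ! : 𝕜)⁻¹ • (rightAd V ^ k) (L.dirDeriv σ) p ∈ L.polyLT N :=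
    Submodule.sum_mem _ fun k hk => Submodule.smul_mem _ _
      (polyLT_mono (by omega) (hT k (Finset.mem_range.1 hk)))
  have hcoeff : ∀ n, coeff n (exp 𝕜) = (n ! : 𝕜)⁻¹ := fun n => by simp [coeff_exp]
  rw [psAct_eq_sum _ (hV.pow_eq_zero le_rfl hp), psAct_eq_sum _ (hV.pow_eq_zero le_rfl hsum), map_sum]
  simp only [map_smul, map_sum, Finset.smul_sum, hcoeff]
  have h1 : ∀ n, (n ! : 𝕜)⁻¹ • L.dirDeriv σ ((V ^ n) p) = ∑ x ∈ Finset.HasAntidiagonal.antidiagonal n,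
      (x.1 ! : 𝕜)⁻¹ • (x.2 ! : 𝕜)⁻¹ • (V ^ x.1) ((rightAd V ^ x.2) (L.dirDeriv σ) p) := by
    intro n
    rw [← Module.End.mul_apply, mul_pow_eq_sum_rightAd, LinearMap.sum_apply, Finset.smul_sum]
    refine Finset.sum_congr rfl fun x hx => ?_
    rw [LinearMap.smul_apply, Module.End.mul_apply, ← Nat.cast_smul_eq_nsmul 𝕜, smul_smul, smul_smul]
    congr 1
    rw [Finset.HasAntidiagonal.mem_antidiagonal] at hx
    have h2 : (n ! : 𝕜) ≠ 0 := Nat.cast_ne_zero.2 (Nat.factorial_ne_zero n)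
    have h3 : (x.1 ! : 𝕜) ≠ 0 := Nat.cast_ne_zero.2 (Nat.factorial_ne_zero _)
    have h4 : (x.2 ! : 𝕜) ≠ 0 := Nat.cast_ne_zero.2 (Nat.factorial_ne_zero _)
    rw [← hx] at h2 ⊢
    rw [Nat.cast_add_choose]
    field_simp
  simp only [h1]
  refine sum_range_sum_antidiagonal N (fun i k => (i ! : 𝕜)⁻¹ • (k ! : 𝕜)⁻¹ •
    (V ^ i) ((rightAd V ^ k) (L.dirDeriv σ) p)) fun i k hik => ?_
  by_cases hk : k < N
  · rw [hV.pow_eq_zero (by omega) (hT k hk), smul_zero, smul_zero]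
  · rw [hT' k (not_lt.1 hk), map_zero, smul_zero, smul_zero]

theorem psAct_exp_mul_psAct_exp_neg {V : Module.End 𝕜 L.Poly} (hV : IsLocallyNilpotent V) :
    psAct V hV (exp 𝕜) * psAct V hV (evalNegHom (exp 𝕜)) = 1 ∧
      psAct V hV (evalNegHom (exp 𝕜)) * psAct V hV (exp 𝕜) = 1 := by
  rw [← map_mul, ← map_mul, mul_comm (evalNegHom (exp 𝕜)), exp_mul_exp_neg_eq_one, map_one]
  exact ⟨rfl, rfl⟩

/-- If all commutators `[D_σ, V]` are shift-invariant, then so are `exp(-V) D_σ exp(V)`. -/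
theorem isShiftInvariant_conj_exp {V : Module.End 𝕜 L.Poly} (hV : Lowers V) (hc : Continuous V)
    (h : ∀ σ, IsShiftInvariant (rightAd V (L.dirDeriv σ))) (σ : StrongDual 𝕜 Φ) :
    IsShiftInvariant (psAct V hV.isLocallyNilpotent (evalNegHom (exp 𝕜)) * L.dirDeriv σ *
      psAct V hV.isLocallyNilpotent (exp 𝕜)) := by
  refine ⟨((hV.continuous_psAct hc _).comp (continuous_dirDeriv σ)).comp (hV.continuous_psAct hc _),
    fun ρ => LinearMap.ext fun p => ?_⟩
  have key : ∀ N, ∀ p ∈ L.polyLT N, (psAct V hV.isLocallyNilpotent (evalNegHom (exp 𝕜)) *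
      L.dirDeriv σ * psAct V hV.isLocallyNilpotent (exp 𝕜)) p =
      ∑ k ∈ Finset.range N, (k ! : 𝕜)⁻¹ • (rightAd V ^ k) (L.dirDeriv σ) p := by
    intro N p hp
    rw [Module.End.mul_apply, Module.End.mul_apply, dirDeriv_psAct_exp hV σ hp,
      ← Module.End.mul_apply, (psAct_exp_mul_psAct_exp_neg _).2, Module.End.one_apply]
  obtain ⟨N, hp⟩ := exists_mem_polyLT p
  rw [Module.End.mul_apply, Module.End.mul_apply (L.dirDeriv ρ), key N p hp,
    key N _ (dirDeriv_mem_polyLT ρ (polyLT_mono (Nat.le_succ N) hp)), map_sum]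
  refine Finset.sum_congr rfl fun k _ => ?_
  rw [map_smul]
  exact congrArg (fun S : Module.End 𝕜 L.Poly => (k ! : 𝕜)⁻¹ • S p)
    ((isShiftInvariant_rightAd_pow hc h σ k).commute ρ).eq

end LBSpace

/-! ### Exponentials of power series -/

section PowerSeries

open PowerSeries

variable {𝕜 : Type*} [Field 𝕜]

/-- The quotient `f g⁻¹` has derivative `0` and constant term `1`. -/
theorem PowerSeries.eq_of_derivative_eq_mul [CharZero 𝕜] {f g h : 𝕜⟦X⟧} (hf : d⁄dX 𝕜 f = f * h)
    (hg : d⁄dX 𝕜 g = g * h) (hg0 : constantCoeff g ≠ 0)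
    (h0 : constantCoeff f = constantCoeff g) : f = g := by
  have h1 : d⁄dX 𝕜 (f * g⁻¹) = d⁄dX 𝕜 (1 : 𝕜⟦X⟧) := by
    have hgi := PowerSeries.mul_inv_cancel g hg0
    rw [Derivation.leibniz, derivative_inv', hf, hg, smul_eq_mul, smul_eq_mul,
      Derivation.map_one_eq_zero]
    linear_combination (-(f * h * g⁻¹)) * hgi
  have h2 : f * g⁻¹ = 1 := by
    refine PowerSeries.derivative.ext h1 ?_
    rw [map_mul, PowerSeries.constantCoeff_inv, h0, mul_inv_cancel₀ hg0, map_one]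
  have := congrArg (· * g) h2
  simpa [mul_assoc, PowerSeries.inv_mul_cancel g hg0] using this

theorem PowerSeries.constantCoeff_exp_subst [Algebra ℚ 𝕜] {a : 𝕜⟦X⟧} (ha : constantCoeff a = 0) :
    constantCoeff ((exp 𝕜).subst a) = 1 := by
  rw [← coeff_zero_eq_constantCoeff_apply, coeff_subst' (HasSubst.of_constantCoeff_zero' ha),
    finsum_eq_single _ 0]
  · simp
  · intro n hn
    simp [ha, hn]

/-- Both sides solve `y' = (a + b)' y` with constant term `1`. -/
theorem PowerSeries.exp_subst_add [CharZero 𝕜] [Algebra ℚ 𝕜] {a b : 𝕜⟦X⟧} (ha : constantCoeff a = 0)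
    (hb : constantCoeff b = 0) :
    (exp 𝕜).subst (a + b) = (exp 𝕜).subst a * (exp 𝕜).subst b := by
  have hab : constantCoeff (a + b) = 0 := by rw [map_add, ha, hb, add_zero]
  refine eq_of_derivative_eq_mul (h := d⁄dX 𝕜 (a + b)) ?_ ?_ ?_ ?_
  · rw [derivative_subst (HasSubst.of_constantCoeff_zero' hab), derivative_exp]
  · rw [Derivation.leibniz, derivative_subst (HasSubst.of_constantCoeff_zero' ha),
      derivative_subst (HasSubst.of_constantCoeff_zero' hb), derivative_exp, map_add,
      smul_eq_mul, smul_eq_mul]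
    ring
  · rw [map_mul, constantCoeff_exp_subst ha, constantCoeff_exp_subst hb, mul_one]
    exact one_ne_zero
  · rw [map_mul, constantCoeff_exp_subst ha, constantCoeff_exp_subst hb, mul_one,
      constantCoeff_exp_subst hab]

theorem coeff_exp_eq_inv [Algebra ℚ 𝕜] (n : ℕ) : coeff n (exp 𝕜) = (n ! : 𝕜)⁻¹ := by
  simp [coeff_exp]

theorem isLocallyNilpotent_diffOp {b : 𝕜⟦X⟧} (hb : constantCoeff b = 0) :
    IsLocallyNilpotent (diffOp 𝕜 b) := isLocallyNilpotent_psAct isLocallyNilpotent_derivative hb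

theorem diffOp_exp_subst [Algebra ℚ 𝕜] {b : 𝕜⟦X⟧} (hb : constantCoeff b = 0) (p : Polynomial 𝕜) :
    diffOp 𝕜 ((exp 𝕜).subst b) p =
      psAct (diffOp 𝕜 b) (isLocallyNilpotent_diffOp hb) (exp 𝕜) p :=
  (congrArg (fun f => f p) (psAct_subst isLocallyNilpotent_derivative hb (exp 𝕜))).symm

/-- Taylor's formula. -/
theorem eval_zero_diffOp_exp_subst [CharZero 𝕜] [Algebra ℚ 𝕜] (c : 𝕜) (p : Polynomial 𝕜) :
    (diffOp 𝕜 ((exp 𝕜).subst (c • X : 𝕜⟦X⟧)) p).eval 0 = p.eval c := by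
  have h : (Polynomial.leval 0).comp (diffOp 𝕜 ((exp 𝕜).subst (c • X : 𝕜⟦X⟧))) =
      Polynomial.leval c := by
    refine Polynomial.lhom_ext' fun n => LinearMap.ext_ring ?_
    simp only [LinearMap.comp_apply, Polynomial.monomial_one_right_eq_X_pow, Polynomial.leval_apply]
    rw [eval_zero_diffOp_X_pow, ← rescale_eq_subst, coeff_rescale, coeff_exp_eq_inv]
    have hn : (n ! : 𝕜) ≠ 0 := Nat.cast_ne_zero.2 (Nat.factorial_ne_zero n)
    simp
    field_simp
  exact congrArg (fun f => f p) h

theorem eq_of_eval_zero_diffOp_eq [CharZero 𝕜] {a b : 𝕜⟦X⟧}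
    (h : ∀ p, (diffOp 𝕜 a p).eval 0 = (diffOp 𝕜 b p).eval 0) : a = b := by
  ext n
  have hn : (n ! : 𝕜) ≠ 0 := Nat.cast_ne_zero.2 (Nat.factorial_ne_zero n)
  have := h (Polynomial.X ^ n)
  rw [eval_zero_diffOp_X_pow, eval_zero_diffOp_X_pow] at this
  exact mul_left_cancel₀ hn this

end PowerSeries

/-- On a fixed polynomial, `exp(t b)(d/dx)` is a finite sum `∑ t^k b(d/dx)^k / k!`, so its
derivative at `t = 0` is the linear coefficient. -/
theorem hasDerivAt_diffOp_exp_subst {𝕜 : Type*} [RCLike 𝕜] {b : PowerSeries 𝕜}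
    (hb : PowerSeries.constantCoeff b = 0) (F : Polynomial 𝕜 →ₗ[𝕜] 𝕜) (q : Polynomial 𝕜) :
    HasDerivAt (fun t : 𝕜 => F (diffOp 𝕜 ((PowerSeries.exp 𝕜).subst (t • b)) q))
      (F (diffOp 𝕜 b q)) 0 := by
  obtain ⟨m, hm⟩ := isLocallyNilpotent_derivative q
  -- The range is enlarged by `2` so that it contains the index `1`.
  have hm := Module.End.pow_apply_eq_zero_of_le hm (Nat.le_add_right m 2)
  have hf : ∀ t : 𝕜, F (diffOp 𝕜 ((PowerSeries.exp 𝕜).subst (t • b)) q) =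
      ∑ k ∈ Finset.range (m + 2), t ^ k * ((k ! : 𝕜)⁻¹ * F ((diffOp 𝕜 b ^ k) q)) := by
    intro t
    have htb : PowerSeries.constantCoeff (t • b) = 0 := by simp [hb]
    have hz : (diffOp 𝕜 (t • b) ^ (m + 2)) q = 0 := psAct_pow_apply_eq_zero _ htb hm
    rw [diffOp_exp_subst htb, psAct_eq_sum _ hz, map_sum]
    refine Finset.sum_congr rfl fun k _ => ?_
    rw [map_smul, coeff_exp_eq_inv, map_smul, smul_pow, LinearMap.smul_apply, map_smul,
      smul_eq_mul, smul_eq_mul]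
    ring
  simp only [hf]
  have h := HasDerivAt.fun_sum (u := Finset.range (m + 2)) (x := (0 : 𝕜))
    (A := fun k t => t ^ k * ((k ! : 𝕜)⁻¹ * F ((diffOp 𝕜 b ^ k) q))) fun k _ =>
      (hasDerivAt_pow k (0 : 𝕜)).mul_const _
  refine h.congr_deriv ?_
  rw [Finset.sum_eq_single 1]
  · simp
  · intro k _ hk
    rcases k with _ | _ | k <;> simp at hk ⊢
  · simp

namespace LBSpace

open PowerSeries

variable {𝕜 : Type*} [RCLike 𝕜] {E : ℕ → Type*}
  [∀ n, NormedAddCommGroup (E n)] [∀ n, NormedSpace 𝕜 (E n)] [∀ n, CompleteSpace (E n)]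
  {Φ : Type*} [AddCommGroup Φ] [Module 𝕜 Φ] [TopologicalSpace Φ]
  {L : LBSpace 𝕜 E Φ}

/-! ### Generating functions and differential equations -/

/-- The polynomials `P e^{⟨·, ξ⟩}` satisfy a differential equation `D_σ y = b y`. -/
def SolvesODE (P : Module.End 𝕜 L.Poly) : Prop :=
  ∀ (ξ : Φ) (σ : StrongDual 𝕜 Φ), ∃ b : 𝕜⟦X⟧, constantCoeff b = 0 ∧
    ∀ p, L.dirDeriv σ (P (L.ofLinear ξ p)) = P (L.ofLinear ξ (diffOp 𝕜 b p))

theorem lowers_dirDeriv (σ : StrongDual 𝕜 Φ) : Lowers (L.dirDeriv σ) := fun _ _ =>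
  dirDeriv_mem_polyLT σ

/-- Taylor's formula for polynomials on `Φ'`. -/
theorem apply_eq_psAct_dirDeriv (ω : StrongDual 𝕜 Φ) (q : L.Poly) :
    q ω = psAct (L.dirDeriv ω) (lowers_dirDeriv ω).isLocallyNilpotent (exp 𝕜) q 0 := by
  have hc := (lowers_dirDeriv (L := L) ω).continuous_psAct (continuous_dirDeriv ω) (exp 𝕜)
  refine congrArg (fun f : L.Poly →ₗ[𝕜] 𝕜 => f q) (eq_of_ofLinear (S := L.ev ω)
    (T := (L.ev 0).comp (psAct (L.dirDeriv ω) (lowers_dirDeriv ω).isLocallyNilpotent (exp 𝕜)))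
    (continuous_ev ω) ((continuous_ev 0).comp hc) fun ξ p => ?_)
  have hX : constantCoeff (ω ξ • X : 𝕜⟦X⟧) = 0 := by simp
  have h := psAct_intertwine (isLocallyNilpotent_diffOp hX)
    (lowers_dirDeriv (L := L) ω).isLocallyNilpotent (T := L.ofLinear ξ)
    (fun p => (dirDeriv_ofLinear_eq_diffOp ω ξ p).symm) (exp 𝕜) p
  rw [LinearMap.comp_apply, ← h, ← diffOp_exp_subst hX, ev_apply, ev_apply, ofLinear_apply,
    ofLinear_apply, zero_apply, eval_zero_diffOp_exp_subst]

/-- The factor `1 / k!` in `genFun` is the one for which `genFun` represents `p ↦ P(p(⟨·, ξ⟩))(ω)`;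
identities of generating functions thus become identities of operators. -/
theorem apply_ofLinear_eq_genFun (P : L.Poly →L[𝕜] L.Poly) (ω : StrongDual 𝕜 Φ) (ξ : Φ)
    (p : Polynomial 𝕜) : P (L.ofLinear ξ p) ω = (diffOp 𝕜 (genFun P ω ξ) p).eval 0 := by
  have h : (L.ev ω).comp ((P : L.Poly →ₗ[𝕜] L.Poly).comp (L.ofLinear ξ)) =
      (Polynomial.leval 0).comp (diffOp 𝕜 (genFun P ω ξ)) := by
    refine Polynomial.lhom_ext' fun n => LinearMap.ext_ring ?_
    have hn : (n ! : 𝕜) ≠ 0 := Nat.cast_ne_zero.2 (Nat.factorial_ne_zero n)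
    simp only [LinearMap.comp_apply, Polynomial.monomial_one_right_eq_X_pow, Polynomial.leval_apply,
      eval_zero_diffOp_X_pow, genFun, coeff_mk, ofLinear_X_pow]
    rw [mul_inv_cancel_left₀ hn]
    rfl
  exact congrArg (fun f => f p) h

theorem constantCoeff_pairSeriesF1 (B : L.W1) (ω : StrongDual 𝕜 Φ) (ξ : Φ) :
    constantCoeff (pairSeriesF1 B ω ξ) = 0 := by
  rw [← coeff_zero_eq_constantCoeff_apply, pairSeriesF1, coeff_mk]

theorem pairSeriesF1_add_smul (B : L.W1) (ω σ : StrongDual 𝕜 Φ) (t : 𝕜) (ξ : Φ) :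
    pairSeriesF1 B (ω + t • σ) ξ = pairSeriesF1 B ω ξ + t • pairSeriesF1 B σ ξ := by
  ext n
  rw [map_add, PowerSeries.coeff_smul]
  simp only [pairSeriesF1, coeff_mk]
  rcases n with _ | _ | n <;> simp

/-- Exponential generating functions solve differential equations. -/
theorem solvesODE_of_genFun {P : L.Poly →L[𝕜] L.Poly} {A : L.W0} {B : L.W1}
    (h : ∀ ω ξ, genFun P ω ξ = (exp 𝕜).subst (pairSeriesF1 B ω ξ) * seriesF0 A ξ) :
    SolvesODE (P : L.Poly →ₗ[𝕜] L.Poly) := by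
  intro ξ σ
  refine ⟨pairSeriesF1 B σ ξ, constantCoeff_pairSeriesF1 B σ ξ, fun p => poly_ext fun ω =>
    dirDeriv_apply_of_hasLineDerivAt ?_⟩
  have h1 := hasDerivAt_diffOp_exp_subst (constantCoeff_pairSeriesF1 B σ ξ)
    ((Polynomial.leval 0).comp (diffOp 𝕜 (genFun P ω ξ))) p
  have h2 : (P : L.Poly →ₗ[𝕜] L.Poly) (L.ofLinear ξ (diffOp 𝕜 (pairSeriesF1 B σ ξ) p)) ω =
      ((Polynomial.leval 0).comp (diffOp 𝕜 (genFun P ω ξ))) (diffOp 𝕜 (pairSeriesF1 B σ ξ) p) :=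
    apply_ofLinear_eq_genFun P ω ξ _
  rw [h2]
  refine h1.congr_of_eventuallyEq (Filter.Eventually.of_forall fun t => ?_)
  refine (apply_ofLinear_eq_genFun P (ω + t • σ) ξ p).trans ?_
  have ht : constantCoeff (t • pairSeriesF1 B σ ξ) = 0 := by
    simp [constantCoeff_pairSeriesF1]
  -- A shift of `ω` by `t σ` multiplies the generating function by `exp(t ⟨σ, B(ξ)⟩)`, whose
  -- derivative at `t = 0` is the required series `b`.
  have h3 : genFun P (ω + t • σ) ξ =
      genFun P ω ξ * (exp 𝕜).subst (t • pairSeriesF1 B σ ξ) := by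
    rw [h, h, pairSeriesF1_add_smul, exp_subst_add (constantCoeff_pairSeriesF1 B ω ξ) ht]
    ring
  rw [h3, map_mul]
  rfl

/-- Solutions of differential equations have exponential generating functions. -/
theorem genFun_eq_of_dirDeriv {P : L.Poly →L[𝕜] L.Poly} {ω : StrongDual 𝕜 Φ} {ξ : Φ} {b : 𝕜⟦X⟧}
    (hb : constantCoeff b = 0)
    (h : ∀ p, L.dirDeriv ω (P (L.ofLinear ξ p)) = P (L.ofLinear ξ (diffOp 𝕜 b p))) :
    genFun P ω ξ = (exp 𝕜).subst b * genFun P 0 ξ := by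
  refine eq_of_eval_zero_diffOp_eq fun p => ?_
  -- `P` intertwines `b(d/dx)` with `D_ω`, hence `exp(b)(d/dx)` with `exp(D_ω)`, and the latter
  -- carries the value at `0` to the value at `ω`.
  have h1 := psAct_intertwine (isLocallyNilpotent_diffOp hb)
    (lowers_dirDeriv (L := L) ω).isLocallyNilpotent
    (T := (P : L.Poly →ₗ[𝕜] L.Poly).comp (L.ofLinear ξ)) (fun p => (h p).symm) (exp 𝕜) p
  rw [← diffOp_exp_subst hb] at h1
  rw [mul_comm, map_mul, Module.End.mul_apply, ← apply_ofLinear_eq_genFun,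
    ← apply_ofLinear_eq_genFun, apply_eq_psAct_dirDeriv ω]
  exact congrArg (fun q : L.Poly => q 0) h1.symm

/-! ### The linear part of a polynomial -/

theorem dirDeriv_mono_apply_zero (σ : StrongDual 𝕜 Φ) {k : ℕ} (hk : k ≠ 1) (f : L.SymPow k) :
    L.dirDeriv σ (L.mono k f) 0 = 0 := by
  rcases k with _ | _ | k
  · rw [dirDeriv_mono_zero]; rfl
  · exact absurd rfl hk
  · rw [dirDeriv_mono_succ_apply]
    have : pair f (Fin.snoc (fun _ => 0) σ : Fin (k + 1 + 1) → StrongDual 𝕜 Φ) = 0 :=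
      f.1.map_coord_zero (0 : Fin (k + 1)).castSucc (by simp)
    rw [this, mul_zero]

theorem dirDeriv_mono_one_apply_zero (σ : StrongDual 𝕜 Φ) {m : ℕ} (T : symTensorPow 𝕜 (E m) 1) :
    L.dirDeriv σ (L.mono 1 (L.toSymPow m 1 T)) 0 = T.1 fun _ => L.restr m σ := by
  refine (dirDeriv_mono_succ_apply (n := 0) σ _ 0).trans ?_
  rw [pair_toSymPow]
  have : (fun i => L.restr m ((Fin.snoc (fun _ => 0) σ : Fin (0 + 1) → StrongDual 𝕜 Φ) i)) =
      fun _ => L.restr m σ := by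
    funext i
    have : i = Fin.last 0 := Fin.ext (by omega)
    rw [this, Fin.snoc_last]
  rw [this]
  simp

/-- The linear part of a polynomial is given by an element of `Φ`. -/
theorem exists_linearPart : ∃ l : L.Poly →L[𝕜] Φ, ∀ q (σ : StrongDual 𝕜 Φ),
    σ (l q) = L.dirDeriv σ q 0 := by
  have := L.isTopologicalAddGroup
  have := L.polynormableSpace
  -- First-degree tensors over `E m` are vectors of `E m`, not only elements of its bidual; this
  -- places the linear part in `Φ`.
  choose r hr using fun m => exists_symTensorPow_one (𝕜 := 𝕜) (B := E m)
  have hone : ∀ m T (σ : StrongDual 𝕜 Φ),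
      σ (L.incl m (r m T)) = L.dirDeriv σ (L.mono 1 (L.toSymPow m 1 T)) 0 := fun m T σ => by
    rw [dirDeriv_mono_one_apply_zero, hr]
    rfl
  have hex : ∀ q : L.Poly, ∃ x : Φ, ∀ σ : StrongDual 𝕜 Φ, σ x = L.dirDeriv σ q 0 := by
    intro q
    induction q using poly_induction with
    | zero => exact ⟨0, fun σ => by rw [map_zero, map_zero]; rfl⟩
    | add p q hp hq =>
      obtain ⟨x, hx⟩ := hp
      obtain ⟨y, hy⟩ := hq
      exact ⟨x + y, fun σ => by rw [map_add, map_add, hx, hy]; rfl⟩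
    | mono k f =>
      by_cases hk : k = 1
      · subst hk
        induction f using symPow_induction with
        | zero => exact ⟨0, fun σ => by rw [map_zero, map_zero, map_zero]; rfl⟩
        | add f g hf hg =>
          obtain ⟨x, hx⟩ := hf
          obtain ⟨y, hy⟩ := hg
          exact ⟨x + y, fun σ => by rw [map_add, map_add, map_add, hx, hy]; rfl⟩
        | incl m T => exact ⟨_, hone m T⟩
      · exact ⟨0, fun σ => by rw [dirDeriv_mono_apply_zero σ hk, map_zero]⟩
  choose l hl using hex
  let l' : L.Poly →ₗ[𝕜] Φ :=
    { toFun := l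
      map_add' p q := L.eq_of_forall_dual fun σ => by
        rw [map_add, hl, hl, hl, map_add]
        rfl
      map_smul' c p := L.eq_of_forall_dual fun σ => by
        rw [map_smul, hl, hl, map_smul]
        rfl }
  have hl' : ∀ q (σ : StrongDual 𝕜 Φ), σ (l' q) = L.dirDeriv σ q 0 := hl
  refine ⟨⟨l', continuous_of_mono l' fun k m => ?_⟩, hl⟩
  by_cases hk : k = 1
  · subst hk
    refine ((L.incl m).continuous.comp (r m).continuous).congr fun T =>
      L.eq_of_forall_dual fun σ => ?_
    rw [hl']
    exact hone m T σ
  · refine continuous_const.congr (f := fun _ => (0 : Φ)) fun T => L.eq_of_forall_dual fun σ => ?_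
    rw [hl', dirDeriv_mono_apply_zero σ hk, map_zero]

/-! ### Generators -/

/-- The series `⟨σ, β(ξ)⟩`. -/
def betaSeries (β : L.W1) (σ : StrongDual 𝕜 Φ) (ξ : Φ) : 𝕜⟦X⟧ :=
  PowerSeries.mk fun
    | 0 => 0
    | 1 => 0
    | k + 2 => σ (β k (L.pow (k + 2) ξ))

/-- The series `α(ξ)`. -/
def alphaSeries (α : L.W0) (ξ : Φ) : 𝕜⟦X⟧ :=
  PowerSeries.mk fun
    | 0 => 0
    | k + 1 => α k (L.pow (k + 1) ξ)

theorem betaSeries_add_smul (β : L.W1) (ω σ : StrongDual 𝕜 Φ) (t : 𝕜) (ξ : Φ) :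
    betaSeries β (ω + t • σ) ξ = betaSeries β ω ξ + t • betaSeries β σ ξ := by
  ext n
  rw [map_add, PowerSeries.coeff_smul]
  simp only [betaSeries, coeff_mk]
  rcases n with _ | _ | n <;> simp

theorem ofLinear_mem_polyLT (ξ : Φ) {n : ℕ} {p : Polynomial 𝕜} (hp : p.natDegree < n) :
    L.ofLinear ξ p ∈ L.polyLT n := by
  rw [p.as_sum_range' n hp, map_sum]
  refine Submodule.sum_mem _ fun k hk => ?_
  rw [← Polynomial.C_mul_X_pow_eq_monomial, ← Polynomial.smul_eq_C_mul, map_smul, ofLinear_X_pow]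
  exact Submodule.smul_mem _ _ (mono_mem_polyLT (Finset.mem_range.1 hk) _)

/-- On functions of `⟨ω, ξ⟩` the generator is an ordinary differential operator, whose coefficients
depend on `ω` only through the linear term `⟨ω, β(ξ)⟩`. -/
theorem IsGenerator.apply_ofLinear {V : L.Poly →L[𝕜] L.Poly} {α : L.W0} {β : L.W1}
    (hV : IsGenerator V α β) (ξ : Φ) (p : Polynomial 𝕜) (ω : StrongDual 𝕜 Φ) :
    V (L.ofLinear ξ p) ω = (diffOp 𝕜 (alphaSeries α ξ + betaSeries β ω ξ) p).eval (ω ξ) := by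
  have hp := Nat.lt_succ_self p.natDegree
  have hmem := ofLinear_mem_polyLT (L := L) ξ hp
  have hα : diffOp 𝕜 (alphaSeries α ξ) p = ∑ k ∈ Finset.range (p.natDegree + 1),
      α k (L.pow (k + 1) ξ) • Polynomial.derivative^[k + 1] p := by
    rw [diffOp_eq_sum (Nat.lt_succ_of_lt hp), Finset.sum_range_succ']
    simp [alphaSeries]
  have hβ : diffOp 𝕜 (betaSeries β ω ξ) p = ∑ k ∈ Finset.range (p.natDegree + 1),
      ω (β k (L.pow (k + 2) ξ)) • Polynomial.derivative^[k + 2] p := by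
    rw [diffOp_eq_sum (Nat.lt_succ_of_lt (Nat.lt_succ_of_lt hp)), Finset.sum_range_succ',
      Finset.sum_range_succ']
    simp [betaSeries]
  rw [hV, alphaNabla_eq_sum α hmem, mulBetaNabla_eq_sum β hmem, map_add, LinearMap.add_apply,
    Polynomial.eval_add, hα, hβ, Polynomial.eval_finsetSum, Polynomial.eval_finsetSum]
  simp only [grad_ofLinear, map_smul, Polynomial.eval_smul, smul_eq_mul, mul_comm]

/-- Product rule: differentiating the argument `⟨ω, ξ⟩` gives `V D_σ`, and differentiating the
coefficient `⟨ω, β(ξ)⟩` gives the commutator `⟨σ, β(∇)⟩`. -/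
theorem IsGenerator.rightAd_dirDeriv {V : L.Poly →L[𝕜] L.Poly} {α : L.W0} {β : L.W1}
    (hV : IsGenerator V α β) (σ : StrongDual 𝕜 Φ) (ξ : Φ) (p : Polynomial 𝕜) :
    rightAd (V : L.Poly →ₗ[𝕜] L.Poly) (L.dirDeriv σ) (L.ofLinear ξ p) =
      L.ofLinear ξ (diffOp 𝕜 (betaSeries β σ ξ) p) := by
  have h : L.dirDeriv σ (V (L.ofLinear ξ p)) =
      V (L.dirDeriv σ (L.ofLinear ξ p)) + L.ofLinear ξ (diffOp 𝕜 (betaSeries β σ ξ) p) := by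
    refine poly_ext fun ω => dirDeriv_apply_of_hasLineDerivAt ?_
    set q := diffOp 𝕜 (alphaSeries α ξ + betaSeries β ω ξ) p
    set r := diffOp 𝕜 (betaSeries β σ ξ) p
    have h1 : HasDerivAt (fun t : 𝕜 => ω ξ + t * σ ξ) (σ ξ) 0 := by
      simpa using ((hasDerivAt_id (0 : 𝕜)).mul_const (σ ξ)).const_add (ω ξ)
    have h2 : ∀ q : Polynomial 𝕜, HasDerivAt (fun t : 𝕜 => q.eval (ω ξ + t * σ ξ))
        (q.derivative.eval (ω ξ) * σ ξ) 0 := by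
      intro q
      have h : HasDerivAt (fun x => q.eval x) (q.derivative.eval (ω ξ)) (ω ξ + 0 * σ ξ) := by
        simpa using q.hasDerivAt (ω ξ)
      exact h.comp (0 : 𝕜) h1
    have h3 := (h2 q).add ((hasDerivAt_id (0 : 𝕜)).mul (h2 r))
    have h4 : (V (L.dirDeriv σ (L.ofLinear ξ p)) + L.ofLinear ξ r) ω =
        q.derivative.eval (ω ξ) * σ ξ +
          (1 * r.eval (ω ξ + 0 * σ ξ) + id 0 * (r.derivative.eval (ω ξ) * σ ξ)) := by
      rw [poly_add_apply, dirDeriv_ofLinear, map_smul, poly_smul_apply, hV.apply_ofLinear,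
        ofLinear_apply, ← diffOp_X, diffOp_comm, diffOp_X]
      simp [q, mul_comm]
    rw [h4]
    refine h3.congr_of_eventuallyEq (Filter.Eventually.of_forall fun t => ?_)
    change V (L.ofLinear ξ p) (ω + t • σ) = q.eval (ω ξ + t * σ ξ) + t * r.eval (ω ξ + t * σ ξ)
    rw [hV.apply_ofLinear, betaSeries_add_smul, ← add_assoc, map_add, LinearMap.add_apply,
      Polynomial.eval_add, map_smul, LinearMap.smul_apply, Polynomial.eval_smul]
    rfl
  rw [rightAd_apply]
  exact sub_eq_iff_eq_add'.2 h

end LBSpace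

/-! ### Generators, logarithms and Sheffer operators -/

namespace LBSpace

open PowerSeries

variable {𝕜 : Type*} [RCLike 𝕜] {E : ℕ → Type*}
  [∀ n, NormedAddCommGroup (E n)] [∀ n, NormedSpace 𝕜 (E n)] [∀ n, CompleteSpace (E n)]
  {Φ : Type*} [AddCommGroup Φ] [Module 𝕜 Φ] [TopologicalSpace Φ]
  {L : LBSpace 𝕜 E Φ}

theorem IsGenerator.isShiftInvariant {V : L.Poly →L[𝕜] L.Poly} {α : L.W0} {β : L.W1}
    (hV : IsGenerator V α β) (σ : StrongDual 𝕜 Φ) :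
    IsShiftInvariant (rightAd (V : L.Poly →ₗ[𝕜] L.Poly) (L.dirDeriv σ)) :=
  .of_diffOp (((continuous_dirDeriv σ).comp V.continuous).sub
    (V.continuous.comp (continuous_dirDeriv σ))) fun ξ => ⟨_, hV.rightAd_dirDeriv σ ξ⟩

theorem IsGenerator.lowersDegree {V : L.Poly →L[𝕜] L.Poly} {α : L.W0} {β : L.W1}
    (hV : IsGenerator V α β) : LowersDegree V := by
  obtain ⟨W, hW, hW'⟩ := exists_isGenerator α β
  have : V = W := ContinuousLinearMap.ext fun p => poly_ext fun ω => (hV p ω).trans (hW p ω).symm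
  exact this ▸ hW'

theorem expOp_eq_psAct {V : L.Poly →L[𝕜] L.Poly}
    (hV : IsLocallyNilpotent (V : L.Poly →ₗ[𝕜] L.Poly)) (p : L.Poly) :
    expOp V p = psAct (V : L.Poly →ₗ[𝕜] L.Poly) hV (exp 𝕜) p := by
  rw [psAct_apply, expOp]
  simp only [coeff_exp_eq_inv]

theorem psAct_exp_ofLinear_one {V : Module.End 𝕜 L.Poly} (hV : Lowers V) (ξ : Φ) :
    psAct V hV.isLocallyNilpotent (exp 𝕜) (L.ofLinear ξ 1) = L.ofLinear ξ 1 := by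
  have h : L.ofLinear ξ 1 ∈ L.polyLT 1 := ofLinear_mem_polyLT ξ (by simp)
  rw [psAct_eq_sum _ (hV.pow_eq_zero le_rfl h)]
  simp

/-- The exponential of a generator solves differential equations. -/
theorem solvesODE_psAct_exp {V : Module.End 𝕜 L.Poly} (hV : Lowers V) (hc : Continuous V)
    (h : ∀ σ, IsShiftInvariant (rightAd V (L.dirDeriv σ))) :
    SolvesODE (psAct V hV.isLocallyNilpotent (exp 𝕜)) := by
  intro ξ σ
  obtain ⟨b, hb⟩ := (isShiftInvariant_conj_exp hV hc h σ).exists_diffOp ξ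
  refine ⟨b, ?_, fun p => ?_⟩
  -- The constant term of `b` vanishes because `exp(V)` fixes constants and `D_σ` annihilates them.
  · have h1 := hb 1
    rw [Module.End.mul_apply, Module.End.mul_apply, psAct_exp_ofLinear_one hV, dirDeriv_ofLinear,
      Polynomial.derivative_one, map_zero, smul_zero, map_zero] at h1
    have h2 := congrArg (L.ev 0) h1
    rw [ev_apply, ev_apply, ofLinear_apply, zero_apply] at h2
    rw [constantCoeff_eq_eval_zero_diffOp]
    exact h2.symm
  · rw [← hb, ← Module.End.mul_apply (psAct V _ (exp 𝕜)), mul_assoc, ← mul_assoc,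
      (psAct_exp_mul_psAct_exp_neg _).1, one_mul]
    rfl

/-! ### The logarithm of a Sheffer operator -/

theorem IsMonic.lowers {P : L.Poly →L[𝕜] L.Poly} (hP : IsMonic P) :
    Lowers ((P : L.Poly →ₗ[𝕜] L.Poly) - 1 : Module.End 𝕜 L.Poly) := fun n p hp =>
  polyLT_induction
    (motive := fun p => ((P : L.Poly →ₗ[𝕜] L.Poly) - 1 : Module.End 𝕜 L.Poly) p ∈ L.polyLT n)
    (by rw [map_zero]; exact zero_mem _) (fun p q hp hq => by rw [map_add]; exact add_mem hp hq)
    (fun k hk f => polyLT_mono (Nat.lt_succ_iff.1 hk) (hP k f)) hp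

/-- `P - 1` lowers the degree, so the logarithmic series may be applied to it; substitution in the
functional calculus gives `exp(V) = 1 + (P - 1)`. -/
theorem IsMonic.exists_log {P : L.Poly →L[𝕜] L.Poly} (hP : IsMonic P) :
    ∃ (V : Module.End 𝕜 L.Poly) (hV : Lowers V), Continuous V ∧
      (P : L.Poly →ₗ[𝕜] L.Poly) = psAct V hV.isLocallyNilpotent (exp 𝕜) := by
  obtain ⟨l, hl, hl'⟩ := exists_exp_subst_eq_one_add_X (K := 𝕜)
  have hc : Continuous ((P : L.Poly →ₗ[𝕜] L.Poly) - 1 : Module.End 𝕜 L.Poly) :=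
    P.continuous.sub continuous_id
  refine ⟨psAct _ hP.lowers.isLocallyNilpotent l, hP.lowers.psAct_lowers hl,
    hP.lowers.continuous_psAct hc l, ?_⟩
  have h := psAct_subst hP.lowers.isLocallyNilpotent hl (exp 𝕜)
  rw [hl', map_add, map_one, psAct_X, add_sub_cancel] at h
  exact h.symm

theorem sum_range_ite_one_eq_add (N : ℕ) (c : ℕ → ℕ → 𝕜) :
    (∑ i ∈ Finset.range (N + 2), ∑ j ∈ Finset.range (N + 2), if 1 = i + j then c i j else 0) =
      c 0 1 + c 1 0 := by
  rw [← Finset.sum_product', Finset.sum_ite, Finset.sum_const_zero, add_zero]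
  have : {x ∈ Finset.range (N + 2) ×ˢ Finset.range (N + 2) | 1 = x.1 + x.2} =
      {((0, 1) : ℕ × ℕ), (1, 0)} := by
    ext ⟨a, b⟩
    simp
    omega
  rw [this, Finset.sum_pair (by simp)]

/-- If all `exp(-nV) T exp(nV)` commute with `D`, then so does `[T, V]`. -/
theorem commute_rightAd_of_conj {V T D : Module.End 𝕜 L.Poly} (hV : Lowers V)
    (hT : ∀ n, ∀ p ∈ L.polyLT n, T p ∈ L.polyLT n) (hD : ∀ n, ∀ p ∈ L.polyLT n, D p ∈ L.polyLT n)
    (h : ∀ n : ℕ, Commute (psAct V hV.isLocallyNilpotent (evalNegHom (exp 𝕜)) ^ n * T *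
      psAct V hV.isLocallyNilpotent (exp 𝕜) ^ n) D) : Commute (rightAd V T) D := by
  refine LinearMap.ext fun p => poly_ext fun ω => ?_
  obtain ⟨N, hp⟩ := exists_mem_polyLT p
  -- A bound of at least `2` keeps the index pairs `(0, 1)` and `(1, 0)` in the sums.
  have hp := polyLT_mono (Nat.le_add_right N 2) hp
  have hV' : ∀ j, ∀ q ∈ L.polyLT (N + 2), (V ^ j) q ∈ L.polyLT (N + 2) := fun j q hq =>
    hV.pow_mem j _ (polyLT_mono (Nat.le_add_right _ _) hq)
  have key : ∀ n : ℕ, ∀ q ∈ L.polyLT (N + 2),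
      (psAct V hV.isLocallyNilpotent (evalNegHom (exp 𝕜)) ^ n * T *
        psAct V hV.isLocallyNilpotent (exp 𝕜) ^ n) q =
      ∑ i ∈ Finset.range (N + 2), ∑ j ∈ Finset.range (N + 2),
        ((n : 𝕜) ^ (i + j) * ((-1) ^ i * (i ! : 𝕜)⁻¹ * (j ! : 𝕜)⁻¹)) • (V ^ i) (T ((V ^ j) q)) := by
    intro n q hq
    have hq' := hV.pow_eq_zero le_rfl hq
    rw [← map_pow, ← map_pow, ← map_pow, exp_pow_eq_rescale_exp, evalNegHom, Module.End.mul_apply,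
      Module.End.mul_apply, psAct_eq_sum _ hq', map_sum, map_sum, Finset.sum_comm]
    refine Finset.sum_congr rfl fun j _ => ?_
    rw [map_smul, map_smul, psAct_eq_sum _ (hV.pow_eq_zero le_rfl (hT _ _ (hV' j q hq))),
      Finset.smul_sum]
    refine Finset.sum_congr rfl fun i _ => ?_
    rw [smul_smul]
    congr 1
    simp only [coeff_rescale, coeff_exp_eq_inv]
    ring
  -- The value at `ω` of `[exp(-nV) T exp(nV), D] p` is the polynomial `f` at `n`, with `c i j`
  -- contributing to degree `i + j`. It vanishes for all natural `n`, so its linear coefficient `c 0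
  -- 1 + c 1 0`, the value of `[[T, V], D] p` at `ω`, is zero.
  let c : ℕ → ℕ → 𝕜 := fun i j => ((-1) ^ i * (i ! : 𝕜)⁻¹ * (j ! : 𝕜)⁻¹) *
    ((V ^ i) (T ((V ^ j) (D p))) ω - D ((V ^ i) (T ((V ^ j) p))) ω)
  let f : Polynomial 𝕜 := ∑ i ∈ Finset.range (N + 2), ∑ j ∈ Finset.range (N + 2),
    Polynomial.C (c i j) * Polynomial.X ^ (i + j)
  have hf : ∀ n : ℕ, f.eval (n : 𝕜) = 0 := by
    intro n
    have h1 := congrArg (fun S : Module.End 𝕜 L.Poly => S p ω) (h n).eq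
    simp only [Module.End.mul_apply D, Module.End.mul_apply _ D] at h1
    rw [key n p hp, key n _ (hD _ _ hp)] at h1
    simp only [map_sum, map_smul, coe_sum_apply, poly_smul_apply] at h1
    rw [← sub_eq_zero, ← Finset.sum_sub_distrib] at h1
    simp only [← Finset.sum_sub_distrib] at h1
    rw [← h1]
    simp only [f, Polynomial.eval_finsetSum, Polynomial.eval_mul, Polynomial.eval_C,
      Polynomial.eval_pow, Polynomial.eval_X, c]
    refine Finset.sum_congr rfl fun i _ => Finset.sum_congr rfl fun j _ => ?_
    ring
  have hf0 : f = 0 := by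
    refine Polynomial.eq_zero_of_infinite_isRoot f ((Set.infinite_range_of_injective
      (Nat.cast_injective (R := 𝕜))).mono ?_)
    rintro _ ⟨n, rfl⟩
    exact hf n
  have h1 : f.coeff 1 = c 0 1 + c 1 0 := by
    simp only [f, Polynomial.finsetSum_coeff, Polynomial.coeff_C_mul_X_pow]
    exact sum_range_ite_one_eq_add N c
  rw [hf0, Polynomial.coeff_zero] at h1
  simp only [c, pow_zero, pow_one, Module.End.one_apply, Nat.factorial_zero, Nat.factorial_one,
    Nat.cast_one, inv_one, one_mul, mul_one] at h1
  rw [rightAd_apply, Module.End.mul_apply, Module.End.mul_apply, LinearMap.sub_apply,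
    LinearMap.sub_apply, map_sub, poly_sub_apply, poly_sub_apply]
  simp only [Module.End.mul_apply]
  linear_combination -h1

/-- If `exp(V)` solves differential equations, then all commutators `[D_σ, V]` are
shift-invariant. -/
theorem isShiftInvariant_of_solvesODE {V : Module.End 𝕜 L.Poly} (hV : Lowers V) (hc : Continuous V)
    (h : SolvesODE (psAct V hV.isLocallyNilpotent (exp 𝕜))) (σ : StrongDual 𝕜 Φ) :
    IsShiftInvariant (rightAd V (L.dirDeriv σ)) := by
  set P := psAct V hV.isLocallyNilpotent (exp 𝕜) with hP
  set Q := psAct V hV.isLocallyNilpotent (evalNegHom (exp 𝕜)) with hQ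
  have hPc : Continuous P := hV.continuous_psAct hc _
  have hQc : Continuous Q := hV.continuous_psAct hc _
  have hQP : Q * P = 1 := (psAct_exp_mul_psAct_exp_neg _).2
  -- By the differential equations, `T P = P c(d/dx)` on functions of one linear form, so
  -- conjugation by `P` preserves shift-invariance and can be iterated.
  have step : ∀ T : Module.End 𝕜 L.Poly, IsShiftInvariant T → IsShiftInvariant (Q * T * P) := by
    intro T hT
    refine .of_diffOp ((hQc.comp hT.continuous).comp hPc) fun ξ => ?_
    obtain ⟨c, hc⟩ := exists_diffOp_of_commute (Y := P.comp (L.ofLinear ξ)) (fun ρ => h ξ ρ) (by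
      rw [LinearMap.comp_apply, hP, psAct_exp_ofLinear_one hV, ofLinear_one]
      exact one_ne_zero) hT.commute
    refine ⟨c, fun p => ?_⟩
    have h1 : (Q * T * P) (L.ofLinear ξ p) = Q (T (P.comp (L.ofLinear ξ) p)) := rfl
    rw [h1, hc, LinearMap.comp_apply, ← Module.End.mul_apply, hQP, Module.End.one_apply]
  have hn : ∀ n : ℕ, IsShiftInvariant (Q ^ n * L.dirDeriv σ * P ^ n) := by
    intro n
    induction n with
    | zero => simpa using isShiftInvariant_dirDeriv σ
    | succ n ih =>
      have := step _ ih
      rwa [show Q * (Q ^ n * L.dirDeriv σ * P ^ n) * P = Q ^ (n + 1) * L.dirDeriv σ * P ^ (n + 1) by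
        rw [pow_succ', pow_succ]; noncomm_ring] at this
  have hD : ∀ (σ : StrongDual 𝕜 Φ) n, ∀ p ∈ L.polyLT n, L.dirDeriv σ p ∈ L.polyLT n :=
    fun σ n p hp => dirDeriv_mem_polyLT σ (polyLT_mono (Nat.le_succ n) hp)
  exact ⟨((continuous_dirDeriv σ).comp hc).sub (hc.comp (continuous_dirDeriv σ)),
    fun ρ => commute_rightAd_of_conj hV (hD σ) (hD ρ) fun n => (hn n).commute ρ⟩

/-! ### Coefficients -/

/-- The coefficient is `T` on homogeneous polynomials of degree `k`, divided by `k!`, so it inherits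
continuity from `T`. -/
theorem exists_coefficient {F : Type*} [AddCommGroup F] [Module 𝕜 F] [TopologicalSpace F]
    {T : L.Poly →ₗ[𝕜] F} (hT : Continuous T) (k : ℕ) : ∃ a : L.SymPow k →L[𝕜] F,
      ∀ ξ, a (L.pow k ξ) = (k ! : 𝕜)⁻¹ • T (L.ofLinear ξ (Polynomial.X ^ k)) := by
  refine ⟨⟨(T.comp (L.mono k)).comp ((k ! : 𝕜)⁻¹ • LinearMap.id),
    (hT.comp (continuous_mono k)).comp (continuous_const_smul (k ! : 𝕜)⁻¹)⟩, fun ξ => ?_⟩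
  rw [ofLinear_X_pow, ← map_smul, ← map_smul]
  rfl

theorem inv_factorial_mul (n : ℕ) (x : 𝕜) : (n ! : 𝕜)⁻¹ * (n ! * x) = x :=
  inv_mul_cancel_left₀ (Nat.cast_ne_zero.2 (Nat.factorial_ne_zero n)) x

theorem betaSeries_zero_left (σ : StrongDual 𝕜 Φ) (ξ : Φ) :
    betaSeries (0 : L.W1) σ ξ = 0 := by
  ext n
  rw [betaSeries, coeff_mk]
  rcases n with _ | _ | n <;> simp

theorem betaSeries_zero_right (β : L.W1) (ξ : Φ) : betaSeries β 0 ξ = 0 := by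
  ext n
  rw [betaSeries, coeff_mk]
  rcases n with _ | _ | n <;> simp

theorem IsGenerator.apply_ofLinear_zero {V : L.Poly →L[𝕜] L.Poly} {α : L.W0} {β : L.W1}
    (hV : IsGenerator V α β) (ξ : Φ) (p : Polynomial 𝕜) :
    V (L.ofLinear ξ p) 0 = (diffOp 𝕜 (alphaSeries α ξ) p).eval 0 := by
  rw [hV.apply_ofLinear, betaSeries_zero_right, add_zero, zero_apply]

/-- An operator that lowers the degree and whose commutators with derivatives are shift-invariant
is a generator. -/
theorem exists_isGenerator_of_rightAd {V : L.Poly →L[𝕜] L.Poly} (hV : LowersDegree V)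
    (h : ∀ σ, IsShiftInvariant (rightAd (V : L.Poly →ₗ[𝕜] L.Poly) (L.dirDeriv σ))) :
    ∃ (α : L.W0) (β : L.W1), IsGenerator V α β := by
  have := L.isTopologicalAddGroup
  obtain ⟨l, hl⟩ := exists_linearPart (L := L)
  -- At `ω = 0` the term `M(β(∇))` vanishes, so `α` is read off from the values of `V` there.
  choose α hα using fun k => exists_coefficient
    (T := (L.ev 0).comp (V : L.Poly →ₗ[𝕜] L.Poly)) ((continuous_ev 0).comp V.continuous) (k + 1)
  have hVα : ∀ ξ p, V (L.ofLinear ξ p) 0 = (diffOp 𝕜 (alphaSeries α ξ) p).eval 0 := by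
    intro ξ p
    obtain ⟨a, ha⟩ := exists_eval_zero_diffOp_eq
      ((L.ev 0).comp ((V : L.Poly →ₗ[𝕜] L.Poly).comp (L.ofLinear ξ)))
    have : a = alphaSeries α ξ := by
      ext n
      have h1 := ha (Polynomial.X ^ n)
      rw [eval_zero_diffOp_X_pow] at h1
      rw [alphaSeries, coeff_mk]
      cases n with
      | zero =>
        have h2 := hV 0 _ (ofLinear_mem_polyLT ξ (p := Polynomial.X ^ 0) (n := 1) (by simp))
        rw [polyLT_zero, Submodule.mem_bot] at h2
        have h3 : (L.ev 0) (V (L.ofLinear ξ (Polynomial.X ^ 0))) = 0 := by rw [h2, map_zero]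
        have h4 := h1.symm.trans h3
        simpa using h4
      | succ n =>
        have h2 := hα n ξ
        rw [LinearMap.comp_apply] at h1 h2
        change _ = α n (L.pow (n + 1) ξ)
        rw [h2, smul_eq_mul]
        exact (inv_factorial_mul (n + 1) _).symm.trans (congrArg _ h1.symm)
    rw [← this, ← ha]
    rfl
  obtain ⟨W₀, hW₀, hW₀'⟩ := exists_isGenerator α 0
  -- Subtracting `α(∇)` leaves the commutators with derivatives unchanged and makes all values at
  -- `0` zero.
  let V' : L.Poly →ₗ[𝕜] L.Poly := (V : L.Poly →ₗ[𝕜] L.Poly) - (W₀ : L.Poly →ₗ[𝕜] L.Poly)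
  have hV'c : Continuous V' := V.continuous.sub W₀.continuous
  have hV'0 : ∀ ξ p, V' (L.ofLinear ξ p) 0 = 0 := by
    intro ξ p
    rw [LinearMap.sub_apply, poly_sub_apply]
    exact sub_eq_zero.2 ((hVα ξ p).trans (hW₀.apply_ofLinear_zero ξ p).symm)
  have hV'l : Lowers V' := fun n p hp => sub_mem (hV n p hp) (hW₀' n p hp)
  -- Formally `V' e^{⟨·, ξ⟩} = ⟨·, β(ξ)⟩ e^{⟨·, ξ⟩}`, whose linear part at `0` is `β(ξ)`.
  choose β hβ using fun k => exists_coefficient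
    (T := (l : L.Poly →ₗ[𝕜] Φ).comp V') (l.continuous.comp hV'c) (k + 2)
  obtain ⟨W, hW, -⟩ := exists_isGenerator α β
  have hAd : ∀ σ ξ p, rightAd (V : L.Poly →ₗ[𝕜] L.Poly) (L.dirDeriv σ) (L.ofLinear ξ p) =
      L.ofLinear ξ (diffOp 𝕜 (betaSeries β σ ξ) p) := by
    intro σ ξ p
    obtain ⟨c, hc⟩ := (h σ).exists_diffOp ξ
    suffices c = betaSeries β σ ξ by rw [hc, this]
    have h1 : ∀ p, (diffOp 𝕜 c p).eval 0 = L.dirDeriv σ (V' (L.ofLinear ξ p)) 0 := by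
      intro p
      have h2 := hW₀.rightAd_dirDeriv σ ξ p
      rw [betaSeries_zero_left, map_zero, LinearMap.zero_apply, map_zero] at h2
      have h3 : rightAd V' (L.dirDeriv σ) (L.ofLinear ξ p) = L.ofLinear ξ (diffOp 𝕜 c p) := by
        have h4 : rightAd V' (L.dirDeriv σ) = rightAd (V : L.Poly →ₗ[𝕜] L.Poly) (L.dirDeriv σ) -
            rightAd (W₀ : L.Poly →ₗ[𝕜] L.Poly) (L.dirDeriv σ) := by
          simp only [rightAd_apply, V', mul_sub, sub_mul]
          abel
        rw [h4, LinearMap.sub_apply, h2, sub_zero, hc]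
      have h5 := congrArg (L.ev 0) h3
      rw [ev_apply, ev_apply, ofLinear_apply, zero_apply, rightAd_apply, LinearMap.sub_apply,
        poly_sub_apply, Module.End.mul_apply, Module.End.mul_apply, dirDeriv_ofLinear_eq_diffOp,
        hV'0, sub_zero] at h5
      exact h5.symm
    ext n
    have h2 := h1 (Polynomial.X ^ n)
    rw [eval_zero_diffOp_X_pow] at h2
    have hn : (n ! : 𝕜) ≠ 0 := Nat.cast_ne_zero.2 (Nat.factorial_ne_zero n)
    by_cases hn2 : n < 2
    -- `V'` maps degree at most `1` to constants, so the coefficients of index `0` and `1` vanish,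
    -- as `betaSeries` requires.
    · have h3 : L.dirDeriv σ (V' (L.ofLinear ξ (Polynomial.X ^ n))) ∈ L.polyLT 0 :=
        dirDeriv_mem_polyLT σ (hV'l 1 _ (ofLinear_mem_polyLT ξ (by simpa using hn2)))
      rw [polyLT_zero, Submodule.mem_bot] at h3
      rw [h3, poly_zero_apply] at h2
      rw [(mul_eq_zero.1 h2).resolve_left hn, betaSeries, coeff_mk]
      rcases n with _ | _ | n
      · rfl
      · rfl
      · omega
    · obtain ⟨k, rfl⟩ := Nat.exists_eq_add_of_le' (not_lt.1 hn2)
      rw [betaSeries, coeff_mk]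
      change _ = σ (β k (L.pow (k + 2) ξ))
      rw [hβ, map_smul, LinearMap.comp_apply, smul_eq_mul]
      refine (inv_factorial_mul (k + 2) _).symm.trans (congrArg _ (h2.trans ?_))
      exact (hl _ σ).symm
  refine ⟨α, β, ?_⟩
  -- `V - W` commutes with all derivatives and has zero values at `0` on functions of one linear
  -- form, so uniqueness applies.
  have hVW : (V : L.Poly →ₗ[𝕜] L.Poly) = (W : L.Poly →ₗ[𝕜] L.Poly) := by
    refine eq_of_ofLinear V.continuous W.continuous fun ξ p => sub_eq_zero.1 ?_
    refine eq_zero_of_dirDeriv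
      (Z := ((V : L.Poly →ₗ[𝕜] L.Poly) - (W : L.Poly →ₗ[𝕜] L.Poly)).comp (L.ofLinear ξ))
      (fun ρ => ⟨ρ ξ • X, by simp, fun p => ?_⟩) (fun p => ?_) p
    · have h1 := (hAd ρ ξ p).trans (hW.rightAd_dirDeriv ρ ξ p).symm
      rw [rightAd_apply, rightAd_apply, LinearMap.sub_apply, LinearMap.sub_apply] at h1
      simp only [Module.End.mul_apply] at h1
      rw [LinearMap.comp_apply, LinearMap.comp_apply, LinearMap.sub_apply, LinearMap.sub_apply,
        map_sub, ← dirDeriv_ofLinear_eq_diffOp]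
      rw [sub_eq_sub_iff_sub_eq_sub] at h1
      exact h1
    · rw [LinearMap.comp_apply, LinearMap.sub_apply, poly_sub_apply]
      exact sub_eq_zero.2 ((hVα ξ p).trans (hW.apply_ofLinear_zero ξ p).symm)
  intro p ω
  rw [← hW p ω]
  exact congrArg (fun S : L.Poly →ₗ[𝕜] L.Poly => S p ω) hVW

/-- A monic operator that solves differential equations is a Sheffer operator. -/
theorem isSheffer_of_solvesODE {P : L.Poly →L[𝕜] L.Poly} (hP : IsMonic P)
    (h : SolvesODE (P : L.Poly →ₗ[𝕜] L.Poly)) : IsSheffer P := by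
  obtain ⟨l, hl⟩ := exists_linearPart (L := L)
  -- At `ω = 0` the factor `exp⟨ω, B(ξ)⟩` is `1`, so `A` is the generating function there.
  choose A hA using fun k => exists_coefficient
    (T := (L.ev 0).comp (P : L.Poly →ₗ[𝕜] L.Poly)) ((continuous_ev 0).comp P.continuous) (k + 1)
  have hP1 : ∀ ξ, P (L.ofLinear ξ 1) = L.ofLinear ξ 1 := by
    intro ξ
    have := hP 0 (L.pow 0 ξ)
    rwa [polyLT_zero, Submodule.mem_bot, ← ofLinear_X_pow, pow_zero, sub_eq_zero] at this
  have hA0 : ∀ ξ, seriesF0 A ξ = genFun P 0 ξ := by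
    intro ξ
    ext n
    rw [seriesF0, genFun, coeff_mk, coeff_mk, ← ofLinear_X_pow]
    cases n with
    | zero => rw [pow_zero, hP1, ofLinear_one]; simp
    | succ n => exact hA n ξ
  have hA1 : ∀ ξ, seriesF0 A ξ = 1 + alphaSeries A ξ := by
    intro ξ
    ext n
    rw [map_add, seriesF0, alphaSeries, coeff_mk, coeff_mk, coeff_one]
    cases n <;> simp
  have hA2 : ∀ ξ, constantCoeff (seriesF0 A ξ) ≠ 0 := by
    intro ξ
    rw [← coeff_zero_eq_constantCoeff_apply, seriesF0, coeff_mk]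
    exact one_ne_zero
  obtain ⟨W, hW, hW'⟩ := exists_isGenerator A 0
  have hWl : Lowers (W : L.Poly →ₗ[𝕜] L.Poly) := hW'
  -- `1 + W` is `A(∇)` and `U` is its continuous inverse. Composing `P` with `U` removes the factor
  -- `A(ξ)`.
  let U := psAct (W : L.Poly →ₗ[𝕜] L.Poly) hWl.isLocallyNilpotent (1 + X)⁻¹
  have hU : U * (1 + (W : L.Poly →ₗ[𝕜] L.Poly)) = 1 := by
    have h1 : psAct (W : L.Poly →ₗ[𝕜] L.Poly) hWl.isLocallyNilpotent (1 + X) =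
        1 + (W : L.Poly →ₗ[𝕜] L.Poly) := by rw [map_add, map_one, psAct_X]
    rw [← h1, ← map_mul, PowerSeries.inv_mul_cancel _ (by simp), map_one]
  have hUξ : ∀ ξ p, U (L.ofLinear ξ p) = L.ofLinear ξ (diffOp 𝕜 (seriesF0 A ξ)⁻¹ p) := by
    intro ξ p
    have h1 : ∀ q, L.ofLinear ξ (diffOp 𝕜 (seriesF0 A ξ) q) =
        (1 + (W : L.Poly →ₗ[𝕜] L.Poly) : Module.End 𝕜 L.Poly) (L.ofLinear ξ q) := by
      intro q
      rw [hA1, map_add, map_one, LinearMap.add_apply, LinearMap.add_apply, map_add]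
      refine congrArg₂ (· + ·) rfl (poly_ext fun ω => ?_)
      rw [ofLinear_apply]
      refine Eq.trans ?_ (hW.apply_ofLinear ξ q ω).symm
      rw [betaSeries_zero_left, add_zero]
    have h2 : p = diffOp 𝕜 (seriesF0 A ξ) (diffOp 𝕜 (seriesF0 A ξ)⁻¹ p) := by
      rw [← Module.End.mul_apply, ← map_mul, PowerSeries.mul_inv_cancel _ (hA2 ξ), map_one]
      rfl
    conv_lhs => rw [h2]
    rw [h1, ← Module.End.mul_apply, hU, Module.End.one_apply]
  have hUc : Continuous U := hWl.continuous_psAct W.continuous _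
  -- `P U e^{⟨·, ξ⟩}` is formally `exp⟨·, B(ξ)⟩`, whose linear part is `B(ξ)`; the coefficients are
  -- continuous since `l`, `P` and `U` are.
  choose B hB using fun k => exists_coefficient
    (T := (l : L.Poly →ₗ[𝕜] Φ).comp ((P : L.Poly →ₗ[𝕜] L.Poly).comp U))
    (l.continuous.comp (P.continuous.comp hUc)) (k + 2)
  refine ⟨hP, A, B, fun ω ξ => ?_⟩
  obtain ⟨b, hb, hb'⟩ := h ξ ω
  rw [genFun_eq_of_dirDeriv hb hb', hA0]
  suffices b = pairSeriesF1 B ω ξ by rw [this]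
  ext n
  rw [pairSeriesF1, coeff_mk]
  rcases n with _ | _ | k
  · simpa using hb
  -- `P` changes `⟨·, ξ⟩` only by a constant, so applying `D_ω` shows that the linear coefficient of
  -- `b` is `ω ξ`.
  · have h1 := hb' Polynomial.X
    have h2 : diffOp 𝕜 b Polynomial.X = Polynomial.C (coeff 1 b) := by
      rw [diffOp_eq_sum (m := 2) (by simp)]
      simp [Finset.sum_range_succ, hb, Polynomial.smul_eq_C_mul]
    have h3 : P (L.ofLinear ξ Polynomial.X) - L.ofLinear ξ Polynomial.X ∈ L.polyLT 1 := by
      have := hP 1 (L.pow 1 ξ)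
      rwa [← ofLinear_X_pow, pow_one] at this
    have h4 := dirDeriv_mem_polyLT ω h3
    rw [polyLT_zero, Submodule.mem_bot, map_sub, sub_eq_zero] at h4
    rw [ContinuousLinearMap.coe_coe, h4, h2, dirDeriv_ofLinear, Polynomial.derivative_X,
      ← mul_one (Polynomial.C (coeff 1 b)), ← Polynomial.smul_eq_C_mul, map_smul,
      map_smul, hP1] at h1
    have h5 := congrArg (L.ev 0) h1
    rw [map_smul, map_smul, ev_apply, ofLinear_one] at h5
    simpa using h5.symm
  · change _ = ω (B k (L.pow (k + 2) ξ))
    rw [hB, map_smul, LinearMap.comp_apply, smul_eq_mul]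
    refine (inv_factorial_mul (k + 2) _).symm.trans (congrArg _ ?_)
    refine Eq.trans ?_ (hl _ ω).symm
    rw [LinearMap.comp_apply, hUξ, hb', diffOp_comm]
    refine Eq.trans ?_ (apply_ofLinear_eq_genFun P 0 ξ _).symm
    -- The factor `A(ξ)` from evaluating `P` at `0` cancels the `A(ξ)⁻¹` coming from `U`, leaving
    -- the coefficient of `b`.
    rw [← hA0, ← Module.End.mul_apply, ← map_mul, PowerSeries.mul_inv_cancel _ (hA2 ξ), map_one,
      Module.End.one_apply, eval_zero_diffOp_X_pow]

end LBSpace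

end

theorem mainTheorem4 {𝕜 : Type*} [RCLike 𝕜] {E : ℕ → Type*}
    [∀ n, NormedAddCommGroup (E n)] [∀ n, NormedSpace 𝕜 (E n)] [∀ n, CompleteSpace (E n)]
    {Φ : Type*} [AddCommGroup Φ] [Module 𝕜 Φ] [TopologicalSpace Φ]
    (L : LBSpace 𝕜 E Φ) :
    (∀ (α : L.W0) (β : L.W1), ∃ V : L.Poly →L[𝕜] L.Poly,
      LBSpace.IsGenerator V α β ∧ LBSpace.LowersDegree V) ∧
    ∀ P : L.Poly →L[𝕜] L.Poly, LBSpace.IsMonic P →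
      (LBSpace.IsSheffer P ↔
        ∃ (α : L.W0) (β : L.W1) (V : L.Poly →L[𝕜] L.Poly),
          LBSpace.IsGenerator V α β ∧ ∀ p : L.Poly, P p = LBSpace.expOp V p) := by
  refine ⟨LBSpace.exists_isGenerator, fun P hP => ⟨?_, ?_⟩⟩
  · rintro ⟨-, A, B, h⟩
    have hode := LBSpace.solvesODE_of_genFun h
    obtain ⟨V, hV, hc, hPV⟩ := hP.exists_log
    rw [hPV] at hode
    have hsi := LBSpace.isShiftInvariant_of_solvesODE hV hc hode
    obtain ⟨α, β, hgen⟩ := LBSpace.exists_isGenerator_of_rightAd (V := ⟨V, hc⟩) hV hsi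
    refine ⟨α, β, ⟨V, hc⟩, hgen, fun p => ?_⟩
    rw [LBSpace.expOp_eq_psAct hV.isLocallyNilpotent]
    exact congrArg (fun S : Module.End 𝕜 L.Poly => S p) hPV
  · rintro ⟨α, β, V, hgen, hPV⟩
    have hV : LBSpace.Lowers (V : L.Poly →ₗ[𝕜] L.Poly) := hgen.lowersDegree
    have hode := LBSpace.solvesODE_psAct_exp hV V.continuous hgen.isShiftInvariant
    have hPV' : psAct (V : L.Poly →ₗ[𝕜] L.Poly) hV.isLocallyNilpotent (PowerSeries.exp 𝕜) =
        (P : L.Poly →ₗ[𝕜] L.Poly) :=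
      LinearMap.ext fun p => ((hPV p).trans (LBSpace.expOp_eq_psAct hV.isLocallyNilpotent p)).symm
    rw [hPV'] at hode
    exact LBSpace.isSheffer_of_solvesODE hP hode
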